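/- Let $\Bbbk$ be a field of characteristic zero, let $n\ge 2$, and let the symmetric group $\mathfrak S_n$ act on the standard graded polynomial ring $R=\Bbbk[x_1,\dots,x_n]$ by permuting the variables; put $\mathfrak m=(x_1,\dots,x_n)$. For a partition $\lambda$ of $n$ let $S^\lambda$ be the corresponding irreducible representation (Specht module) of $\mathfrak S_n$ over $\Bbbk$ and $\chi^\lambda$ its character. For a graded representation $V=\bigoplus_{e\ge 0}V_e$ of $\mathfrak S_n$ with finite-dimensional components, the graded character is $\chi_V=\sum_{e}\chi_{V_e}t^e\in\mathcal C[[t]]$, where $\mathcal C$ is the ring of $\Bbbk$-valued class functions on $\mathfrak S_n$ with pointwise operations. Let $I\subseteq R$ be a homogeneous $\mathfrak S_n$-stable ideal which is a complete intersection ideal, i.e. is generated by a regular sequence. Assume that $I/\mathfrak mI$ is isomorphic, as a graded representation of $\mathfrak S_n$, to the direct sum of one copy of the standard representation $S^{(n-1,1)}$ in degree $d$ and $m\ge 0$ trivial representations in degrees $c_1,\dots,c_m$. Then the graded character of $R/I$ is $$\chi_{R/I}=\chi_R\left(\sum_{u=0}^{n-1}(-1)^u\chi^{(n-u,1^u)}t^{du}\right)\prod_{i=1}^m(1-t^{c_i}).$$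 -/

import Mathlib

open MvPolynomial

noncomputable section

namespace SymCI

/-! ### Class functions and graded characters -/

/-- The commutative ring of class functions on a group `G` with values in `k`,
with pointwise operations. -/
def ClassFunction (k G : Type*) [Field k] [Group G] : Subring (G → k) where
  carrier := {f | ∀ g h : G, f (h * g * h⁻¹) = f g}
  zero_mem' := fun _ _ => rfl
  one_mem' := fun _ _ => rfl
  add_mem' := fun ha hb g h => by simp only [Pi.add_apply, ha g h, hb g h]
  mul_mem' := fun ha hb g h => by simp only [Pi.mul_apply, ha g h, hb g h]
  neg_mem' := fun ha g h => by simp only [Pi.neg_apply, ha g h]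

section Graded

variable {k G V W : Type*} [Field k] [Group G] [AddCommMonoid V] [Module k V]
  [AddCommMonoid W] [Module k W]

/-- Two graded representations are isomorphic: there is an equivariant linear isomorphism
which matches the homogeneous components. -/
def GradedIso {ρ : Representation k G V} {σ : Representation k G W}
    (𝒱 : ℕ → Subrepresentation ρ) (𝒲 : ℕ → Subrepresentation σ) : Prop :=
  ∃ Φ : ρ.Equiv σ, ∀ (e : ℕ) (x : V), x ∈ 𝒱 e ↔ Φ x ∈ 𝒲 e

/-- The graded representation `σ ⊕ k^m`, with `σ` placed in degree `d` and the `i`-th copy of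
the trivial representation placed in degree `c i`: the component of degree `e`. -/
def sumTrivialGrading (σ : Representation k G W) (d : ℕ) {m : ℕ} (c : Fin m → ℕ) (e : ℕ) :
    Subrepresentation (σ.prod (Representation.trivial k G (Fin m → k))) where
  toSubmodule :=
    { carrier := {x | (e ≠ d → x.1 = 0) ∧ ∀ i, e ≠ c i → x.2 i = 0}
      zero_mem' := ⟨fun _ => rfl, fun _ _ => rfl⟩
      add_mem' := fun {x y} hx hy =>
        ⟨fun h => by simp [hx.1 h, hy.1 h], fun i h => by simp [hx.2 i h, hy.2 i h]⟩
      smul_mem' := fun a x hx =>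
        ⟨fun h => by simp [hx.1 h], fun i h => by simp [hx.2 i h]⟩ }
  apply_mem_toSubmodule := by
    intro g x hx
    exact ⟨fun h => by simp [hx.1 h], fun i h => by simpa using hx.2 i h⟩

end Graded

section Generic

variable {k G V : Type*} [Field k] [Group G] [AddCommGroup V] [Module k V]

/-- The character `g ↦ trace (ρ g)` of a representation, as a class function. -/
def charClass (ρ : Representation k G V) : ClassFunction k G :=
  ⟨ρ.character, fun g h => ρ.char_conj g h⟩

/-- The graded character `∑ₑ χ_{Vₑ} tᵉ` of a representation with homogeneous components
`𝒱 e`, `e ∈ ℕ`, as a power series over the ring of class functions. -/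
def gradedChar {ρ : Representation k G V} (𝒱 : ℕ → Subrepresentation ρ) :
    PowerSeries (ClassFunction k G) :=
  PowerSeries.mk fun e => charClass (𝒱 e).toRepresentation

/-- The quotient of a representation by a subrepresentation. -/
abbrev quotRep {ρ : Representation k G V} (U : Subrepresentation ρ) :
    Representation k G (V ⧸ U.toSubmodule) :=
  ρ.quotient U.toSubmodule fun g _ hv => U.apply_mem_toSubmodule g hv

/-- The homogeneous components of a quotient: the images of those of the whole space. -/
def quotGrading {ρ : Representation k G V} (𝒱 : ℕ → Subrepresentation ρ)
    (U : Subrepresentation ρ) (e : ℕ) : Subrepresentation (quotRep U) where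
  toSubmodule := (𝒱 e).toSubmodule.map U.toSubmodule.mkQ
  apply_mem_toSubmodule := by
    rintro g _ ⟨v, hv, rfl⟩
    exact ⟨ρ g v, (𝒱 e).apply_mem_toSubmodule g hv, rfl⟩

/-- The part of a subrepresentation `B` of `ρ` that lies in the subrepresentation `A`,
as a subrepresentation of `A`. -/
def subrepOf {ρ : Representation k G V} (B A : Subrepresentation ρ) :
    Subrepresentation A.toRepresentation where
  toSubmodule := B.toSubmodule.submoduleOf A.toSubmodule
  apply_mem_toSubmodule := fun g _ hv => B.apply_mem_toSubmodule g hv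

end Generic

/-! ### Specht modules -/

section Specht

variable (k : Type*) [Field k] {n : ℕ}

/-- The permutation representation of the symmetric group on row assignments. A tabloid of
shape `μ` is recorded by the function sending each entry to the index of its row, and `σ` acts
by replacing each entry `i` by `σ i`. -/
def tabloidRep (n : ℕ) : Representation k (Equiv.Perm (Fin n)) ((Fin n → ℕ) →₀ k) where
  toFun σ := Finsupp.lmapDomain k k fun r i => r (σ⁻¹ i)
  map_one' := by ext; simp
  map_mul' σ τ := by ext; simp

/-- The column stabilizer of a Young tableau `T` (a bijective filling of the boxes). -/
def columnStabilizer {μ : YoungDiagram} (T : μ.cells ≃ Fin n) :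
    Finset (Equiv.Perm (Fin n)) :=
  {π | ∀ i, (T.symm (π i)).1.2 = (T.symm i).1.2}

/-- The polytabloid `∑ sgn(π) π{T}`, where `π` runs over the column stabilizer of `T` and
`{T}` is the tabloid of `T`. -/
def polytabloid {μ : YoungDiagram} (T : μ.cells ≃ Fin n) : (Fin n → ℕ) →₀ k :=
  ∑ π ∈ columnStabilizer T, ((Equiv.Perm.sign π : ℤ) : k) •
    tabloidRep k n π (Finsupp.single (fun i => (T.symm i).1.1) 1)

theorem tabloidRep_polytabloid {μ : YoungDiagram} (T : μ.cells ≃ Fin n)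
    (σ : Equiv.Perm (Fin n)) :
    tabloidRep k n σ (polytabloid k T) = polytabloid k (T.trans σ) := by
  unfold polytabloid
  rw [map_sum]
  refine Finset.sum_bij (fun π _ => σ * π * σ⁻¹) ?_ ?_ ?_ ?_
  · intro π hπ
    simp only [columnStabilizer, Finset.mem_filter, Finset.mem_univ, true_and] at hπ ⊢
    intro i
    simpa using hπ (σ⁻¹ i)
  · intro a _ b _ h
    simpa using h
  · intro π hπ
    refine ⟨σ⁻¹ * π * σ, ?_, by group⟩
    simp only [columnStabilizer, Finset.mem_filter, Finset.mem_univ, true_and] at hπ ⊢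
    intro i
    simpa [Equiv.Perm.inv_def] using hπ (σ i)
  · intro π _
    rw [map_smul]
    congr 1
    · rw [Equiv.Perm.sign_mul, Equiv.Perm.sign_mul, Equiv.Perm.sign_inv, mul_right_comm,
        Int.units_mul_self, one_mul]
    · simp only [tabloidRep, MonoidHom.coe_mk, OneHom.coe_mk, Finsupp.lmapDomain_apply,
        Finsupp.mapDomain_single]
      congr 1
      funext i
      simp [Equiv.Perm.inv_def]

/-- The Specht module `S^μ` over `k` for a partition `μ` of `n` (given by its Young diagram):
the span of the polytabloids of all tableaux of shape `μ`. -/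
def spechtModule (n : ℕ) (μ : YoungDiagram) : Subrepresentation (tabloidRep k n) where
  toSubmodule := Submodule.span k (Set.range fun T : μ.cells ≃ Fin n => polytabloid k T)
  apply_mem_toSubmodule := by
    intro σ v hv
    induction hv using Submodule.span_induction with
    | mem x hx =>
      obtain ⟨T, rfl⟩ := hx
      exact Submodule.subset_span ⟨T.trans σ, (tabloidRep_polytabloid k T σ).symm⟩
    | zero => simp
    | add x y _ _ hx hy => rw [map_add]; exact Submodule.add_mem _ hx hy
    | smul a x _ hx => rw [map_smul]; exact Submodule.smul_mem _ a hx

/-- The representation `S^μ` of the symmetric group. -/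
abbrev spechtRep (n : ℕ) (μ : YoungDiagram) :
    Representation k (Equiv.Perm (Fin n)) (spechtModule k n μ).toSubmodule :=
  (spechtModule k n μ).toRepresentation

/-- The irreducible character `χ^μ` of the symmetric group. -/
def spechtChar (n : ℕ) (μ : YoungDiagram) : ClassFunction k (Equiv.Perm (Fin n)) :=
  charClass (V := (spechtModule k n μ).toSubmodule) (spechtRep k n μ)

/-- The Young diagram of the hook partition `(n - u, 1^u)` of `n`, for `0 ≤ u ≤ n - 1`. -/
def hook (n : ℕ) (u : Fin n) : YoungDiagram :=
  YoungDiagram.ofRowLens ((n - u) :: List.replicate u 1) <| by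
    rw [List.sortedGE_iff_pairwise, List.pairwise_cons]
    refine ⟨fun a ha => ?_, ?_⟩
    · rw [List.eq_of_mem_replicate ha]
      have := u.2
      omega
    · exact List.pairwise_replicate.2 (Or.inr le_rfl)

/-- The Young diagram of the partition `(n - 1, 1)`, for `n ≥ 2`. -/
def standardShape (n : ℕ) (hn : 2 ≤ n) : YoungDiagram :=
  YoungDiagram.ofRowLens [n - 1, 1] <| by
    rw [List.sortedGE_iff_pairwise]
    simp
    omega

end Specht

/-! ### The polynomial ring and its stable ideals -/

section Poly

variable {k : Type*} [Field k] {n : ℕ}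

variable (k n) in
/-- The symmetric group acts on `k[x₁, …, xₙ]` by permuting the variables. -/
def polyRep : Representation k (Equiv.Perm (Fin n)) (MvPolynomial (Fin n) k) where
  toFun σ := (rename σ : MvPolynomial (Fin n) k →ₐ[k] MvPolynomial (Fin n) k).toLinearMap
  map_one' := by ext; simp
  map_mul' σ τ := by
    refine LinearMap.ext fun p => ?_
    simp [rename_rename, Equiv.Perm.coe_mul]

variable (k n) in
/-- The standard grading of `k[x₁, …, xₙ]`. -/
def polyGrading (e : ℕ) : Subrepresentation (polyRep k n) where
  toSubmodule := homogeneousSubmodule (Fin n) k e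
  apply_mem_toSubmodule := fun _ _ hv => IsHomogeneous.rename_isHomogeneous hv

attribute [local instance] MvPolynomial.gradedAlgebra in
/-- The ideal is homogeneous for the standard grading. -/
def IsHomogeneousIdeal (I : Ideal (MvPolynomial (Fin n) k)) : Prop :=
  I.IsHomogeneous (homogeneousSubmodule (Fin n) k)

/-- The ideal is stable under all permutations of the variables. -/
def IsSymStable (I : Ideal (MvPolynomial (Fin n) k)) : Prop :=
  ∀ σ : Equiv.Perm (Fin n), ∀ f ∈ I, rename σ f ∈ I

/-- The ideal is generated by a regular sequence. -/
def IsCompleteIntersection {R : Type*} [CommRing R] (I : Ideal R) : Prop :=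
  ∃ rs : List R, RingTheory.Sequence.IsRegular R rs ∧ Ideal.ofList rs = I

variable (k n) in
/-- The irrelevant ideal `(x₁, …, xₙ)`. -/
def irrelevant : Ideal (MvPolynomial (Fin n) k) := Ideal.span (Set.range X)

theorem IsSymStable.irrelevant_mul {I : Ideal (MvPolynomial (Fin n) k)} (hI : IsSymStable I) :
    IsSymStable (irrelevant k n * I) := by
  intro σ f hf
  induction hf using Submodule.mul_induction_on' with
  | mem_mul_mem a ha b hb =>
    rw [map_mul]
    refine Ideal.mul_mem_mul ?_ (hI σ b hb)
    have h : irrelevant k n ≤ (irrelevant k n).comap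
        (rename σ : MvPolynomial (Fin n) k →ₐ[k] MvPolynomial (Fin n) k) := by
      refine Ideal.span_le.2 ?_
      rintro _ ⟨i, rfl⟩
      have h : (X (σ i) : MvPolynomial (Fin n) k) ∈ irrelevant k n :=
        Ideal.subset_span ⟨σ i, rfl⟩
      simpa using h
    exact h ha
  | add x _ y _ hx hy => rw [map_add]; exact Ideal.add_mem _ hx hy

/-- A stable ideal, as a subrepresentation of the polynomial ring. -/
def idealRep (I : Ideal (MvPolynomial (Fin n) k)) (hI : IsSymStable I) :
    Subrepresentation (polyRep k n) where
  toSubmodule := I.restrictScalars k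
  apply_mem_toSubmodule := fun σ f hf => hI σ f hf

/-- The graded representation `R/I`: its components as subrepresentations of `R/I`. -/
def quotientGrading (I : Ideal (MvPolynomial (Fin n) k)) (hI : IsSymStable I) (e : ℕ) :
    Subrepresentation (quotRep (idealRep I hI)) :=
  quotGrading (polyGrading k n) (idealRep I hI) e

/-- The subrepresentation `𝔪I` of `I`, where `𝔪` is the irrelevant ideal. -/
def irrelevantMulIn (I : Ideal (MvPolynomial (Fin n) k)) (hI : IsSymStable I) :
    Subrepresentation (idealRep I hI).toRepresentation :=
  subrepOf (idealRep (irrelevant k n * I) hI.irrelevant_mul) (idealRep I hI)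

/-- The graded representation `I/𝔪I`: its components, the images of the homogeneous components
of `I`, as subrepresentations of `I/𝔪I`. -/
def generatorGrading (I : Ideal (MvPolynomial (Fin n) k)) (hI : IsSymStable I) (e : ℕ) :
    Subrepresentation (quotRep (irrelevantMulIn I hI)) :=
  quotGrading (fun e => subrepOf (polyGrading k n e) (idealRep I hI)) (irrelevantMulIn I hI) e

end Poly

end SymCI

end

/-! Fix a permutation σ; every graded character becomes a power series of traces of σ. Write P(t)
for the trace series of σ on R, Q(t) for that on R/I, and H(t) = Σ (-1)^u χ^{(n-u,1^u)}(σ) t^u.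

Because the characteristic is zero, the generators can be lifted equivariantly
(`exists_equivariant_generators`): f_1, …, f_n of degree d, permuted by the group and with sum zero,
and invariant z_j of degree c_j. Without f_n they form a minimal generating family of I. It has as
many members as the regular sequence, since both numbers are dim I/𝔪I, and this makes it
quasi-regular (`isQuasiRegular_of_minimal_generators`). Let A be a stable graded complement of I in
R. By quasi-regularity the evaluation A[Y_1, …, Y_{n-1}, Z_1, …, Z_m] → R is bijective. To keep the
symmetry one uses all n variables Y_i: evaluation is then onto, and its kernel consists of the
multiples of Y_1 + … + Y_n (`traceOn_weightedPart_relation`). Only monomials fixed by σ contribute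
to a trace, whence (`mk_fixedMonomials_eq`) P(t) = (1 - t^d) P(t^d) Q(t) / ∏ (1 - t^{c_j}).

It remains to show (1 - t) H(t) P(t) = 1 and to substitute t^d for t. Exactness of the Koszul
complex of R gives P(t) · Σ (-1)^u tr(σ | Λ^u) t^u = 1 (`altTrace_mul_fixedMonomials`). Exactness of
the augmented chain complex of the simplex gives tr Λ^u = tr B_u + tr B_{u-1}, with B_u the
boundaries in Λ^u (`altTrace_succ`). Finally B_u is the Specht module of the hook (n-u, 1^u),
because the polytabloids of a hook are the boundaries of determinant forms (`spechtModule_hook`). -/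

noncomputable section

namespace SymCI

/-! ### Traces on stable subspaces -/

section TraceOn

variable {k V W : Type*} [Field k] [AddCommGroup V] [Module k V] [AddCommGroup W] [Module k W]

open Classical in
/-- The trace of an endomorphism on a stable subspace (zero if the subspace is not stable). -/
def traceOn (τ : Module.End k V) (U : Submodule k V) : k :=
  if h : ∀ x ∈ U, τ x ∈ U then LinearMap.trace k U (τ.restrict h) else 0

theorem traceOn_eq_trace {τ : Module.End k V} {U : Submodule k V} (h : ∀ x ∈ U, τ x ∈ U) :
    traceOn τ U = LinearMap.trace k U (τ.restrict h) := dif_pos h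

@[simp] theorem traceOn_bot (τ : Module.End k V) : traceOn τ ⊥ = 0 := by
  have h : ∀ x ∈ (⊥ : Submodule k V), τ x ∈ (⊥ : Submodule k V) := by simp
  rw [traceOn_eq_trace h, Subsingleton.elim (τ.restrict h) 0, map_zero]

theorem traceOn_congr {τ τ' : Module.End k V} {U : Submodule k V} (h : ∀ x ∈ U, τ x = τ' x) :
    traceOn τ U = traceOn τ' U := by
  by_cases hU : ∀ x ∈ U, τ x ∈ U
  · have hU' : ∀ x ∈ U, τ' x ∈ U := fun x hx => h x hx ▸ hU x hx
    rw [traceOn_eq_trace hU, traceOn_eq_trace hU']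
    congr 1
    ext x
    simpa using h x x.2
  · have hU' : ¬ ∀ x ∈ U, τ' x ∈ U := fun H => hU fun x hx => (h x hx).symm ▸ H x hx
    rw [traceOn, traceOn, dif_neg hU, dif_neg hU']

theorem traceOn_zero (U : Submodule k V) : traceOn (0 : Module.End k V) U = 0 := by
  have h : ∀ x ∈ U, (0 : Module.End k V) x ∈ U := by simp
  rw [traceOn_eq_trace h]
  convert map_zero (LinearMap.trace k U)
  ext x
  rfl

theorem character_toRepresentation {G : Type*} [Group G] {ρ : Representation k G V}
    (U : Subrepresentation ρ) (g : G) :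
    U.toRepresentation.character g = traceOn (ρ g) U.toSubmodule := by
  rw [traceOn_eq_trace (U.apply_mem_toSubmodule g)]
  rfl

/-- The trace of an endomorphism of a finite direct sum is the sum of the traces of its diagonal
blocks. -/
theorem traceOn_eq_sum {α : Type*} (s : Finset α) {X : α → Type*} [∀ a, AddCommGroup (X a)]
    [∀ a, Module k (X a)] {τ : Module.End k V} {U : Submodule k V} [FiniteDimensional k U]
    (hU : ∀ x ∈ U, τ x ∈ U) (Y : ∀ a, Submodule k (X a)) [∀ a, FiniteDimensional k (Y a)]
    (i : ∀ a, X a →ₗ[k] V) (p : ∀ a, V →ₗ[k] X a) (hi : ∀ a ∈ s, ∀ w ∈ Y a, i a w ∈ U)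
    (hp : ∀ a ∈ s, ∀ x ∈ U, p a x ∈ Y a) (hsum : ∀ x ∈ U, ∑ a ∈ s, i a (p a x) = x) :
    traceOn τ U = ∑ a ∈ s, traceOn (p a ∘ₗ τ ∘ₗ i a) (Y a) := by
  have hst : ∀ a ∈ s, ∀ w ∈ Y a, (p a ∘ₗ τ ∘ₗ i a) w ∈ Y a := fun a ha w hw =>
    hp a ha _ (hU _ (hi a ha w hw))
  let I : ∀ a : s, Y a →ₗ[k] U := fun a => (i a).restrict (hi a a.2)
  let P : ∀ a : s, U →ₗ[k] Y a := fun a => (p a).restrict (hp a a.2)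
  -- Only this resolution of the identity is used, not the orthogonality of the blocks: cyclicity of
  -- the trace turns each tr(τ I P) into tr(P τ I).
  have hid : ∑ a : s, I a ∘ₗ P a = LinearMap.id := by
    ext x
    simp only [LinearMap.sum_apply, LinearMap.comp_apply, Submodule.coe_sum, LinearMap.id_apply]
    have := hsum x x.2
    rw [← Finset.sum_coe_sort] at this
    exact this
  rw [traceOn_eq_trace hU, ← Finset.sum_coe_sort]
  calc LinearMap.trace k U (τ.restrict hU)
      = LinearMap.trace k U (τ.restrict hU ∘ₗ ∑ a : s, I a ∘ₗ P a) := by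
        rw [hid, LinearMap.comp_id]
    _ = ∑ a : s, LinearMap.trace k U ((τ.restrict hU ∘ₗ I a) ∘ₗ P a) := by
        rw [← map_sum]
        congr 1
        ext x
        simp
    _ = _ := by
        refine Finset.sum_congr rfl fun a _ => ?_
        rw [LinearMap.trace_comp_comm', traceOn_eq_trace (hst a a.2)]
        rfl

/-- The trace is additive along a surjection. -/
theorem traceOn_eq_ker_add_map {τ : Module.End k V} {τ' : Module.End k W} (φ : V →ₗ[k] W)
    {U : Submodule k V} [FiniteDimensional k U] (hφ : ∀ x ∈ U, φ (τ x) = τ' (φ x))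
    (hU : ∀ x ∈ U, τ x ∈ U) :
    traceOn τ U = traceOn τ (U ⊓ LinearMap.ker φ) + traceOn τ' (U.map φ) := by
  let Φ : U →ₗ[k] U.map φ := φ.restrict fun x hx => Submodule.mem_map_of_mem hx
  obtain ⟨s, hs⟩ := Φ.exists_rightInverse_of_surjective (LinearMap.range_eq_top.2 (by
    rintro ⟨_, x, hx, rfl⟩
    exact ⟨⟨x, hx⟩, rfl⟩))
  have hs' : ∀ y : U.map φ, φ (s y) = y := fun y => congrArg Subtype.val (LinearMap.congr_fun hs y)
  have hK : ∀ x ∈ U ⊓ LinearMap.ker φ, τ x ∈ U ⊓ LinearMap.ker φ := fun x hx =>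
    ⟨hU x hx.1, LinearMap.mem_ker.2 <| by rw [hφ x hx.1, LinearMap.mem_ker.1 hx.2, map_zero]⟩
  have hM : ∀ y ∈ U.map φ, τ' y ∈ U.map φ := by
    rintro _ ⟨x, hx, rfl⟩
    exact ⟨τ x, hU x hx, hφ x hx⟩
  have hle : U ⊓ LinearMap.ker φ ≤ U := inf_le_left
  have : FiniteDimensional k (U ⊓ LinearMap.ker φ : Submodule k V) :=
    Submodule.finiteDimensional_of_le hle
  let ι := Submodule.inclusion hle
  -- The projection `x ↦ x - s (Φ x)` onto the kernel. The section `s` need not commute with τ; it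
  -- enters only through the splitting of the identity under the trace.
  let π : U →ₗ[k] (U ⊓ LinearMap.ker φ : Submodule k V) :=
    LinearMap.codRestrict _ (U.subtype - U.subtype ∘ₗ s ∘ₗ Φ) fun x => by
      refine ⟨Submodule.sub_mem _ x.2 (s _).2, LinearMap.mem_ker.2 ?_⟩
      have := hs' (Φ x)
      change φ (x - s (Φ x)) = 0
      rw [map_sub, this]
      exact sub_self _
  have hid : ι ∘ₗ π + s ∘ₗ Φ = LinearMap.id := by
    ext x
    exact sub_add_cancel (x : V) _
  rw [traceOn_eq_trace hU, traceOn_eq_trace hK, traceOn_eq_trace hM]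
  calc LinearMap.trace k U (τ.restrict hU)
      = LinearMap.trace k U ((τ.restrict hU ∘ₗ ι) ∘ₗ π) +
          LinearMap.trace k U ((τ.restrict hU ∘ₗ s) ∘ₗ Φ) := by
        rw [← map_add, LinearMap.comp_assoc, LinearMap.comp_assoc, ← LinearMap.comp_add, hid,
          LinearMap.comp_id]
    _ = _ := by
        rw [LinearMap.trace_comp_comm', LinearMap.trace_comp_comm' Φ (τ.restrict hU ∘ₗ s)]
        congr 2
        · ext x
          have := hφ x x.2.1
          rw [LinearMap.mem_ker.1 x.2.2, map_zero] at this
          have h0 : Φ ⟨τ x, hU x x.2.1⟩ = 0 := Subtype.ext this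
          change τ x - (s (Φ ⟨τ x, hU x x.2.1⟩) : V) = τ x
          simp [h0]
        · ext y
          change φ (τ (s y)) = τ' y
          rw [hφ _ (s y).2, hs']

theorem traceOn_map_of_injOn {τ : Module.End k V} {τ' : Module.End k W} (φ : V →ₗ[k] W)
    {U : Submodule k V} [FiniteDimensional k U] (hφ : ∀ x ∈ U, φ (τ x) = τ' (φ x))
    (hU : ∀ x ∈ U, τ x ∈ U) (hinj : ∀ x ∈ U, φ x = 0 → x = 0) :
    traceOn τ' (U.map φ) = traceOn τ U := by
  have h : U ⊓ LinearMap.ker φ = ⊥ := by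
    rw [eq_bot_iff]
    exact fun x hx => (Submodule.mem_bot k).2 (hinj x hx.1 hx.2)
  rw [traceOn_eq_ker_add_map φ hφ hU, h, traceOn_bot, zero_add]

theorem traceOn_top (τ : Module.End k V) [FiniteDimensional k V] :
    traceOn τ ⊤ = LinearMap.trace k V τ := by
  have h : ∀ x ∈ (⊤ : Submodule k V), τ x ∈ (⊤ : Submodule k V) := by simp
  rw [traceOn_eq_trace h, ← LinearMap.trace_conj' (τ.restrict h) Submodule.topEquiv]
  congr 1

end TraceOn

/-! ### Regular sequences are quasi-regular -/

section QuasiRegular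

variable {R ι : Type*} [CommRing R]

/-- A family of elements is quasi-regular if the only homogeneous polynomial relations of degree
`s` between its members modulo the `(s + 1)`-st power of the ideal they generate are those with
coefficients in that ideal. -/
def IsQuasiRegular (a : ι → R) : Prop :=
  ∀ (s : ℕ) (F : MvPolynomial ι R), F.IsHomogeneous s →
    eval a F ∈ Ideal.span (Set.range a) ^ (s + 1) → ∀ m, coeff m F ∈ Ideal.span (Set.range a)

theorem eval_mem_pow {a : ι → R} {s : ℕ} {F : MvPolynomial ι R} (hF : F.IsHomogeneous s) :
    eval a F ∈ Ideal.span (Set.range a) ^ s :=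
  (Ideal.mem_span_pow_iff_exists_isHomogeneous a _).2 ⟨F, hF, rfl⟩

theorem eval_mem_pow_succ {a : ι → R} {s : ℕ} {F : MvPolynomial ι R} (hF : F.IsHomogeneous s)
    (hc : ∀ m, coeff m F ∈ Ideal.span (Set.range a)) :
    eval a F ∈ Ideal.span (Set.range a) ^ (s + 1) := by
  rw [F.as_sum, map_sum]
  refine Ideal.sum_mem _ fun m hm => ?_
  rw [← mul_one (coeff m F), ← C_mul_monomial, map_mul, eval_C, pow_succ']
  refine Ideal.mul_mem_mul (hc m) (eval_mem_pow (isHomogeneous_monomial _ ?_))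
  have := hF (mem_support_iff.1 hm)
  rw [← this]
  exact DFunLike.congr_fun Finsupp.degree_eq_weight_one m

theorem exists_eval_eq_of_mem_pow_succ {a : ι → R} {s : ℕ} {x : R}
    (hx : x ∈ Ideal.span (Set.range a) ^ (s + 1)) :
    ∃ G : MvPolynomial ι R, G.IsHomogeneous s ∧ (∀ m, coeff m G ∈ Ideal.span (Set.range a)) ∧
      eval a G = x := by
  rw [pow_succ'] at hx
  induction hx using Submodule.mul_induction_on' with
  | mem_mul_mem b hb y hy =>
    obtain ⟨P, hP, rfl⟩ := (Ideal.mem_span_pow_iff_exists_isHomogeneous a _).1 hy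
    refine ⟨C b * P, by simpa using (isHomogeneous_C ι b).mul hP, fun m => ?_, by simp⟩
    rw [coeff_C_mul]
    exact Ideal.mul_mem_right _ _ hb
  | add x _ y _ hx hy =>
    obtain ⟨G, hG, hGc, rfl⟩ := hx
    obtain ⟨H, hH, hHc, rfl⟩ := hy
    refine ⟨G + H, hG.add hH, fun m => ?_, by simp⟩
    rw [coeff_add]
    exact Ideal.add_mem _ (hGc m) (hHc m)

/-- Reduces quasi-regularity to exact relations: an element of the (s+1)-st power is the value of a
form of degree s with coefficients in the ideal, and this form may be subtracted from `F`. -/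
theorem coeff_mem_of_eval_mem_pow_succ {a : ι → R} {s : ℕ}
    (h : ∀ F : MvPolynomial ι R, F.IsHomogeneous s → eval a F = 0 →
      ∀ m, coeff m F ∈ Ideal.span (Set.range a)) {F : MvPolynomial ι R} (hF : F.IsHomogeneous s)
    (hx : eval a F ∈ Ideal.span (Set.range a) ^ (s + 1)) (m : ι →₀ ℕ) :
    coeff m F ∈ Ideal.span (Set.range a) := by
  obtain ⟨G, hG, hGc, hGF⟩ := exists_eval_eq_of_mem_pow_succ hx
  have := h (F - G) (hF.sub hG) (by simp [hGF]) m
  rw [coeff_sub] at this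
  exact (Submodule.sub_mem_iff_left _ (hGc m)).1 this

theorem finSuccEquiv_rename_succ {r : ℕ} (G : MvPolynomial (Fin r) R) :
    finSuccEquiv R r (rename Fin.succ G) = Polynomial.C G := by
  have : ((finSuccEquiv R r : MvPolynomial (Fin (r + 1)) R →ₐ[R] _).comp (rename Fin.succ)) =
      Polynomial.CAlgHom := by
    ext i : 1
    simp [finSuccEquiv_X_succ]
  exact AlgHom.congr_fun this G

theorem exists_eq_rename_add_X_mul {r s : ℕ} {F : MvPolynomial (Fin (r + 1)) R}
    (hF : F.IsHomogeneous (s + 1)) :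
    ∃ (G : MvPolynomial (Fin r) R) (H : MvPolynomial (Fin (r + 1)) R),
      G.IsHomogeneous (s + 1) ∧ H.IsHomogeneous s ∧ F = rename Fin.succ G + X 0 * H ∧
      (∀ m, coeff (Finsupp.cons 0 m) F = coeff m G) ∧
      ∀ i m, coeff (Finsupp.cons (i + 1) m) F = coeff (Finsupp.cons i m) H := by
  set p := finSuccEquiv R r F with hp
  have hH : ∀ i m, coeff (Finsupp.cons (i + 1) m) F =
      coeff (Finsupp.cons i m) ((finSuccEquiv R r).symm p.divX) := by
    intro i m
    rw [← finSuccEquiv_coeff_coeff, ← finSuccEquiv_coeff_coeff, AlgEquiv.apply_symm_apply,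
      Polynomial.coeff_divX]
  refine ⟨p.coeff 0, (finSuccEquiv R r).symm p.divX,
    hF.finSuccEquiv_coeff_isHomogeneous 0 (s + 1) (zero_add _), ?_, ?_, ?_, hH⟩
  · intro m hm
    rw [← Finsupp.cons_tail m, ← hH] at hm
    have := hF hm
    rw [← Finsupp.cons_tail m]
    simp only [Finsupp.weight_apply, Pi.one_apply, smul_eq_mul, mul_one, Finsupp.sum_cons] at this ⊢
    omega
  · apply (finSuccEquiv R r).injective
    rw [map_add, map_mul, AlgEquiv.apply_symm_apply, finSuccEquiv_X_zero,
      finSuccEquiv_rename_succ, ← hp]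
    rw [add_comm, mul_comm, Polynomial.divX_mul_X_add]
  · intro m
    rw [hp, finSuccEquiv_coeff_coeff]

/-- Induction on the degree of a relation G + X₀H with G free of X₀. The value of H lies in a power
of J, so H is handled by the induction hypothesis, and G by the quasi-regularity of the tail. -/
theorem isQuasiRegular_cons {r : ℕ} {a : Fin (r + 1) → R}
    (htail : IsQuasiRegular (Fin.tail a))
    (h0 : ∀ x, a 0 * x ∈ Ideal.span (Set.range (Fin.tail a)) →
      x ∈ Ideal.span (Set.range (Fin.tail a))) :
    IsQuasiRegular a := by
  set J := Ideal.span (Set.range (Fin.tail a)) with hJ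
  set I := Ideal.span (Set.range a) with hI
  have hJI : J ≤ I := Ideal.span_mono (by rintro _ ⟨i, rfl⟩; exact ⟨i.succ, rfl⟩)
  -- Regularity of `a 0` modulo J passes to all powers of J: if x is the value of a form G of degree
  -- s in the tail, quasi-regularity applied to `a 0 * G` puts the coefficients of G in J.
  have hpow : ∀ s x, a 0 * x ∈ J ^ s → x ∈ J ^ s := by
    intro s
    induction s with
    | zero => simp
    | succ s ih =>
      intro x hx
      obtain ⟨G, hG, rfl⟩ := (Ideal.mem_span_pow_iff_exists_isHomogeneous _ _).1
        (ih x (Ideal.pow_le_pow_right s.le_succ hx))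
      refine eval_mem_pow_succ hG fun m => h0 _ ?_
      have := htail s (C (a 0) * G) (by simpa using (isHomogeneous_C _ (a 0)).mul hG)
        (by simpa using hx) m
      rwa [coeff_C_mul] at this
  intro s
  induction s with
  | zero =>
    intro F hF hx m
    refine coeff_mem_of_eval_mem_pow_succ (fun F hF h0 m => ?_) hF hx m
    obtain ⟨c, rfl⟩ : ∃ c, F = C c := ⟨_, totalDegree_eq_zero_iff_eq_C.1 (by
      simpa using hF.totalDegree_le)⟩
    rw [eval_C] at h0
    simp [h0]
  | succ s ih =>
    intro F hF hx m
    refine coeff_mem_of_eval_mem_pow_succ (fun F hF hF0 m => ?_) hF hx m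
    obtain ⟨G, H, hG, hH, rfl, hcG, hcH⟩ := exists_eq_rename_add_X_mul hF
    have hGe : eval a (rename Fin.succ G) = eval (Fin.tail a) G := eval_rename _ _ _
    rw [map_add, map_mul, eval_X, hGe] at hF0
    have hHmem : eval a H ∈ J ^ (s + 1) := by
      apply hpow
      rw [eq_neg_of_add_eq_zero_right hF0]
      exact neg_mem (eval_mem_pow hG)
    -- The form `h` has the same value as H but involves only the tail, so G + a₀h is a relation of
    -- degree s+1 in the tail alone.
    obtain ⟨h, hh, hhe⟩ := (Ideal.mem_span_pow_iff_exists_isHomogeneous _ _).1 hHmem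
    have hHc := ih H hH (Ideal.pow_right_mono hJI _ hHmem)
    have hGc := htail (s + 1) (G + C (a 0) * h)
      (hG.add (by simpa using (isHomogeneous_C _ (a 0)).mul hh)) (by
        rw [map_add, map_mul, eval_C, hhe, hF0]
        exact zero_mem _)
    rw [← Finsupp.cons_tail m]
    rcases m 0 with _ | i
    · rw [hcG]
      have := hJI (hGc m.tail)
      rw [coeff_add, coeff_C_mul] at this
      have h0 : a 0 * coeff m.tail h ∈ I := Ideal.mul_mem_right _ _ (Ideal.subset_span ⟨0, rfl⟩)
      exact (Submodule.add_mem_iff_left _ h0).1 this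
    · rw [hcH]
      exact hHc _

theorem isQuasiRegular_of_fin {r : ℕ} (a : Fin r → R)
    (h : ∀ i x, a i * x ∈ Ideal.span (a '' Set.Ioi i) → x ∈ Ideal.span (a '' Set.Ioi i)) :
    IsQuasiRegular a := by
  induction r with
  | zero =>
    intro s F hF hx m
    refine coeff_mem_of_eval_mem_pow_succ (fun F hF h0 m => ?_) hF hx m
    rw [F.eq_C_of_isEmpty, eval_C] at h0
    rw [Subsingleton.elim m 0, h0]
    exact zero_mem _
  | succ r ih =>
    have htail : ∀ i : Fin r, Fin.tail a '' Set.Ioi i = a '' Set.Ioi i.succ := by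
      intro i
      rw [← Fin.image_succ_Ioi, Set.image_image]
      rfl
    refine isQuasiRegular_cons (ih _ fun i x => ?_) fun x => ?_
    · rw [htail]
      exact h i.succ x
    · have : Set.range (Fin.tail a) = a '' Set.Ioi 0 := by
        ext y
        constructor
        · rintro ⟨i, rfl⟩
          exact ⟨i.succ, Fin.succ_pos i, rfl⟩
        · rintro ⟨i, hi, rfl⟩
          obtain ⟨j, rfl⟩ := Fin.exists_succ_eq.2 (ne_of_gt hi)
          exact ⟨j, rfl⟩
      rw [this]
      exact h 0 x

theorem exists_isQuasiRegular_of_isWeaklyRegular {rs : List R}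
    (h : RingTheory.Sequence.IsWeaklyRegular R rs) :
    ∃ a : Fin rs.length → R, IsQuasiRegular a ∧ Ideal.span (Set.range a) = Ideal.ofList rs := by
  -- A member of a regular sequence is regular modulo its predecessors, while the induction peels
  -- off an element that is regular modulo its successors; hence the reversal.
  refine ⟨fun i => rs.get i.rev, isQuasiRegular_of_fin _ fun i x hx => ?_, ?_⟩
  · have key : Ideal.span ((fun i : Fin rs.length => rs.get i.rev) '' Set.Ioi i) =
        Ideal.ofList (rs.take i.rev) := by
      rw [Ideal.ofList]
      congr 1
      ext y
      simp only [Set.mem_image, Set.mem_Ioi, Set.mem_ofPred_eq, List.mem_take_iff_getElem]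
      constructor
      · rintro ⟨j, hj, rfl⟩
        have hj' := Fin.rev_lt_rev.2 hj
        exact ⟨j.rev, lt_min hj' j.rev.2, rfl⟩
      · rintro ⟨j, hj, rfl⟩
        have hj1 : j < i.rev := (lt_min_iff.1 hj).1
        have hj2 : j < rs.length := (lt_min_iff.1 hj).2
        refine ⟨Fin.rev ⟨j, hj2⟩, ?_, by simp⟩
        rw [← Fin.rev_lt_rev, Fin.rev_rev]
        exact hj1
    rw [key] at hx ⊢
    have hr := h.regular_mod_prev i.rev i.rev.2
    rw [smul_eq_mul, Ideal.mul_top] at hr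
    rw [← Ideal.Quotient.eq_zero_iff_mem]
    apply hr
    change rs.get i.rev • Ideal.Quotient.mk _ x = _ • (0 : R ⧸ Ideal.ofList (rs.take i.rev))
    rw [smul_zero]
    exact Ideal.Quotient.eq_zero_iff_mem.2 hx
  · rw [Ideal.ofList]
    congr 1
    ext y
    simp only [Set.mem_range, Set.mem_ofPred_eq, List.mem_iff_get]
    exact ⟨fun ⟨i, hi⟩ => ⟨i.rev, hi⟩, fun ⟨i, hi⟩ => ⟨i.rev, by simpa using hi⟩⟩

end QuasiRegular

/-! ### Change of generators of a quasi-regular family -/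

section Transfer

variable {R ι κ : Type*} [CommRing R]

theorem IsQuasiRegular.coeff_mem [Fintype κ] {a : κ → R} (ha : IsQuasiRegular a) {c : κ → R}
    (hc : ∑ j, c j * a j = 0) (j : κ) : c j ∈ Ideal.span (Set.range a) := by
  classical
  have hF : (∑ j, C (c j) * X j : MvPolynomial κ R).IsHomogeneous 1 :=
    IsHomogeneous.sum _ _ _ fun j _ => by
      simpa using (isHomogeneous_C _ (c j)).mul (isHomogeneous_X R j)
  have := ha 1 _ hF (by simp [hc]) (Finsupp.single j 1)
  simpa [coeff_sum, coeff_C_mul, coeff_X, Finsupp.single_left_inj] using this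

/-- Subtracting an expression with coefficients in 𝔪 leaves a linear relation, whose coefficients
lie in the ideal of the family and so in 𝔪. This is the minimality of a quasi-regular family as a
set of generators. -/
theorem IsQuasiRegular.coeff_mem_of_mem_mul [Fintype κ] {a : κ → R} (ha : IsQuasiRegular a)
    {𝔪 : Ideal R} (hm : Ideal.span (Set.range a) ≤ 𝔪) {c : κ → R}
    (hc : ∑ j, c j * a j ∈ 𝔪 * Ideal.span (Set.range a)) (j : κ) : c j ∈ 𝔪 := by
  rw [← smul_eq_mul 𝔪, Submodule.mem_ideal_smul_span_iff_exists_sum] at hc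
  obtain ⟨b, hb, hbc⟩ := hc
  rw [Finsupp.sum_fintype _ _ (by simp)] at hbc
  have := ha.coeff_mem (c := fun j => c j - b j) (by
    simp only [sub_mul, Finset.sum_sub_distrib, ← hbc, smul_eq_mul, sub_self]) j
  exact (Submodule.sub_mem_iff_left _ (hb j)).1 (hm this)

/-- Quasi-regularity does not depend on the choice of a generating family of given size. -/
theorem IsQuasiRegular.of_span_eq [Fintype ι] [Fintype κ] [DecidableEq ι] [DecidableEq κ]
    {a : κ → R} (ha : IsQuasiRegular a)
    {f : ι → R} (hspan : Ideal.span (Set.range f) = Ideal.span (Set.range a))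
    (hcard : Fintype.card ι = Fintype.card κ) : IsQuasiRegular f := by
  have hM : ∀ i, ∃ c : κ → R, ∑ j, c j * a j = f i := fun i => by
    have : f i ∈ Ideal.span (Set.range a) := hspan ▸ Ideal.subset_span ⟨i, rfl⟩
    simpa [Ideal.mem_span_range_iff_exists_fun] using this
  have hL : ∀ j, ∃ c : ι → R, ∑ i, c i * f i = a j := fun j => by
    have : a j ∈ Ideal.span (Set.range f) := hspan ▸ Ideal.subset_span ⟨j, rfl⟩
    simpa [Ideal.mem_span_range_iff_exists_fun] using this
  choose M hM using hM
  choose L hL using hL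
  let q := Ideal.Quotient.mk (Ideal.span (Set.range a))
  -- Each row of LM - 1 is a linear relation among the `a j`, hence vanishes modulo the ideal.
  have hLM : (Matrix.of L).map q * (Matrix.of M).map q = 1 := by
    ext j j'
    have := ha.coeff_mem (c := fun j' => (∑ i, L j i * M i j') - if j = j' then 1 else 0) (by
      simp only [sub_mul, Finset.sum_sub_distrib, Finset.sum_mul, ite_mul, one_mul, zero_mul,
        Finset.sum_ite_eq, Finset.mem_univ, if_true]
      rw [Finset.sum_comm]
      simp only [mul_assoc, ← Finset.mul_sum, hM, hL, sub_self]) j'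
    rw [← Ideal.Quotient.eq_zero_iff_mem, map_sub, sub_eq_zero] at this
    simp only [Matrix.mul_apply, Matrix.map_apply, Matrix.of_apply, Matrix.one_apply]
    rw [map_sum] at this
    simp only [map_mul] at this
    rw [this]
    split_ifs <;> simp
  -- Equal cardinality makes the one-sided inverse two-sided; the other order of the product is the
  -- one needed to recover F from G.
  have hML := (Matrix.mul_eq_one_comm_of_card_eq κ ι _ hcard.symm).1 hLM
  intro s F hF hx
  rw [hspan] at hx ⊢
  set G : MvPolynomial κ R := bind₁ (fun i => ∑ j, C (M i j) * X j) F with hG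
  have hGh : G.IsHomogeneous s := by
    rw [← one_mul s]
    refine hF.aeval _ fun i => IsHomogeneous.sum _ _ _ fun j _ => ?_
    simpa using (isHomogeneous_C κ (M i j)).mul (isHomogeneous_X R j)
  have hGe : eval a G = eval f F := by
    have : (eval a).comp (bind₁ fun i => ∑ j, C (M i j) * X j :
        MvPolynomial ι R →ₐ[R] MvPolynomial κ R).toRingHom = eval f := by
      ext i
      · simp
      · simp [hM]
    exact RingHom.congr_fun this F
  have hG0 : map q G = 0 := by
    ext m
    rw [coeff_map, coeff_zero]
    exact Ideal.Quotient.eq_zero_iff_mem.2 (ha s G hGh (hGe ▸ hx) m)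
  -- Modulo the ideal, substituting L undoes the substitution of M, so the vanishing of G forces
  -- that of F.
  have hF0 : map q F = bind₁ (fun j => ∑ i, C (q (L j i)) * X i) (map q G) := by
    have : (map q : MvPolynomial ι R →+* _) = ((bind₁ fun j => ∑ i, C (q (L j i)) * X i :
        MvPolynomial κ _ →ₐ[_] MvPolynomial ι _).toRingHom.comp (map q)).comp
        (bind₁ fun i => ∑ j, C (M i j) * X j :
          MvPolynomial ι R →ₐ[R] MvPolynomial κ R).toRingHom := by
      refine MvPolynomial.ringHom_ext (fun r => by simp) fun i => ?_
      have hi : ∀ i', ∑ j, q (M i j) * q (L j i') = if i = i' then 1 else 0 := fun i' => by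
        simpa [Matrix.mul_apply, Matrix.one_apply] using congrFun (congrFun hML i) i'
      simp only [RingHom.comp_apply, AlgHom.toRingHom_eq_coe, RingHom.coe_coe, bind₁_X_right,
        map_sum, map_mul, map_C, map_X, bind₁_C_right, Finset.mul_sum]
      rw [Finset.sum_comm]
      simp only [← mul_assoc, ← Finset.sum_mul, ← C_mul, ← map_sum, hi]
      simp
    exact RingHom.congr_fun this F
  intro m
  rw [← Ideal.Quotient.eq_zero_iff_mem]
  change q (coeff m F) = 0
  rw [← coeff_map, hF0, hG0, map_zero, coeff_zero]

end Transfer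

/-! ### Koszul differentials and a homotopy formula -/

section Koszul

variable {k : Type*} [Field k] {n : ℕ} {M : Type*} [AddCommGroup M] [Module k M]

theorem alternatingMap_sum_apply {V α : Type*} [AddCommGroup V] [Module k V] {u : ℕ} (s : Finset α)
    (F : α → V [⋀^Fin u]→ₗ[k] M) (v : Fin u → V) : (∑ i ∈ s, F i) v = ∑ i ∈ s, F i v := by
  classical
  induction s using Finset.induction_on with
  | empty => simp
  | insert a s ha ih => simp [Finset.sum_insert ha, ih]

/-- The Koszul differential `∑ⱼ xⱼ ⊗ ι(eⱼ)` on alternating maps with values in a module on which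
operators `xⱼ` act. -/
def koszulD (x : Fin n → M →ₗ[k] M) (u : ℕ) :
    ((Fin n → k) [⋀^Fin (u + 1)]→ₗ[k] M) →ₗ[k] ((Fin n → k) [⋀^Fin u]→ₗ[k] M) where
  toFun F := ∑ j, (x j).compAlternatingMap (F.curryLeft (Pi.single j 1))
  map_add' F G := by ext v; simp [Finset.sum_add_distrib]
  map_smul' c F := by ext v; simp [Finset.smul_sum]

theorem koszulD_apply (x : Fin n → M →ₗ[k] M) {u : ℕ} (F : (Fin n → k) [⋀^Fin (u + 1)]→ₗ[k] M)
    (v : Fin u → Fin n → k) :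
    koszulD x u F v = ∑ j, x j (F (Matrix.vecCons (Pi.single j 1) v)) := by
  simp [koszulD, alternatingMap_sum_apply]

/-- The operator on alternating maps opposite to the Koszul differential, for operators `D v`
depending linearly on the vector `v`. -/
def koszulH (D : (Fin n → k) →ₗ[k] M →ₗ[k] M) (u : ℕ) :
    ((Fin n → k) [⋀^Fin u]→ₗ[k] M) →ₗ[k] ((Fin n → k) [⋀^Fin (u + 1)]→ₗ[k] M) where
  toFun F := AlternatingMap.alternatizeUncurryFin
    { toFun := fun v => (D v).compAlternatingMap F
      map_add' := fun v w => by ext; simp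
      map_smul' := fun c v => by ext; simp }
  map_add' F G := by
    ext v
    simp [AlternatingMap.alternatizeUncurryFin_apply, Finset.sum_add_distrib]
  map_smul' c F := by
    ext v
    simp [AlternatingMap.alternatizeUncurryFin_apply, Finset.smul_sum, smul_comm _ c]

theorem koszulH_apply (D : (Fin n → k) →ₗ[k] M →ₗ[k] M) {u : ℕ}
    (F : (Fin n → k) [⋀^Fin u]→ₗ[k] M) (v : Fin (u + 1) → Fin n → k) :
    koszulH D u F v = ∑ i : Fin (u + 1), (-1) ^ (i : ℕ) • D (v i) (F (i.removeNth v)) := by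
  simp [koszulH, AlternatingMap.alternatizeUncurryFin_apply]

/-- The operators commute and the first two arguments anticommute, so the double sum is
antisymmetric in its indices; it equals its own negative and 2 is invertible. -/
theorem koszulD_koszulD [CharZero k] (x : Fin n → M →ₗ[k] M)
    (hx : ∀ i j m, x i (x j m) = x j (x i m)) {u : ℕ}
    (F : (Fin n → k) [⋀^Fin (u + 2)]→ₗ[k] M) : koszulD x u (koszulD x (u + 1) F) = 0 := by
  ext v
  simp only [koszulD_apply, map_sum, AlternatingMap.zero_apply]
  set T : Fin n → Fin n → M := fun i j => x i (x j (F (Matrix.vecCons (Pi.single j 1)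
    (Matrix.vecCons (Pi.single i 1) v)))) with hT
  have hanti : ∀ i j, T i j + T j i = 0 := by
    intro i j
    have := F.map_swap_add (v := Matrix.vecCons (Pi.single i 1) (Matrix.vecCons (Pi.single j 1) v))
      (i := 0) (j := 1) (by simp)
    have hsw : Matrix.vecCons (Pi.single i 1) (Matrix.vecCons (Pi.single j 1) v) ∘
        Equiv.swap (0 : Fin (u + 2)) 1 =
        Matrix.vecCons (Pi.single j (1 : k)) (Matrix.vecCons (Pi.single i 1) v) := by
      ext a
      refine Fin.cases ?_ (fun a => Fin.cases ?_ (fun a => ?_) a) a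
      · simp
      · simp
      · rw [Function.comp_apply, Equiv.swap_apply_of_ne_of_ne]
        · simp
        · exact Fin.succ_ne_zero _
        · exact fun h => Fin.succ_ne_zero a (Fin.succ_injective _ h)
    rw [hsw] at this
    rw [hT]
    simp only
    rw [hx j i, ← map_add, ← map_add, this, map_zero, map_zero]
  have hS : (2 : k) • ∑ i, ∑ j, T i j = 0 := by
    rw [two_smul]
    nth_rewrite 2 [Finset.sum_comm]
    simp only [← Finset.sum_add_distrib, hanti, Finset.sum_const_zero]
  exact (smul_eq_zero.1 hS).resolve_left two_ne_zero

theorem koszul_homotopy_zero (x : Fin n → M →ₗ[k] M) (D : (Fin n → k) →ₗ[k] M →ₗ[k] M)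
    (F : (Fin n → k) [⋀^Fin 0]→ₗ[k] M) :
    koszulD x 0 (koszulH D 0 F) =
      (∑ j, x j ∘ₗ D (Pi.single j 1)).compAlternatingMap F := by
  ext v
  simp [koszulD_apply, koszulH_apply, Subsingleton.elim _ v]

/-- A Cartan-type formula: the mixed terms of the two composites cancel, the term in which `D` takes
the new vector gives Σ x_j D(e_j), and the commutators [D v, x_j] = c v_j contribute c once for each
of the u+1 slots. It serves with c = 0 for the simplex and c = 1 for polynomials. -/
theorem koszul_homotopy (x : Fin n → M →ₗ[k] M) (D : (Fin n → k) →ₗ[k] M →ₗ[k] M) (c : k)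
    (hc : ∀ v j m, D v (x j m) = x j (D v m) + (c * v j) • m) {u : ℕ}
    (F : (Fin n → k) [⋀^Fin (u + 1)]→ₗ[k] M) :
    koszulD x (u + 1) (koszulH D (u + 1) F) + koszulH D u (koszulD x u F) =
      (∑ j, x j ∘ₗ D (Pi.single j 1)).compAlternatingMap F + (c * (u + 1 : ℕ)) • F := by
  ext v
  have h1 : ∀ (j : Fin n) (i : Fin (u + 1)),
      i.succ.removeNth (Matrix.vecCons (Pi.single j (1 : k)) v) =
        Matrix.vecCons (Pi.single j 1) (i.removeNth v) := by
    intro j i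
    ext a
    refine Fin.cases ?_ (fun a => ?_) a
    · simp [Fin.removeNth]
    · simp [Fin.removeNth]
  have h2 : ∀ i : Fin (u + 1), F (Matrix.vecCons (v i) (i.removeNth v)) =
      ∑ j, v i j • F (Matrix.vecCons (Pi.single j 1) (i.removeNth v)) := by
    intro i
    have := congrArg (fun w => F.curryLeft w (i.removeNth v)) (pi_eq_sum_univ' (v i))
    simpa [alternatingMap_sum_apply] using this
  have h3 : ∑ i : Fin (u + 1), (-1) ^ (i : ℕ) • F (Matrix.vecCons (v i) (i.removeNth v)) =
      (u + 1) • F v := by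
    have := congrArg (fun G => G v) (AlternatingMap.alternatizeUncurryFin_curryLeft F)
    simpa only [AlternatingMap.alternatizeUncurryFin_apply, AlternatingMap.curryLeft_apply_apply,
      AlternatingMap.smul_apply] using this
  simp only [AlternatingMap.add_apply, koszulD_apply, koszulH_apply, map_sum, hc,
    LinearMap.compAlternatingMap_apply, AlternatingMap.smul_apply, LinearMap.sum_apply,
    LinearMap.comp_apply]
  have hA : ∀ j : Fin n, ∑ i : Fin (u + 2), x j ((-1 : ℤ) ^ (i : ℕ) •
      D (Matrix.vecCons (Pi.single j 1) v i) (F (i.removeNth (Matrix.vecCons (Pi.single j 1) v)))) =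
      x j (D (Pi.single j 1) (F v)) - ∑ i : Fin (u + 1), (-1 : ℤ) ^ (i : ℕ) •
        x j (D (v i) (F (Matrix.vecCons (Pi.single j 1) (i.removeNth v)))) := by
    intro j
    rw [Fin.sum_univ_succ, sub_eq_add_neg, ← Finset.sum_neg_distrib]
    congr 1
    · have : (0 : Fin (u + 2)).removeNth (Matrix.vecCons (Pi.single j (1 : k)) v) = v := by
        ext a
        simp [Fin.removeNth]
      rw [this]
      simp
    · refine Finset.sum_congr rfl fun i _ => ?_
      rw [h1, Matrix.cons_val_succ, Fin.val_succ, pow_succ, mul_neg_one, neg_smul, map_neg,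
        map_zsmul]
  have hB : ∀ i : Fin (u + 1), ∑ j, (x j (D (v i) (F (Matrix.vecCons (Pi.single j 1)
      (i.removeNth v)))) + (c * v i j) • F (Matrix.vecCons (Pi.single j 1) (i.removeNth v))) =
      ∑ j, x j (D (v i) (F (Matrix.vecCons (Pi.single j 1) (i.removeNth v)))) +
        c • F (Matrix.vecCons (v i) (i.removeNth v)) := by
    intro i
    rw [Finset.sum_add_distrib, h2, Finset.smul_sum]
    simp only [mul_smul]
  simp only [hA, hB, smul_add, Finset.sum_add_distrib, Finset.sum_sub_distrib, Finset.smul_sum]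
  rw [Finset.sum_comm (γ := Fin n)]
  have hC : ∑ i : Fin (u + 1), (-1 : ℤ) ^ (i : ℕ) • c • F (Matrix.vecCons (v i) (i.removeNth v)) =
      (c * (u + 1 : ℕ)) • F v := by
    rw [mul_smul, Nat.cast_smul_eq_nsmul, ← h3, Finset.smul_sum]
    simp only [smul_comm c]
  rw [hC]
  abel

end Koszul

/-! ### Group action on vector-valued alternating maps -/

section AlternatingAction

variable {k : Type*} [Field k] {n : ℕ} {M : Type*} [AddCommGroup M] [Module k M]

/-- The action on alternating maps of a permutation of the coordinates together with an
endomorphism of the target. -/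
def altAct (σ : Equiv.Perm (Fin n)) (τ : M →ₗ[k] M) (u : ℕ) :
    Module.End k ((Fin n → k) [⋀^Fin u]→ₗ[k] M) where
  toFun F := (τ.compAlternatingMap F).compLinearMap (LinearMap.funLeft k k σ)
  map_add' F G := by ext v; simp
  map_smul' c F := by ext v; simp

theorem altAct_apply (σ : Equiv.Perm (Fin n)) (τ : M →ₗ[k] M) {u : ℕ}
    (F : (Fin n → k) [⋀^Fin u]→ₗ[k] M) (v : Fin u → Fin n → k) :
    altAct σ τ u F v = τ (F fun a => v a ∘ σ) := rfl

theorem koszulD_altAct (x : Fin n → M →ₗ[k] M) (σ : Equiv.Perm (Fin n)) (τ : M →ₗ[k] M)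
    (h : ∀ j m, τ (x j m) = x (σ j) (τ m)) {u : ℕ} (F : (Fin n → k) [⋀^Fin (u + 1)]→ₗ[k] M) :
    koszulD x u (altAct σ τ (u + 1) F) = altAct σ τ u (koszulD x u F) := by
  ext v
  simp only [koszulD_apply, altAct_apply, map_sum, h]
  refine (Fintype.sum_equiv σ _ _ fun j => ?_).symm
  congr 3
  ext a b
  refine Fin.cases ?_ (fun a => ?_) a
  · simp only [Matrix.cons_val_zero, Function.comp_apply, Pi.single_apply, σ.injective.eq_iff]
  · simp

/-- The alternating maps with values in a given subspace. -/
def altIn (u : ℕ) (N : Submodule k M) : Submodule k ((Fin n → k) [⋀^Fin u]→ₗ[k] M) where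
  carrier := {F | ∀ v, F v ∈ N}
  zero_mem' := fun v => by simp
  add_mem' := fun hF hG v => N.add_mem (hF v) (hG v)
  smul_mem' := fun c F hF v => N.smul_mem c (hF v)

theorem mem_altIn_of_basis {u : ℕ} {N : Submodule k M} {F : (Fin n → k) [⋀^Fin u]→ₗ[k] M}
    (h : ∀ t : Fin u → Fin n, F (fun a => Pi.single (t a) 1) ∈ N) : F ∈ altIn u N := by
  intro v
  have : v = fun a => ∑ j, v a j • Pi.single j (1 : k) := by
    ext a j
    simp [Finset.sum_apply, Pi.single_apply]
  rw [this, ← AlternatingMap.coe_multilinearMap, MultilinearMap.map_sum]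
  refine N.sum_mem fun t _ => ?_
  rw [MultilinearMap.map_smul_univ]
  exact N.smul_mem _ (h t)

theorem alternatingMap_ext_single {u : ℕ} {F G : (Fin n → k) [⋀^Fin u]→ₗ[k] M}
    (h : ∀ t : Fin u → Fin n, F (fun a => Pi.single (t a) 1) = G (fun a => Pi.single (t a) 1)) :
    F = G := by
  rw [← sub_eq_zero]
  ext v
  exact (Submodule.mem_bot k).1 (mem_altIn_of_basis (N := ⊥) (F := F - G) (fun t => by
    simp [h t]) v)

instance finiteDimensional_altIn (u : ℕ) (N : Submodule k M) [FiniteDimensional k N] :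
    FiniteDimensional k (altIn u N : Submodule k ((Fin n → k) [⋀^Fin u]→ₗ[k] M)) := by
  let f : (altIn u N : Submodule k ((Fin n → k) [⋀^Fin u]→ₗ[k] M)) →ₗ[k]
      ((Fin u → Fin n) → N) :=
    { toFun := fun F t => ⟨F.1 fun a => Pi.single (t a) 1, F.2 _⟩
      map_add' := fun F G => rfl
      map_smul' := fun c F => rfl }
  refine FiniteDimensional.of_injective f fun F G h => Subtype.ext ?_
  exact alternatingMap_ext_single fun t => congrArg Subtype.val (congrFun h t)

theorem altIn_top (u : ℕ) : (altIn u ⊤ : Submodule k ((Fin n → k) [⋀^Fin u]→ₗ[k] M)) = ⊤ :=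
  eq_top_iff.2 fun _ _ _ => trivial

instance finiteDimensional_alternatingMap (u : ℕ) [FiniteDimensional k M] :
    FiniteDimensional k ((Fin n → k) [⋀^Fin u]→ₗ[k] M) := by
  have := finiteDimensional_altIn (n := n) u (⊤ : Submodule k M)
  rw [altIn_top] at this
  exact Module.Finite.equiv Submodule.topEquiv

theorem altAct_mem_altIn {σ : Equiv.Perm (Fin n)} {τ : M →ₗ[k] M} {u : ℕ} {N : Submodule k M}
    (h : ∀ x ∈ N, τ x ∈ N) {F : (Fin n → k) [⋀^Fin u]→ₗ[k] M} (hF : F ∈ altIn u N) :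
    altAct σ τ u F ∈ altIn u N := fun _ => h _ (hF _)

end AlternatingAction

/-! ### Exactness of the augmented simplex complex -/

section SimplexComplex

variable {k : Type*} [Field k] {n : ℕ}

variable (k n) in
/-- The differential of the augmented chain complex of the simplex, on alternating forms. -/
def simplexD (u : ℕ) :
    ((Fin n → k) [⋀^Fin (u + 1)]→ₗ[k] k) →ₗ[k] ((Fin n → k) [⋀^Fin u]→ₗ[k] k) :=
  koszulD (fun _ => LinearMap.id) u

variable (k) in
/-- The operator evaluating the coordinate `i`. -/
def coordOp (i : Fin n) : (Fin n → k) →ₗ[k] k →ₗ[k] k where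
  toFun v := v i • LinearMap.id
  map_add' v w := by simp [add_smul]
  map_smul' c v := by simp [mul_smul]

theorem range_simplexD_zero (i : Fin n) : LinearMap.range (simplexD k n 0) = ⊤ := by
  refine LinearMap.range_eq_top.2 fun F => ⟨koszulH (coordOp k i) 0 F, ?_⟩
  rw [simplexD, koszul_homotopy_zero]
  ext v
  simp [coordOp, Pi.single_apply]

/-- Coning off the vertex `i` contracts the complex: scalar operators commute, so c = 0 in the
homotopy formula, and Σ_j D(e_j) is the identity. -/
theorem ker_simplexD [CharZero k] (i : Fin n) (u : ℕ) :
    LinearMap.ker (simplexD k n u) = LinearMap.range (simplexD k n (u + 1)) := by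
  ext F
  constructor
  · intro hF
    refine ⟨koszulH (coordOp k i) (u + 1) F, ?_⟩
    have := koszul_homotopy (fun _ : Fin n => (LinearMap.id : k →ₗ[k] k)) (coordOp k i) 0
      (by simp [coordOp]) F
    rw [LinearMap.mem_ker, simplexD] at hF
    rw [hF, map_zero, add_zero] at this
    rw [simplexD, this]
    ext v
    simp [coordOp, Pi.single_apply]
  · rintro ⟨G, rfl⟩
    exact koszulD_koszulD _ (by simp) G

theorem alternatingMap_eq_zero_of_lt {u : ℕ} (h : n < u) (F : (Fin n → k) [⋀^Fin u]→ₗ[k] k) :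
    F = 0 := by
  refine alternatingMap_ext_single fun t => ?_
  obtain ⟨a, b, hab, hne⟩ := Fintype.exists_ne_map_eq_of_card_lt t (by simpa using h)
  rw [F.map_eq_zero_of_eq _ (by rw [hne]) hab, AlternatingMap.zero_apply]

variable (k) in
/-- The trace of a permutation on the alternating forms of degree `u`. -/
def altTrace (σ : Equiv.Perm (Fin n)) (u : ℕ) : k :=
  traceOn (altAct σ (LinearMap.id : k →ₗ[k] k) u) ⊤

variable (k) in
/-- The trace of a permutation on the boundaries of degree `u` of the simplex. -/
def boundaryTrace (σ : Equiv.Perm (Fin n)) (u : ℕ) : k :=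
  traceOn (altAct σ (LinearMap.id : k →ₗ[k] k) u) (LinearMap.range (simplexD k n u))

theorem altTrace_zero (σ : Equiv.Perm (Fin n)) : altTrace k σ 0 = 1 := by
  let f : ((Fin n → k) [⋀^Fin 0]→ₗ[k] k) →ₗ[k] k :=
    { toFun := fun F => F 0
      map_add' := fun _ _ => rfl
      map_smul' := fun _ _ => rfl }
  have hf : (⊤ : Submodule k ((Fin n → k) [⋀^Fin 0]→ₗ[k] k)).map f = ⊤ :=
    eq_top_iff.2 fun c _ => ⟨AlternatingMap.constOfIsEmpty k _ _ c, trivial, rfl⟩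
  rw [altTrace, ← traceOn_map_of_injOn (τ' := LinearMap.id) f (fun F _ => ?_)
    (fun _ _ => Submodule.mem_top)
    (fun F _ hF => ?_), hf, traceOn_top, LinearMap.trace_id, Module.finrank_self, Nat.cast_one]
  · change F _ = F _
    congr 1
  · ext v
    rw [Subsingleton.elim v 0]
    exact hF

theorem altTrace_zero_eq (σ : Equiv.Perm (Fin n)) (i : Fin n) :
    altTrace k σ 0 = boundaryTrace k σ 0 := by
  rw [altTrace, boundaryTrace, range_simplexD_zero i]

/-- Rank-nullity for traces along the equivariant differential, whose kernel is the next space of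
boundaries by exactness. -/
theorem altTrace_succ [CharZero k] (σ : Equiv.Perm (Fin n)) (i : Fin n) (u : ℕ) :
    altTrace k σ (u + 1) = boundaryTrace k σ (u + 1) + boundaryTrace k σ u := by
  rw [altTrace, traceOn_eq_ker_add_map (τ' := altAct σ LinearMap.id u) (simplexD k n u)
    (fun F _ => koszulD_altAct _ _ _ (by simp) F) (fun _ _ => Submodule.mem_top), top_inf_eq,
    ker_simplexD i, Submodule.map_top]
  rfl

theorem boundaryTrace_eq_zero (σ : Equiv.Perm (Fin n)) {u : ℕ} (h : n ≤ u) :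
    boundaryTrace k σ u = 0 := by
  have : LinearMap.range (simplexD k n u) = ⊥ := by
    rw [eq_bot_iff]
    rintro _ ⟨F, rfl⟩
    rw [alternatingMap_eq_zero_of_lt (Nat.lt_succ_of_le h) F, map_zero]
    exact zero_mem _
  rw [boundaryTrace, this, traceOn_bot]

end SimplexComplex

/-! ### The Koszul complex of the polynomial ring -/

section PolynomialKoszul

variable {k : Type*} [Field k] {n : ℕ}

instance finiteDimensional_homogeneousSubmodule (e : ℕ) :
    FiniteDimensional k (homogeneousSubmodule (Fin n) k e) :=
  Module.Finite.iff_fg.2 (homogeneousSubmodule_fg _ _ _)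

variable (k n) in
/-- The directional derivatives on the polynomial ring. -/
def pderivOp : (Fin n → k) →ₗ[k] MvPolynomial (Fin n) k →ₗ[k] MvPolynomial (Fin n) k where
  toFun v := ∑ j, v j • (pderiv j : Derivation k (MvPolynomial (Fin n) k) _).toLinearMap
  map_add' v w := by simp [add_smul, Finset.sum_add_distrib]
  map_smul' c v := by simp [mul_smul, Finset.smul_sum]

theorem pderivOp_apply (v : Fin n → k) (p : MvPolynomial (Fin n) k) :
    pderivOp k n v p = ∑ j, v j • pderiv j p := by
  simp [pderivOp, LinearMap.sum_apply]

variable (k n) in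
/-- The differential of the polynomial Koszul complex. -/
def polyKoszulD (u : ℕ) :
    ((Fin n → k) [⋀^Fin (u + 1)]→ₗ[k] MvPolynomial (Fin n) k) →ₗ[k]
      ((Fin n → k) [⋀^Fin u]→ₗ[k] MvPolynomial (Fin n) k) :=
  koszulD (fun j => LinearMap.mulLeft k (X j)) u

theorem polyKoszulD_mem {u e : ℕ} {F : (Fin n → k) [⋀^Fin (u + 1)]→ₗ[k] MvPolynomial (Fin n) k}
    (hF : F ∈ altIn (u + 1) (homogeneousSubmodule (Fin n) k e)) :
    polyKoszulD k n u F ∈ altIn u (homogeneousSubmodule (Fin n) k (e + 1)) := by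
  intro v
  rw [polyKoszulD, koszulD_apply]
  refine Submodule.sum_mem _ fun j _ => ?_
  rw [add_comm]
  exact (isHomogeneous_X k j).mul (hF _)

theorem pderivOp_mem {e : ℕ} (v : Fin n → k) {p : MvPolynomial (Fin n) k}
    (hp : p ∈ homogeneousSubmodule (Fin n) k (e + 1)) :
    pderivOp k n v p ∈ homogeneousSubmodule (Fin n) k e := by
  rw [pderivOp_apply]
  exact Submodule.sum_mem _ fun j _ => Submodule.smul_mem _ _ (IsHomogeneous.pderiv hp)

theorem koszulH_pderivOp_mem {u e : ℕ} {F : (Fin n → k) [⋀^Fin u]→ₗ[k] MvPolynomial (Fin n) k}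
    (hF : F ∈ altIn u (homogeneousSubmodule (Fin n) k (e + 1))) :
    koszulH (pderivOp k n) u F ∈ altIn (u + 1) (homogeneousSubmodule (Fin n) k e) := by
  intro v
  rw [koszulH_apply]
  exact Submodule.sum_mem _ fun i _ => Submodule.smul_of_tower_mem _ _ (pderivOp_mem _ (hF _))

theorem euler_compAlternatingMap {u e : ℕ}
    {F : (Fin n → k) [⋀^Fin u]→ₗ[k] MvPolynomial (Fin n) k}
    (hF : F ∈ altIn u (homogeneousSubmodule (Fin n) k e)) :
    (∑ j, LinearMap.mulLeft k (X j) ∘ₗ pderivOp k n (Pi.single j 1)).compAlternatingMap F =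
      (e : k) • F := by
  ext1 v
  have := IsHomogeneous.sum_X_mul_pderiv (hF v)
  rw [LinearMap.compAlternatingMap_apply, AlternatingMap.smul_apply, Nat.cast_smul_eq_nsmul, ← this,
    LinearMap.sum_apply]
  refine Finset.sum_congr rfl fun j _ => ?_
  simp [pderivOp_apply, Pi.single_apply]

/-- The commutator of ∂_v with X_j is v_j, so c = 1: Euler's identity contributes the polynomial
degree e and the commutators the exterior degree u+1. The total is a nonzero scalar in
characteristic zero, which yields exactness. -/
theorem polyKoszul_homotopy {u e : ℕ}
    {F : (Fin n → k) [⋀^Fin (u + 1)]→ₗ[k] MvPolynomial (Fin n) k}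
    (hF : F ∈ altIn (u + 1) (homogeneousSubmodule (Fin n) k e)) :
    polyKoszulD k n (u + 1) (koszulH (pderivOp k n) (u + 1) F) +
      koszulH (pderivOp k n) u (polyKoszulD k n u F) = ((e + (u + 1) : ℕ) : k) • F := by
  rw [polyKoszulD, polyKoszulD, koszul_homotopy _ _ 1, euler_compAlternatingMap hF, ← add_smul,
    one_mul, ← Nat.cast_add]
  intro v j p
  simp only [pderivOp_apply, LinearMap.mulLeft_apply, Derivation.leibniz, pderiv_X, smul_add,
    Finset.sum_add_distrib, Finset.mul_sum, smul_eq_mul, mul_smul_comm, one_mul]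
  congr 1
  simp [Pi.single_apply]

theorem altIn_inf_ker_polyKoszulD [CharZero k] (u e : ℕ) :
    altIn (u + 1) (homogeneousSubmodule (Fin n) k (e + 1)) ⊓ LinearMap.ker (polyKoszulD k n u) =
      (altIn (u + 2) (homogeneousSubmodule (Fin n) k e)).map (polyKoszulD k n (u + 1)) := by
  ext F
  constructor
  · rintro ⟨hF, hF0⟩
    have := polyKoszul_homotopy hF
    rw [LinearMap.mem_ker.1 hF0, map_zero, add_zero] at this
    have hne : ((e + 1 + (u + 1) : ℕ) : k) ≠ 0 := Nat.cast_ne_zero.2 (by omega)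
    refine ⟨((e + 1 + (u + 1) : ℕ) : k)⁻¹ • koszulH (pderivOp k n) (u + 1) F,
      Submodule.smul_mem _ _ (koszulH_pderivOp_mem hF), ?_⟩
    rw [map_smul, this, inv_smul_smul₀ hne]
  · rintro ⟨G, hG, rfl⟩
    exact ⟨polyKoszulD_mem hG, LinearMap.mem_ker.2 (koszulD_koszulD _ (fun i j m => by
      simp [mul_left_comm]) G)⟩

/-- The edge of constant coefficients: derivatives kill constants, so the homotopy formula shows
that u+1 annihilates each cycle. -/
theorem altIn_inf_ker_polyKoszulD_zero [CharZero k] (u : ℕ) :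
    altIn (u + 1) (homogeneousSubmodule (Fin n) k 0) ⊓ LinearMap.ker (polyKoszulD k n u) = ⊥ := by
  rw [eq_bot_iff]
  rintro F ⟨hF, hF0⟩
  have := polyKoszul_homotopy hF
  have hH : koszulH (pderivOp k n) (u + 1) F = 0 := by
    ext1 v
    rw [koszulH_apply]
    refine Finset.sum_eq_zero fun i _ => ?_
    have h0 : ∀ v, ∃ c, F v = C c := fun v => ⟨_, totalDegree_eq_zero_iff_eq_C.1 (by
      simpa using (hF v : IsHomogeneous (F v) 0).totalDegree_le)⟩
    obtain ⟨c, hc⟩ := h0 (i.removeNth v)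
    rw [pderivOp_apply, hc]
    simp
  rw [LinearMap.mem_ker.1 hF0, map_zero, hH, map_zero, zero_add] at this
  have hne : ((0 + (u + 1) : ℕ) : k) ≠ 0 := Nat.cast_ne_zero.2 (by omega)
  exact (Submodule.mem_bot k).2 ((smul_eq_zero.1 this.symm).resolve_left hne)

theorem altIn_zero_eq_map_polyKoszulD [CharZero k] (e : ℕ) :
    altIn 0 (homogeneousSubmodule (Fin n) k (e + 1)) =
      (altIn 1 (homogeneousSubmodule (Fin n) k e)).map (polyKoszulD k n 0) := by
  ext F
  constructor
  · intro hF
    have := koszul_homotopy_zero (fun j => LinearMap.mulLeft k (X j)) (pderivOp k n) F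
    rw [euler_compAlternatingMap hF] at this
    have hne : ((e + 1 : ℕ) : k) ≠ 0 := Nat.cast_ne_zero.2 (by omega)
    refine ⟨((e + 1 : ℕ) : k)⁻¹ • koszulH (pderivOp k n) 0 F,
      Submodule.smul_mem _ _ (koszulH_pderivOp_mem hF), ?_⟩
    rw [map_smul, polyKoszulD, this, inv_smul_smul₀ hne]
  · rintro ⟨G, hG, rfl⟩
    exact polyKoszulD_mem hG

/-- The number of monomials of degree `e` fixed by a permutation of the variables. -/
def fixedMonomials (σ : Equiv.Perm (Fin n)) (e : ℕ) : ℕ :=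
  (((Finset.univ : Finset (Fin n)).finsuppAntidiag e).filter fun b => b.mapDomain σ = b).card

theorem mem_finsuppAntidiag_univ {e : ℕ} {b : Fin n →₀ ℕ} :
    b ∈ (Finset.univ : Finset (Fin n)).finsuppAntidiag e ↔ b.degree = e := by
  rw [Finset.mem_finsuppAntidiag, Finsupp.degree_eq_sum]
  simp

theorem isHomogeneous_monomial_of_mem {e : ℕ} {b : Fin n →₀ ℕ}
    (hb : b ∈ (Finset.univ : Finset (Fin n)).finsuppAntidiag e) (c : k) :
    monomial b c ∈ homogeneousSubmodule (Fin n) k e :=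
  isHomogeneous_monomial _ (mem_finsuppAntidiag_univ.1 hb)

theorem sum_monomial_coeff_of_isHomogeneous {e : ℕ} {p : MvPolynomial (Fin n) k}
    (hp : p ∈ homogeneousSubmodule (Fin n) k e) :
    ∑ b ∈ (Finset.univ : Finset (Fin n)).finsuppAntidiag e, monomial b (coeff b p) = p := by
  conv_rhs => rw [← support_sum_monomial_coeff p]
  refine (Finset.sum_subset (fun b hb => mem_finsuppAntidiag_univ.2 ?_) fun b _ hb => ?_).symm
  · rw [← hp (mem_support_iff.1 hb)]
    exact DFunLike.congr_fun Finsupp.degree_eq_weight_one b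
  · rw [notMem_support_iff.1 hb, map_zero]

theorem coeff_polyRep_monomial (σ : Equiv.Perm (Fin n)) (b : Fin n →₀ ℕ) (c : k) :
    coeff b (polyRep k n σ (monomial b c)) = if b.mapDomain σ = b then c else 0 := by
  change coeff b (rename σ (monomial b c)) = _
  rw [rename_monomial, coeff_monomial]

/-- Coefficient extraction splits the space into blocks indexed by monomials, which σ permutes. A
fixed monomial gives a diagonal block acting as on scalar forms; the other diagonal blocks are zero.
-/
theorem traceOn_altIn_homogeneousSubmodule (σ : Equiv.Perm (Fin n)) (u e : ℕ) :
    traceOn (altAct σ (polyRep k n σ) u) (altIn u (homogeneousSubmodule (Fin n) k e)) =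
      fixedMonomials σ e * altTrace k σ u := by
  rw [traceOn_eq_sum ((Finset.univ : Finset (Fin n)).finsuppAntidiag e)
    (X := fun _ => (Fin n → k) [⋀^Fin u]→ₗ[k] k)
    (U := altIn u (homogeneousSubmodule (Fin n) k e))
    (fun F hF => altAct_mem_altIn ((polyGrading k n e).apply_mem_toSubmodule σ) hF) (fun _ => ⊤)
    (fun b => (monomial b : k →ₗ[k] MvPolynomial (Fin n) k).compAlternatingMapₗ k)
    (fun b => (lcoeff k b : MvPolynomial (Fin n) k →ₗ[k] k).compAlternatingMapₗ k)]
  · rw [fixedMonomials, Finset.card_filter, Nat.cast_sum, Finset.sum_mul]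
    refine Finset.sum_congr rfl fun b _ => ?_
    split_ifs with h
    · rw [Nat.cast_one, one_mul]
      refine traceOn_congr fun F _ => ?_
      ext v
      change coeff b (polyRep k n σ (monomial b _)) = _
      rw [coeff_polyRep_monomial, if_pos h]
      rfl
    · rw [Nat.cast_zero, zero_mul, ← traceOn_zero (⊤ : Submodule k ((Fin n → k) [⋀^Fin u]→ₗ[k] k))]
      refine traceOn_congr fun F _ => ?_
      ext v
      change coeff b (polyRep k n σ (monomial b _)) = _
      rw [coeff_polyRep_monomial, if_neg h]
      rfl
  · exact fun b hb F _ v => isHomogeneous_monomial_of_mem hb _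
  · exact fun _ _ _ _ => Submodule.mem_top
  · intro F hF
    ext1 v
    rw [alternatingMap_sum_apply]
    exact sum_monomial_coeff_of_isHomogeneous (hF v)

theorem traceOn_homogeneousSubmodule (σ : Equiv.Perm (Fin n)) (e : ℕ) :
    traceOn (polyRep k n σ) (homogeneousSubmodule (Fin n) k e) = fixedMonomials σ e := by
  rw [traceOn_eq_sum ((Finset.univ : Finset (Fin n)).finsuppAntidiag e)
    (X := fun _ => k) (U := homogeneousSubmodule (Fin n) k e)
    ((polyGrading k n e).apply_mem_toSubmodule σ) (fun _ => ⊤)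
    (fun b => (monomial b : k →ₗ[k] MvPolynomial (Fin n) k))
    (fun b => (lcoeff k b : MvPolynomial (Fin n) k →ₗ[k] k))]
  · rw [fixedMonomials, Finset.card_filter, Nat.cast_sum]
    refine Finset.sum_congr rfl fun b _ => ?_
    split_ifs with h
    · rw [Nat.cast_one, ← Nat.cast_one, ← Module.finrank_self k, ← LinearMap.trace_id,
        ← traceOn_top]
      refine traceOn_congr fun c _ => ?_
      change coeff b (polyRep k n σ (monomial b _)) = _
      rw [coeff_polyRep_monomial, if_pos h]
      rfl
    · rw [Nat.cast_zero, ← traceOn_zero (⊤ : Submodule k k)]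
      refine traceOn_congr fun c _ => ?_
      change coeff b (polyRep k n σ (monomial b _)) = _
      rw [coeff_polyRep_monomial, if_neg h]
      rfl
  · exact fun b hb c _ => isHomogeneous_monomial_of_mem hb _
  · exact fun _ _ _ _ => Submodule.mem_top
  · exact fun p hp => sum_monomial_coeff_of_isHomogeneous hp

theorem fixedMonomials_zero (σ : Equiv.Perm (Fin n)) : fixedMonomials σ 0 = 1 := by
  rw [fixedMonomials, Finset.finsuppAntidiag_zero, Finset.filter_singleton]
  simp

variable (k) in
/-- The trace of a permutation on the boundaries in the polynomial Koszul complex. -/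
def koszulBoundaryTrace (σ : Equiv.Perm (Fin n)) (u e : ℕ) : k :=
  traceOn (altAct σ (polyRep k n σ) u)
    ((altIn (u + 1) (homogeneousSubmodule (Fin n) k e)).map (polyKoszulD k n u))

theorem polyKoszulD_altAct (σ : Equiv.Perm (Fin n)) {u : ℕ}
    (F : (Fin n → k) [⋀^Fin (u + 1)]→ₗ[k] MvPolynomial (Fin n) k) :
    polyKoszulD k n u (altAct σ (polyRep k n σ) (u + 1) F) =
      altAct σ (polyRep k n σ) u (polyKoszulD k n u F) :=
  koszulD_altAct _ _ _ (fun j p => by simp [polyRep]) F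

theorem fixedMonomials_mul_altTrace_succ_succ [CharZero k] (σ : Equiv.Perm (Fin n)) (u e : ℕ) :
    (fixedMonomials σ (e + 1) : k) * altTrace k σ (u + 1) =
      koszulBoundaryTrace k σ (u + 1) e + koszulBoundaryTrace k σ u (e + 1) := by
  rw [← traceOn_altIn_homogeneousSubmodule,
    traceOn_eq_ker_add_map (τ' := altAct σ (polyRep k n σ) u) (polyKoszulD k n u)
      (U := altIn (u + 1) (homogeneousSubmodule (Fin n) k _)) (fun F _ => polyKoszulD_altAct σ F)
      (fun F hF => altAct_mem_altIn ((polyGrading k n _).apply_mem_toSubmodule σ) hF),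
    altIn_inf_ker_polyKoszulD]
  rfl

theorem fixedMonomials_zero_mul_altTrace_succ [CharZero k] (σ : Equiv.Perm (Fin n)) (u : ℕ) :
    (fixedMonomials σ 0 : k) * altTrace k σ (u + 1) = koszulBoundaryTrace k σ u 0 := by
  rw [← traceOn_altIn_homogeneousSubmodule,
    traceOn_eq_ker_add_map (τ' := altAct σ (polyRep k n σ) u) (polyKoszulD k n u)
      (U := altIn (u + 1) (homogeneousSubmodule (Fin n) k _)) (fun F _ => polyKoszulD_altAct σ F)
      (fun F hF => altAct_mem_altIn ((polyGrading k n _).apply_mem_toSubmodule σ) hF),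
    altIn_inf_ker_polyKoszulD_zero, traceOn_bot, zero_add]
  rfl

theorem fixedMonomials_succ_mul_altTrace_zero [CharZero k] (σ : Equiv.Perm (Fin n)) (e : ℕ) :
    (fixedMonomials σ (e + 1) : k) * altTrace k σ 0 = koszulBoundaryTrace k σ 0 e := by
  rw [← traceOn_altIn_homogeneousSubmodule, altIn_zero_eq_map_polyKoszulD]
  rfl

/-- The graded character of the exterior algebra, with signs, is inverse to that of the
polynomial ring. -/
theorem altTrace_mul_fixedMonomials [CharZero k] (σ : Equiv.Perm (Fin n)) :
    (PowerSeries.mk fun u => (-1) ^ u * altTrace k σ u) *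
      PowerSeries.mk (fun e => (fixedMonomials σ e : k)) = 1 := by
  ext N
  rw [PowerSeries.coeff_mul, PowerSeries.coeff_one]
  simp only [PowerSeries.coeff_mk]
  rcases N with _ | N
  · simp [altTrace_zero, fixedMonomials_zero]
  rw [if_neg (Nat.succ_ne_zero N)]
  -- Boundary traces with both indices shifted by one and zero on the edges: the three cases of
  -- exactness then take a single form, and the alternating sum along the diagonal telescopes.
  let s : ℕ → ℕ → k := fun u e =>
    if u = 0 ∨ e = 0 then 0 else koszulBoundaryTrace k σ (u - 1) (e - 1)
  have key : ∀ u e, u + e ≠ 0 →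
      (fixedMonomials σ e : k) * altTrace k σ u = s (u + 1) e + s u (e + 1) := by
    rintro (_ | u) (_ | e) h
    · exact absurd rfl h
    · simp [s, fixedMonomials_succ_mul_altTrace_zero]
    · simp [s, fixedMonomials_zero_mul_altTrace_succ]
    · simp [s, fixedMonomials_mul_altTrace_succ_succ]
  rw [Finset.Nat.sum_antidiagonal_eq_sum_range_succ_mk]
  have : ∀ u ∈ Finset.range (N + 1 + 1),
      (-1) ^ u * altTrace k σ u * (fixedMonomials σ (N + 1 - u) : k) =
        (-1) ^ u * s u (N + 2 - u) - (-1) ^ (u + 1) * s (u + 1) (N + 2 - (u + 1)) := by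
    intro u hu
    have hu' := Finset.mem_range.1 hu
    have h1 : N + 1 - u + 1 = N + 2 - u := by omega
    have h2 : N + 2 - (u + 1) = N + 1 - u := by omega
    rw [mul_assoc, mul_comm (altTrace k σ u), key u (N + 1 - u) (by omega), h1, h2]
    ring
  rw [Finset.sum_congr rfl this, Finset.sum_range_sub']
  simp [s]

end PolynomialKoszul

/-! ### Generating series of the boundary traces -/

section HookSeries

variable {k : Type*} [Field k] {n : ℕ}

theorem one_sub_X_mul_boundaryTrace [CharZero k] (σ : Equiv.Perm (Fin n)) (i : Fin n) :
    (1 - PowerSeries.X) * (PowerSeries.mk fun u => (-1) ^ u * boundaryTrace k σ u) =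
      PowerSeries.mk fun u => (-1) ^ u * altTrace k σ u := by
  ext u
  rw [sub_mul, one_mul, map_sub]
  rcases u with _ | u
  · simp [altTrace_zero_eq σ i]
  · rw [PowerSeries.coeff_succ_X_mul]
    simp only [PowerSeries.coeff_mk, altTrace_succ σ i]
    ring

/-- The series is a polynomial because there are no nonzero alternating forms on kⁿ in more than n
arguments. -/
theorem mk_boundaryTrace (σ : Equiv.Perm (Fin n)) :
    (PowerSeries.mk fun u => (-1) ^ u * boundaryTrace k σ u) =
      ∑ u : Fin n, (-1) ^ (u : ℕ) * PowerSeries.C (boundaryTrace k σ u) *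
        PowerSeries.X ^ (u : ℕ) := by
  rw [Fin.sum_univ_eq_sum_range (fun u => (-1) ^ u * PowerSeries.C (boundaryTrace k σ u) *
        PowerSeries.X ^ u) n]
  ext e
  have : ∀ u, (-1 : PowerSeries k) ^ u * PowerSeries.C (boundaryTrace k σ u) * PowerSeries.X ^ u =
      PowerSeries.C ((-1) ^ u * boundaryTrace k σ u) * PowerSeries.X ^ u := fun u => by simp
  simp only [this, map_sum, PowerSeries.coeff_C_mul_X_pow, PowerSeries.coeff_mk,
    Finset.sum_ite_eq, Finset.mem_range]
  split_ifs with h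
  · rfl
  · rw [boundaryTrace_eq_zero σ (not_lt.1 h), mul_zero]

end HookSeries

/-! ### Alternating forms inside the space of tabloids -/

section HookTabloids

variable {k : Type*} [Field k] {n : ℕ}

/-- The row assignment placing `t a` in row `a + 1` and all other entries in row `0`. -/
def legRows {u : ℕ} (t : Fin u → Fin n) (i : Fin n) : ℕ := ∑ a, if t a = i then (a : ℕ) + 1 else 0

theorem legRows_apply {u : ℕ} {t : Fin u → Fin n} (ht : Function.Injective t) (a : Fin u) :
    legRows t (t a) = a + 1 := by
  simp [legRows, ht.eq_iff]

theorem legRows_of_notMem {u : ℕ} {t : Fin u → Fin n} {i : Fin n} (h : i ∉ Set.range t) :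
    legRows t i = 0 :=
  Finset.sum_eq_zero fun a _ => if_neg fun ha => h ⟨a, ha⟩

theorem legRows_injOn {u : ℕ} {t t' : Fin u → Fin n} (ht : Function.Injective t)
    (ht' : Function.Injective t') (h : legRows t = legRows t') : t = t' := by
  funext a
  have h1 : legRows t' (t a) = a + 1 := by rw [← h, legRows_apply ht]
  by_cases hm : t a ∈ Set.range t'
  · obtain ⟨b, hb⟩ := hm
    rw [← hb, legRows_apply ht'] at h1
    rw [← hb, Fin.ext (Nat.succ_injective h1)]
  · rw [legRows_of_notMem hm] at h1
    omega

theorem legRows_comp (σ : Equiv.Perm (Fin n)) {u : ℕ} (t : Fin u → Fin n) :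
    legRows (σ ∘ t) = fun i => legRows t (σ⁻¹ i) := by
  funext i
  simp only [legRows, Function.comp_apply, Equiv.Perm.eq_inv_iff_eq]

variable (k n) in
/-- The embedding of the alternating forms of degree `u` into the space of tabloids. -/
def altTabloid (u : ℕ) : ((Fin n → k) [⋀^Fin u]→ₗ[k] k) →ₗ[k] ((Fin n → ℕ) →₀ k) where
  toFun F := ∑ t : Fin u → Fin n, Finsupp.single (legRows t) (F fun a => Pi.single (t a) 1)
  map_add' F G := by simp [Finset.sum_add_distrib]
  map_smul' c F := by simp [Finset.smul_sum]

theorem altTabloid_apply {u : ℕ} (F : (Fin n → k) [⋀^Fin u]→ₗ[k] k) :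
    altTabloid k n u F =
      ∑ t : Fin u → Fin n, Finsupp.single (legRows t) (F fun a => Pi.single (t a) 1) := rfl

theorem alternatingMap_single_of_not_injective {u : ℕ} (F : (Fin n → k) [⋀^Fin u]→ₗ[k] k)
    {t : Fin u → Fin n} (ht : ¬ Function.Injective t) : F (fun a => Pi.single (t a) 1) = 0 :=
  F.map_eq_zero_of_not_injective _ fun h => ht fun a b hab => h (by simp only [hab])

/-- For injective `t` the tabloid determines `t`, so the coefficient there is exactly the value of F
on the basis vectors indexed by `t`; non-injective families contribute zero. -/
theorem altTabloid_injective (u : ℕ) : Function.Injective (altTabloid k n u) := by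
  rw [← LinearMap.ker_eq_bot, eq_bot_iff]
  intro F hF
  refine (Submodule.mem_bot k).2 (alternatingMap_ext_single fun t => ?_)
  by_cases ht : Function.Injective t
  · have := DFunLike.congr_fun (LinearMap.mem_ker.1 hF) (legRows t)
    rw [altTabloid_apply, Finsupp.finsetSum_apply, Finset.sum_eq_single t] at this
    · simpa using this
    · intro t' _ hne
      by_cases ht' : Function.Injective t'
      · exact Finsupp.single_eq_of_ne fun h => hne (legRows_injOn ht' ht h.symm)
      · rw [alternatingMap_single_of_not_injective F ht', Finsupp.single_zero, Finsupp.zero_apply]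
    · simp
  · rw [alternatingMap_single_of_not_injective F ht, AlternatingMap.zero_apply]

theorem altTabloid_altAct (σ : Equiv.Perm (Fin n)) {u : ℕ} (F : (Fin n → k) [⋀^Fin u]→ₗ[k] k) :
    altTabloid k n u (altAct σ (LinearMap.id : k →ₗ[k] k) u F) =
      tabloidRep k n σ (altTabloid k n u F) := by
  rw [altTabloid_apply, altTabloid_apply, map_sum]
  refine (Fintype.sum_equiv (Equiv.arrowCongr (Equiv.refl _) σ) _ _ fun t => ?_).symm
  have h1 : tabloidRep k n σ (Finsupp.single (legRows t) (F fun a => Pi.single (t a) 1)) =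
      Finsupp.single (fun i => legRows t (σ⁻¹ i)) (F fun a => Pi.single (t a) 1) := by
    simp [tabloidRep, Finsupp.mapDomain_single]
  rw [h1, ← legRows_comp, altAct_apply]
  change Finsupp.single (legRows (σ ∘ t)) _ = Finsupp.single (legRows (σ ∘ t)) (F _)
  congr 2
  ext a b
  simp [Pi.single_apply]

variable (k) in
/-- The alternating form `v ↦ det (vᵢ (c j))`. -/
def detForm {u : ℕ} (c : Fin u → Fin n) : (Fin n → k) [⋀^Fin u]→ₗ[k] k :=
  (Matrix.detRowAlternating : (Fin u → k) [⋀^Fin u]→ₗ[k] k).compLinearMap (LinearMap.funLeft k k c)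

theorem detForm_single {u : ℕ} (c s : Fin u → Fin n) :
    detForm k c (fun a => Pi.single (s a) 1) =
      ∑ ρ : Equiv.Perm (Fin u), if s = c ∘ ρ then ((Equiv.Perm.sign ρ : ℤ) : k) else 0 := by
  change Matrix.det (Matrix.of fun i j => (Pi.single (s i) 1 : Fin n → k) (c j)) = _
  rw [← Matrix.det_transpose, Matrix.det_apply']
  refine Finset.sum_congr rfl fun ρ _ => ?_
  simp only [Matrix.transpose_apply, Matrix.of_apply, Pi.single_apply]
  rw [Finset.prod_ite_zero, Finset.prod_const_one]
  by_cases h : s = c ∘ ρ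
  · rw [if_pos h, if_pos fun i _ => by rw [h]; rfl, mul_one]
  · rw [if_neg h, if_neg fun h' => h (funext fun i => (h' i (Finset.mem_univ i)).symm), mul_zero]

/-- Expanding F in determinant forms over all families c counts each ordering once, with matching
signs, and so produces u! F; terms with non-injective c vanish. -/
theorem span_detForm [CharZero k] (u : ℕ) :
    Submodule.span k (detForm k '' {c : Fin u → Fin n | Function.Injective c}) = ⊤ := by
  refine eq_top_iff.2 fun F _ => ?_
  have hF : (Nat.factorial u : k) • F =
      ∑ c : Fin u → Fin n, F (fun a => Pi.single (c a) 1) • detForm k c := by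
    refine alternatingMap_ext_single fun s => ?_
    rw [alternatingMap_sum_apply]
    simp only [AlternatingMap.smul_apply, detForm_single, smul_eq_mul, Finset.mul_sum]
    rw [Finset.sum_comm]
    have : ∀ ρ : Equiv.Perm (Fin u), (∑ c : Fin u → Fin n, F (fun a => Pi.single (c a) 1) *
        if s = c ∘ ρ then ((Equiv.Perm.sign ρ : ℤ) : k) else 0) =
          F fun a => Pi.single (s a) 1 := by
      intro ρ
      rw [Finset.sum_eq_single (s ∘ (ρ⁻¹ : Equiv.Perm (Fin u)))]
      · have hs : s = (s ∘ (ρ⁻¹ : Equiv.Perm (Fin u))) ∘ ρ := by ext; simp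
        rw [if_pos hs]
        have := F.map_perm (fun a => Pi.single (s a) (1 : k)) ρ⁻¹
        change F (fun a => Pi.single (s (ρ⁻¹ a)) (1 : k)) = _ at this
        simp only [Function.comp_apply]
        rw [this, Equiv.Perm.sign_inv, Units.smul_def, zsmul_eq_mul, mul_right_comm, ← Int.cast_mul,
          ← Units.val_mul, Int.units_mul_self, Units.val_one, Int.cast_one, one_mul]
      · intro c _ hc
        rw [if_neg, mul_zero]
        rintro rfl
        exact hc (by ext; simp)
      · simp
    simp only [this, Finset.sum_const, Finset.card_univ, Fintype.card_perm, Fintype.card_fin,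
      nsmul_eq_mul]
  have hne : (Nat.factorial u : k) ≠ 0 := Nat.cast_ne_zero.2 (Nat.factorial_ne_zero u)
  rw [← inv_smul_smul₀ hne F, hF]
  refine Submodule.smul_mem _ _ (Submodule.sum_mem _ fun c _ => ?_)
  by_cases hc : Function.Injective c
  · exact Submodule.smul_mem _ _ (Submodule.subset_span ⟨c, hc, rfl⟩)
  · rw [alternatingMap_single_of_not_injective F hc, zero_smul]
    exact zero_mem _

/-- The differential inserts e_j in the first slot and sums over j, so in the Leibniz expansion the
entry `c (ρ 0)` is forgotten and falls into row 0, while `c (ρ a.succ)` sits in row a+1. This is the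
signed sum over rearrangements of a hook's first column. -/
theorem altTabloid_simplexD_detForm {u : ℕ} (c : Fin (u + 1) → Fin n) :
    altTabloid k n u (simplexD k n u (detForm k c)) =
      ∑ ρ : Equiv.Perm (Fin (u + 1)),
        Finsupp.single (legRows fun a : Fin u => c (ρ a.succ)) ((Equiv.Perm.sign ρ : ℤ) : k) := by
  have h : ∀ t : Fin u → Fin n, simplexD k n u (detForm k c) (fun a => Pi.single (t a) 1) =
      ∑ ρ : Equiv.Perm (Fin (u + 1)),
        if t = fun a => c (ρ a.succ) then ((Equiv.Perm.sign ρ : ℤ) : k) else 0 := by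
    intro t
    have hv : ∀ j : Fin n, Matrix.vecCons (Pi.single j 1) (fun a => Pi.single (t a) (1 : k)) =
        fun a => (Pi.single : Fin n → k → Fin n → k)
          ((Fin.cons j t : Fin (u + 1) → Fin n) a) 1 := by
      intro j
      ext a b
      refine Fin.cases ?_ (fun a => ?_) a <;> simp
    simp only [simplexD, koszulD_apply, LinearMap.id_apply, hv, detForm_single]
    rw [Finset.sum_comm]
    refine Finset.sum_congr rfl fun ρ _ => ?_
    have hcons : ∀ j, (Fin.cons j t : Fin (u + 1) → Fin n) = c ∘ ρ ↔
        j = c (ρ 0) ∧ t = fun a => c (ρ a.succ) := by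
      intro j
      constructor
      · intro h
        exact ⟨by simpa using congrFun h 0, funext fun a => by simpa using congrFun h a.succ⟩
      · rintro ⟨rfl, rfl⟩
        ext a
        refine Fin.cases ?_ (fun a => ?_) a <;> simp
    simp only [hcons, ite_and, Finset.sum_ite_eq', Finset.mem_univ, if_true]
  rw [altTabloid_apply]
  simp only [h, Finsupp.single_finsetSum]
  rw [Finset.sum_comm]
  refine Finset.sum_congr rfl fun ρ _ => ?_
  rw [Finset.sum_eq_single (fun a => c (ρ a.succ))]
  · simp
  · intro t _ ht
    rw [if_neg ht, Finsupp.single_zero]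
  · simp

end HookTabloids

/-! ### Hook Specht modules as boundaries of the simplex -/

section HookSpecht

variable {k : Type*} [Field k] {n : ℕ}

theorem mem_hook {u : Fin n} {x : ℕ × ℕ} :
    x ∈ hook n u ↔ (x.1 = 0 ∧ x.2 < n - u) ∨ (x.1 ≠ 0 ∧ x.1 ≤ u ∧ x.2 = 0) := by
  obtain ⟨i, j⟩ := x
  rw [hook, YoungDiagram.mem_ofRowLens]
  rcases i with _ | i
  · simp
  · simp

/-- The cells of a hook: its first column and the rest of its first row. -/
def hookCell (u : Fin n) : Fin (u + 1) ⊕ Fin (n - u - 1) → (hook n u).cells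
  | Sum.inl a => ⟨(a, 0), by
      rw [YoungDiagram.mem_cells, mem_hook]
      have := a.2
      have := u.2
      rcases Nat.eq_zero_or_pos (a : ℕ) with h | h <;> simp <;> omega⟩
  | Sum.inr b => ⟨(0, b + 1), by
      rw [YoungDiagram.mem_cells, mem_hook]
      have := b.2
      simp
      omega⟩

theorem hookCell_bijective (u : Fin n) : Function.Bijective (hookCell u) := by
  constructor
  · intro x y h
    have h1 : (hookCell u x).1.1 = (hookCell u y).1.1 := by rw [h]
    have h2 : (hookCell u x).1.2 = (hookCell u y).1.2 := by rw [h]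
    rcases x with a | a <;> rcases y with b | b
    · exact congrArg Sum.inl (Fin.ext h1)
    · exact absurd h2 (Nat.succ_ne_zero _).symm
    · exact absurd h2 (Nat.succ_ne_zero _)
    · exact congrArg Sum.inr (Fin.ext (Nat.succ_injective h2))
  · rintro ⟨⟨i, j⟩, h⟩
    have h' := mem_hook.1 ((YoungDiagram.mem_cells _).1 h)
    simp only at h'
    have := u.2
    rcases j with _ | j
    · exact ⟨Sum.inl ⟨i, by omega⟩, rfl⟩
    · refine ⟨Sum.inr ⟨j, by omega⟩, Subtype.ext (Prod.ext ?_ rfl)⟩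
      change 0 = i
      omega

/-- Every injective family fills the first column of some tableau of hook shape. -/
theorem exists_hook_tableau (u : Fin n) {c : Fin (u + 1) → Fin n} (hc : Function.Injective c) :
    ∃ T : (hook n u).cells ≃ Fin n, ∀ a, T (hookCell u (Sum.inl a)) = c a := by
  have e := Equiv.ofBijective _ (hookCell_bijective u)
  have hcard : Fintype.card (Fin (u + 1) ⊕ Fin (n - u - 1)) = Fintype.card (Fin n) := by
    have := u.2
    simp
    omega
  let T₀ := (Equiv.ofBijective _ (hookCell_bijective u)).symm.trans (Fintype.equivOfCardEq hcard)
  let c₀ : Fin (u + 1) → Fin n := fun a => T₀ (hookCell u (Sum.inl a))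
  have hc₀ : Function.Injective c₀ := fun a b h =>
    Sum.inl_injective ((hookCell_bijective u).1 (T₀.injective h))
  let E : {x // x ∈ Set.range c₀} ≃ {x // x ∈ Set.range c} :=
    (Equiv.ofInjective c₀ hc₀).symm.trans (Equiv.ofInjective c hc)
  refine ⟨T₀.trans E.extendSubtype, fun a => ?_⟩
  change E.extendSubtype (c₀ a) = c a
  rw [E.extendSubtype_apply_of_mem _ ⟨a, rfl⟩]
  have : (⟨c₀ a, ⟨a, rfl⟩⟩ : {x // x ∈ Set.range c₀}) = Equiv.ofInjective c₀ hc₀ a := rfl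
  rw [this]
  simp [E]

/-- All columns of a hook but the first have one box, so the column stabilizer is the symmetric
group of the first column, extended by the identity. -/
theorem polytabloid_hook (u : Fin n) (T : (hook n u).cells ≃ Fin n) :
    polytabloid k T = altTabloid k n u
      (simplexD k n u (detForm k fun a => T (hookCell u (Sum.inl a)))) := by
  rw [altTabloid_simplexD_detForm, polytabloid]
  let c : Fin (u + 1) ↪ Fin n := ⟨fun a => T (hookCell u (Sum.inl a)), fun a b h =>
    Sum.inl_injective ((hookCell_bijective u).1 (T.injective h))⟩
  have hcases : ∀ i, (∃ a, i = c a) ∨ (i ∉ Set.range c ∧ ∃ b, i = T (hookCell u (Sum.inr b))) := by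
    intro i
    obtain ⟨x, hx⟩ := (hookCell_bijective u).2 (T.symm i)
    have hx' : i = T (hookCell u x) := by rw [hx, Equiv.apply_symm_apply]
    rcases x with a | b
    · exact Or.inl ⟨a, hx'⟩
    · refine Or.inr ⟨?_, b, hx'⟩
      rintro ⟨a, ha⟩
      exact Sum.inl_ne_inr ((hookCell_bijective u).1 (T.injective (ha.trans hx')))
  have hcol : ∀ a, (T.symm (c a)).1.2 = 0 := fun a => by
    change (T.symm (T _)).1.2 = 0
    rw [Equiv.symm_apply_apply]
    rfl
  have hrow : ∀ a, (T.symm (c a)).1.1 = a := fun a => by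
    change (T.symm (T _)).1.1 = _
    rw [Equiv.symm_apply_apply]
    rfl
  have hcol' : ∀ b, (T.symm (T (hookCell u (Sum.inr b)))).1.2 = b + 1 := fun b => by
    rw [Equiv.symm_apply_apply]
    rfl
  have hrow' : ∀ b, (T.symm (T (hookCell u (Sum.inr b)))).1.1 = 0 := fun b => by
    rw [Equiv.symm_apply_apply]
    rfl
  symm
  refine Finset.sum_bij (fun ρ _ => Equiv.Perm.viaFintypeEmbedding ρ c) ?_ ?_ ?_ ?_
  · intro ρ _
    simp only [columnStabilizer, Finset.mem_filter, Finset.mem_univ, true_and]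
    intro i
    rcases hcases i with ⟨a, rfl⟩ | ⟨hi, _⟩
    · rw [Equiv.Perm.viaFintypeEmbedding_apply_image, hcol, hcol]
    · rw [Equiv.Perm.viaFintypeEmbedding_apply_notMem_range _ _ hi]
  · intro ρ _ ρ' _ h
    ext a
    have := congrArg (fun π : Equiv.Perm (Fin n) => π (c a)) h
    simp only [Equiv.Perm.viaFintypeEmbedding_apply_image] at this
    rw [c.injective this]
  · intro π hπ
    simp only [columnStabilizer, Finset.mem_filter, Finset.mem_univ, true_and] at hπ
    have h1 : ∀ a, ∃ b, π (c a) = c b := by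
      intro a
      rcases hcases (π (c a)) with h | ⟨_, b, hb⟩
      · exact h
      · have := hπ (c a)
        rw [hb, hcol', hcol] at this
        omega
    choose r hr using h1
    have hrinj : Function.Injective r := fun a b hab => by
      apply c.injective
      apply π.injective
      rw [hr, hr, hab]
    -- A column-preserving permutation fixes the arm pointwise, each arm entry being alone in its
    -- column, so it is determined by `r`.
    refine ⟨Equiv.ofBijective r (Finite.injective_iff_bijective.1 hrinj), Finset.mem_univ _, ?_⟩
    ext1 i
    rcases hcases i with ⟨a, rfl⟩ | ⟨hi, b, hb⟩
    · rw [Equiv.Perm.viaFintypeEmbedding_apply_image, hr]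
      rfl
    · rw [Equiv.Perm.viaFintypeEmbedding_apply_notMem_range _ _ hi]
      have h2 := hπ i
      rcases hcases (π i) with ⟨a, ha⟩ | ⟨_, b', hb'⟩
      · rw [ha, hb, hcol', hcol] at h2
        omega
      · rw [hb', hb, hcol', hcol'] at h2
        rw [hb', hb, Fin.ext (Nat.succ_injective h2)]
  · intro ρ _
    rw [Equiv.Perm.viaFintypeEmbedding_sign]
    simp only [tabloidRep, MonoidHom.coe_mk, OneHom.coe_mk, Finsupp.lmapDomain_apply,
      Finsupp.mapDomain_single, Finsupp.smul_single, smul_eq_mul, mul_one]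
    congr 1
    have hinj : Function.Injective fun a : Fin (u : ℕ) => c (ρ a.succ) := fun a b h =>
      Fin.succ_injective _ (ρ.injective (c.injective h))
    funext j
    -- Comparing the row functions at the image of `i` removes the inverse permutation from the
    -- tabloid action.
    obtain ⟨i, rfl⟩ := (Equiv.Perm.viaFintypeEmbedding ρ c).surjective j
    rw [Equiv.Perm.inv_def, Equiv.symm_apply_apply]
    rcases hcases i with ⟨a, rfl⟩ | ⟨hi, b, hb⟩
    · rw [Equiv.Perm.viaFintypeEmbedding_apply_image, hrow]
      refine Fin.cases ?_ (fun a => ?_) a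
      · refine legRows_of_notMem ?_
        rintro ⟨b, hb⟩
        exact Fin.succ_ne_zero b (ρ.injective (c.injective hb))
      · exact legRows_apply hinj a
    · rw [Equiv.Perm.viaFintypeEmbedding_apply_notMem_range _ _ hi]
      have h0 : legRows (fun a : Fin (u : ℕ) => c (ρ a.succ)) i = 0 :=
        legRows_of_notMem fun ⟨a, ha⟩ => hi ⟨_, ha⟩
      refine h0.trans ?_
      rw [hb, hrow']

/-- The Specht modules of hook shape are the modules of boundaries of the simplex. -/
theorem spechtModule_hook [CharZero k] (u : Fin n) :
    (spechtModule k n (hook n u)).toSubmodule =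
      (LinearMap.range (simplexD k n u)).map (altTabloid k n u) := by
  rw [LinearMap.range_eq_map, ← span_detForm, Submodule.map_span, Submodule.map_span]
  change Submodule.span k _ = _
  congr 1
  ext x
  constructor
  · rintro ⟨T, rfl⟩
    refine ⟨_, ⟨_, ⟨fun a => T (hookCell u (Sum.inl a)), fun a b h => ?_, rfl⟩, rfl⟩,
      (polytabloid_hook u T).symm⟩
    exact Sum.inl_injective ((hookCell_bijective u).1 (T.injective h))
  · rintro ⟨_, ⟨_, ⟨c, hc, rfl⟩, rfl⟩, rfl⟩
    obtain ⟨T, hT⟩ := exists_hook_tableau u hc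
    refine ⟨T, ?_⟩
    simp only [polytabloid_hook, hT]

theorem spechtChar_hook [CharZero k] (u : Fin n) (σ : Equiv.Perm (Fin n)) :
    (spechtChar k n (hook n u)).1 σ = boundaryTrace k σ u := by
  refine (character_toRepresentation (spechtModule k n (hook n u)) σ).trans ?_
  rw [spechtModule_hook, boundaryTrace]
  refine traceOn_map_of_injOn (τ := altAct σ (LinearMap.id : k →ₗ[k] k) u) (altTabloid k n u)
    (fun F _ => altTabloid_altAct σ F) ?_ fun F _ hF =>
      altTabloid_injective _ (hF.trans (map_zero _).symm)
  rintro _ ⟨F, rfl⟩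
  exact ⟨altAct σ (LinearMap.id : k →ₗ[k] k) _ F, koszulD_altAct _ _ _ (by simp) F⟩

end HookSpecht

/-! ### A permuted spanning family of the standard representation -/

section StandardVectors

variable {k : Type*} [Field k] {n : ℕ}

variable (k) in
/-- The tabloid of shape `(n - 1, 1)` with `i` in its second row. -/
def pointTabloid (i : Fin n) : (Fin n → ℕ) →₀ k :=
  Finsupp.single (legRows fun _ : Fin 1 => i) 1

theorem tabloidRep_pointTabloid (σ : Equiv.Perm (Fin n)) (i : Fin n) :
    tabloidRep k n σ (pointTabloid k i) = pointTabloid k (σ i) := by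
  have h := legRows_comp σ fun _ : Fin 1 => i
  change _ = Finsupp.single (legRows (σ ∘ fun _ : Fin 1 => i)) 1
  rw [h]
  simp [tabloidRep, pointTabloid, Finsupp.mapDomain_single]

theorem pointTabloid_apply (i j : Fin n) :
    pointTabloid k i (legRows fun _ : Fin 1 => j) = if i = j then 1 else 0 := by
  split_ifs with h
  · rw [pointTabloid, h, Finsupp.single_eq_same]
  · refine Finsupp.single_eq_of_ne fun h' => h ?_
    have hinj : ∀ i : Fin n, Function.Injective fun _ : Fin 1 => i := fun _ _ _ _ =>
      Subsingleton.elim _ _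
    exact (congrFun (legRows_injOn (hinj j) (hinj i) h') 0).symm

theorem altTabloid_simplexD_pair (i j : Fin n) :
    altTabloid k n 1 (simplexD k n 1 (detForm k ![i, j])) =
      pointTabloid k j - pointTabloid k i := by
  have h : (Finset.univ : Finset (Equiv.Perm (Fin 2))) = {1, Equiv.swap 0 1} := by decide
  rw [altTabloid_simplexD_detForm]
  change ∑ ρ : Equiv.Perm (Fin 2), _ = _
  rw [h, Finset.sum_pair (by decide)]
  have h1 : (fun a : Fin 1 => (![i, j] : Fin 2 → Fin n) ((1 : Equiv.Perm (Fin 2)) a.succ)) =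
      fun _ => j := by
    funext a
    rw [Subsingleton.elim a 0]
    rfl
  have h2 : (fun a : Fin 1 => (![i, j] : Fin 2 → Fin n) ((Equiv.swap 0 1 : Equiv.Perm (Fin 2))
      a.succ)) = fun _ => i := by
    funext a
    rw [Subsingleton.elim a 0]
    rfl
  rw [h1, h2, Equiv.Perm.sign_one, Equiv.Perm.sign_swap (by decide)]
  simp [pointTabloid, sub_eq_add_neg]

/-- The standard representation is spanned by `n` vectors which are permuted by the symmetric
group and whose linear relations are the multiples of the relation that their sum is zero. -/
theorem exists_standard_vectors [CharZero k] (hn : 2 ≤ n) :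
    ∃ w : Fin n → (spechtModule k n (standardShape n hn)).toSubmodule,
      (∀ σ i, spechtRep k n (standardShape n hn) σ (w i) = w (σ i)) ∧ ∑ i, w i = 0 ∧
      Submodule.span k (Set.range w) = ⊤ ∧
      ∀ a : Fin n → k, ∑ i, a i • w i = 0 → ∀ i j, a i = a j := by
  -- The shape (n-1, 1) is the hook with u = 1, definitionally.
  have hS : (spechtModule k n (standardShape n hn)).toSubmodule =
      (LinearMap.range (simplexD k n 1)).map (altTabloid k n 1) := spechtModule_hook ⟨1, hn⟩
  have hn0 : (n : k) ≠ 0 := Nat.cast_ne_zero.2 (by omega)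
  -- Point i projected to the sum-zero subspace, scaled by n to avoid division. Differences of these
  -- vectors are n times the polytabloids, which gives spanning.
  let v : Fin n → (Fin n → ℕ) →₀ k := fun i => (n : k) • pointTabloid k i - ∑ j, pointTabloid k j
  have hv : ∀ i, v i ∈ (spechtModule k n (standardShape n hn)).toSubmodule := by
    intro i
    have : v i = ∑ j, (pointTabloid k i - pointTabloid k j) := by
      simp [v, Finset.sum_sub_distrib, Nat.cast_smul_eq_nsmul]
    rw [this, hS]
    refine Submodule.sum_mem _ fun j _ => ?_
    rw [← altTabloid_simplexD_pair]
    exact ⟨_, ⟨_, rfl⟩, rfl⟩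
  have hvsub : ∀ i j, v i - v j = (n : k) • (pointTabloid k i - pointTabloid k j) := by
    intro i j
    simp [v, smul_sub]
  refine ⟨fun i => ⟨v i, hv i⟩, fun σ i => Subtype.ext ?_, Subtype.ext ?_, ?_, ?_⟩
  · change tabloidRep k n σ (v i) = v (σ i)
    simp only [v, map_sub, map_smul, map_sum, tabloidRep_pointTabloid]
    congr 1
    exact Equiv.sum_comp σ (fun j => pointTabloid k j)
  · rw [Submodule.coe_sum]
    simp [v, Finset.sum_sub_distrib, ← Finset.smul_sum, Nat.cast_smul_eq_nsmul]
  · rw [← Submodule.map_injective_of_injective (Submodule.injective_subtype _) |>.eq_iff,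
      Submodule.map_span, Submodule.map_subtype_top, ← Set.range_comp]
    apply le_antisymm
    · rw [Submodule.span_le]
      rintro _ ⟨i, rfl⟩
      exact hv i
    · refine hS.le.trans ?_
      rw [LinearMap.range_eq_map, ← span_detForm, Submodule.map_span, Submodule.map_span,
        Submodule.span_le]
      rintro _ ⟨_, ⟨_, ⟨c, -, rfl⟩, rfl⟩, rfl⟩
      have hc : c = ![c 0, c 1] := by
        ext a
        fin_cases a <;> rfl
      rw [hc, SetLike.mem_coe, altTabloid_simplexD_pair, ← inv_smul_smul₀ hn0 (_ - _), ← hvsub]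
      exact Submodule.smul_mem _ _ (Submodule.sub_mem _ (Submodule.subset_span ⟨_, rfl⟩)
        (Submodule.subset_span ⟨_, rfl⟩))
  · intro a ha
    -- The coefficient of the relation at the point j.
    have key : ∀ j, (n : k) * a j = ∑ i, a i := by
      intro j
      have h1 := congrArg Subtype.val ha
      rw [Submodule.coe_sum] at h1
      have h2 := DFunLike.congr_fun h1 (legRows fun _ : Fin 1 => j)
      simp only [Submodule.coe_smul, Finsupp.finsetSum_apply, Finsupp.smul_apply, v,
        Finsupp.sub_apply, pointTabloid_apply, smul_eq_mul, Finset.sum_ite_eq',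
        Finset.mem_univ, if_true, mul_sub, mul_ite, mul_one, mul_zero,
        Finset.sum_sub_distrib] at h2
      rw [mul_comm]
      exact sub_eq_zero.1 h2
    intro i j
    exact mul_left_cancel₀ hn0 ((key i).trans (key j).symm)

end StandardVectors

/-! ### Equivariant lifting of generators -/

section Lifting

variable {k : Type*} [Field k] {n : ℕ}

/-- The structure map onto `I/𝔪I`, transported along an isomorphism of graded representations. -/
theorem exists_generator_map {W : Type*} [AddCommMonoid W] [Module k W]
    {θ : Representation k (Equiv.Perm (Fin n)) W} {I : Ideal (MvPolynomial (Fin n) k)}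
    (hstab : IsSymStable I) {d m : ℕ} {c : Fin m → ℕ}
    (hgen : GradedIso (generatorGrading I hstab) (sumTrivialGrading θ d c)) :
    ∃ π : (I.restrictScalars k) →ₗ[k] W × (Fin m → k),
      (∀ (σ : Equiv.Perm (Fin n)) (x : I.restrictScalars k),
        π ⟨rename σ x.1, hstab σ _ x.2⟩ = (θ σ (π x).1, (π x).2)) ∧
      (∀ x, π x = 0 ↔ x.1 ∈ irrelevant k n * I) ∧
      (∀ w : W, ∃ x, x.1.IsHomogeneous d ∧ π x = (w, 0)) ∧
      ∀ j : Fin m, ∃ x, x.1.IsHomogeneous (c j) ∧ π x = (0, Pi.single j 1) := by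
  obtain ⟨Φ, hΦ⟩ := hgen
  let q : (I.restrictScalars k) →ₗ[k] _ := (irrelevantMulIn I hstab).toSubmodule.mkQ
  have hlift : ∀ e w, w ∈ sumTrivialGrading θ d c e →
      ∃ x : I.restrictScalars k, x.1.IsHomogeneous e ∧ Φ (q x) = w := by
    intro e w hw
    have h := (hΦ e (Φ.toLinearEquiv.symm w)).2 (by
      have : Φ (Φ.toLinearEquiv.symm w) = w := Φ.toLinearEquiv.apply_symm_apply w
      rw [this]
      exact hw)
    obtain ⟨x, hx, hxw⟩ := h
    refine ⟨x, hx, ?_⟩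
    change Φ.toLinearEquiv (q x) = w
    change q x = _ at hxw
    rw [hxw, LinearEquiv.apply_symm_apply]
  refine ⟨Φ.toLinearEquiv.toLinearMap ∘ₗ q, ?_, ?_, ?_, ?_⟩
  · intro σ x
    have h1 : q ⟨rename σ x.1, hstab σ _ x.2⟩ = quotRep (irrelevantMulIn I hstab) σ (q x) := rfl
    have h2 := LinearMap.congr_fun (Φ.isIntertwining' σ) (q x)
    change Φ.toLinearEquiv (q ⟨rename σ x.1, hstab σ _ x.2⟩) = _
    rw [h1]
    exact h2
  · intro x
    change Φ.toLinearEquiv (q x) = 0 ↔ _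
    rw [LinearEquiv.map_eq_zero_iff]
    exact Submodule.Quotient.mk_eq_zero _
  · intro w
    exact hlift d (w, 0) ⟨fun h => absurd rfl h, fun _ _ => rfl⟩
  · intro j
    refine hlift (c j) (0, Pi.single j 1) ⟨fun _ => rfl, fun i hi => ?_⟩
    exact Pi.single_eq_of_ne (fun h => hi (by rw [h])) _

/-- Generators of `I` lifted equivariantly from `I/𝔪I`. -/
theorem exists_equivariant_generators [CharZero k] (hn : 2 ≤ n) {W : Type*} [AddCommGroup W]
    [Module k W] {θ : Representation k (Equiv.Perm (Fin n)) W} {w : Fin n → W}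
    (hw : ∀ σ i, θ σ (w i) = w (σ i)) (hwsum : ∑ i, w i = 0)
    (hwspan : Submodule.span k (Set.range w) = ⊤)
    (hwrel : ∀ a : Fin n → k, ∑ i, a i • w i = 0 → ∀ i j, a i = a j)
    {I : Ideal (MvPolynomial (Fin n) k)} (hstab : IsSymStable I) {d m : ℕ} {c : Fin m → ℕ}
    (hgen : GradedIso (generatorGrading I hstab) (sumTrivialGrading θ d c)) :
    ∃ (f : Fin n → MvPolynomial (Fin n) k) (z : Fin m → MvPolynomial (Fin n) k),
      (∀ i, f i ∈ I) ∧ (∀ j, z j ∈ I) ∧ (∀ i, (f i).IsHomogeneous d) ∧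
      (∀ j, (z j).IsHomogeneous (c j)) ∧
      (∀ (σ : Equiv.Perm (Fin n)) i, rename σ (f i) = f (σ i)) ∧
      (∀ (σ : Equiv.Perm (Fin n)) j, rename σ (z j) = z j) ∧ ∑ i, f i = 0 ∧
      (∀ x ∈ I, ∃ (a : Fin n → k) (b : Fin m → k),
        x - (∑ i, a i • f i + ∑ j, b j • z j) ∈ irrelevant k n * I) ∧
      ∀ (a : Fin n → k) (b : Fin m → k),
        ∑ i, a i • f i + ∑ j, b j • z j ∈ irrelevant k n * I →
          (∀ i j, a i = a j) ∧ ∀ j, b j = 0 := by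
  obtain ⟨π, hπ, hker, hd, hc⟩ := exists_generator_map hstab hgen
  choose F hF hFπ using fun i => hd (w i)
  choose Z hZ hZπ using hc
  let act : Equiv.Perm (Fin n) → I.restrictScalars k →ₗ[k] I.restrictScalars k :=
    fun σ => (polyRep k n σ).restrict fun x hx => hstab σ x hx
  have hact : ∀ σ x, π (act σ x) = (θ σ (π x).1, (π x).2) := hπ
  have hactmul : ∀ σ τ x, act σ (act τ x) = act (σ * τ) x := fun σ τ x => Subtype.ext (by
    change polyRep k n σ (polyRep k n τ x.1) = polyRep k n (σ * τ) x.1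
    rw [map_mul]
    rfl)
  have hacthom : ∀ σ (x : I.restrictScalars k) e, x.1.IsHomogeneous e →
      (act σ x).1.IsHomogeneous e := fun σ x e hx => IsHomogeneous.rename_isHomogeneous hx
  have hn0 : (n : k) ≠ 0 := Nat.cast_ne_zero.2 (by omega)
  let N : k := (Fintype.card (Equiv.Perm (Fin n)) : k)
  have hN : N ≠ 0 := Nat.cast_ne_zero.2 Fintype.card_ne_zero
  -- Centring makes the lifts sum to zero exactly; as Σ w_i = 0, their images are only scaled by n.
  let F' : Fin n → I.restrictScalars k := fun i => (n : k) • F i - ∑ j, F j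
  have hF'π : ∀ i, π (F' i) = ((n : k) • w i, 0) := by
    intro i
    have : ∑ j, (w j, (0 : Fin m → k)) = 0 := by
      rw [← Prod.mk_zero_zero, ← hwsum]
      exact Prod.ext (by simp [Prod.fst_sum]) (by simp [Prod.snd_sum])
    simp only [F', map_sub, map_smul, map_sum, hFπ, this, sub_zero, Prod.smul_mk, smul_zero]
  have hF'sum : ∑ i, F' i = 0 := by
    simp [F', Finset.sum_sub_distrib, ← Finset.smul_sum, Nat.cast_smul_eq_nsmul]
  -- Each summand lifts the same vector n w_i, so this twisted average is permuted by the group and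
  -- still lifts a nonzero multiple of w_i. It is left unnormalized, since n! · n is invertible.
  let f : Fin n → I.restrictScalars k := fun i => ∑ σ : Equiv.Perm (Fin n), act σ (F' (σ⁻¹ i))
  let z : Fin m → I.restrictScalars k := fun j => ∑ σ : Equiv.Perm (Fin n), act σ (Z j)
  have hfπ : ∀ i, π (f i) = ((N * n) • w i, 0) := by
    intro i
    simp only [f, map_sum, hact, hF'π, map_smul (θ _), hw, Equiv.Perm.inv_def,
      Equiv.apply_symm_apply, Finset.sum_const, Finset.card_univ, Prod.smul_mk, smul_zero, N,
      mul_smul (Fintype.card _ : k), Nat.cast_smul_eq_nsmul k (Fintype.card _)]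
  have hzπ : ∀ j, π (z j) = (0, N • Pi.single j 1) := by
    intro j
    simp only [z, map_sum, hact, hZπ, map_zero, Finset.sum_const, Finset.card_univ, Prod.smul_mk,
      smul_zero, N, Nat.cast_smul_eq_nsmul]
  have hcomb : ∀ (a : Fin n → k) (b : Fin m → k), π (∑ i, a i • f i + ∑ j, b j • z j) =
      ((N * n) • ∑ i, a i • w i, N • b) := by
    intro a b
    simp only [map_add, map_sum, map_smul, hfπ, hzπ]
    refine Prod.ext ?_ ?_
    · simp [Prod.fst_sum, Finset.smul_sum, smul_comm (N * n)]
    · ext j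
      simp [Prod.snd_sum, Finset.sum_apply, Pi.single_apply, mul_comm]
  refine ⟨fun i => (f i).1, fun j => (z j).1, fun i => (f i).2, fun j => (z j).2, ?_, ?_, ?_, ?_,
    ?_, ?_, ?_⟩
  · intro i
    simp only [f, Submodule.coe_sum]
    refine IsHomogeneous.sum _ _ _ fun σ _ => hacthom _ _ _ ?_
    refine (homogeneousSubmodule (Fin n) k d).sub_mem (Submodule.smul_mem _ _ (hF _)) ?_
    rw [Submodule.coe_sum]
    exact Submodule.sum_mem _ fun j _ => hF j
  · intro j
    simp only [z, Submodule.coe_sum]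
    exact IsHomogeneous.sum _ _ _ fun σ _ => hacthom _ _ _ (hZ j)
  · intro σ i
    have : act σ (f i) = f (σ i) := by
      simp only [f, map_sum, hactmul]
      refine Fintype.sum_equiv (Equiv.mulLeft σ) _ _ fun τ => ?_
      simp [mul_inv_rev, Equiv.Perm.mul_apply]
    exact congrArg Subtype.val this
  · intro σ j
    have : act σ (z j) = z j := by
      simp only [z, map_sum, hactmul]
      exact Fintype.sum_equiv (Equiv.mulLeft σ) _ _ fun τ => rfl
    exact congrArg Subtype.val this
  · have : ∑ i, f i = 0 := by
      simp only [f]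
      rw [Finset.sum_comm]
      refine Finset.sum_eq_zero fun σ _ => ?_
      rw [← map_sum, Equiv.sum_comp σ⁻¹ F', hF'sum, map_zero]
    have := congrArg Subtype.val this
    rwa [Submodule.coe_sum] at this
  · intro x hxI
    have hx : x ∈ I.restrictScalars k := hxI
    have hmem : (π ⟨x, hx⟩).1 ∈ Submodule.span k (Set.range w) := hwspan ▸ Submodule.mem_top
    obtain ⟨a, ha⟩ := (Submodule.mem_span_range_iff_exists_fun k).1 hmem
    refine ⟨fun i => (N * n)⁻¹ * a i, fun j => N⁻¹ * (π ⟨x, hx⟩).2 j, ?_⟩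
    have h0 : π (⟨x, hx⟩ - (∑ i, ((N * n)⁻¹ * a i) • f i +
        ∑ j, (N⁻¹ * (π ⟨x, hx⟩).2 j) • z j)) = 0 := by
      rw [map_sub, hcomb, sub_eq_zero]
      refine Prod.ext ?_ ?_
      · simp only [mul_smul (N * (n : k))⁻¹, ← Finset.smul_sum, ha]
        rw [smul_inv_smul₀ (mul_ne_zero hN hn0)]
      · ext j
        simp [mul_inv_cancel_left₀ hN]
    have := (hker _).1 h0
    simpa [Submodule.coe_sum] using this
  · intro a b hab
    have h0 : π (∑ i, a i • f i + ∑ j, b j • z j) = 0 := (hker _).2 (by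
      simpa [Submodule.coe_sum] using hab)
    rw [hcomb, Prod.mk_eq_zero] at h0
    refine ⟨hwrel a ((smul_eq_zero.1 h0.1).resolve_left (mul_ne_zero hN hn0)), fun j => ?_⟩
    exact congrFun ((smul_eq_zero.1 h0.2).resolve_left hN) j

theorem exists_equivariant_generators_of_standard [CharZero k] (hn : 2 ≤ n)
    {I : Ideal (MvPolynomial (Fin n) k)} (hstab : IsSymStable I) {d m : ℕ} {c : Fin m → ℕ}
    (hgen : GradedIso (generatorGrading I hstab)
      (sumTrivialGrading (spechtRep k n (standardShape n hn)) d c)) :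
    ∃ (f : Fin n → MvPolynomial (Fin n) k) (z : Fin m → MvPolynomial (Fin n) k),
      (∀ i, f i ∈ I) ∧ (∀ j, z j ∈ I) ∧ (∀ i, (f i).IsHomogeneous d) ∧
      (∀ j, (z j).IsHomogeneous (c j)) ∧
      (∀ (σ : Equiv.Perm (Fin n)) i, rename σ (f i) = f (σ i)) ∧
      (∀ (σ : Equiv.Perm (Fin n)) j, rename σ (z j) = z j) ∧ ∑ i, f i = 0 ∧
      (∀ x ∈ I, ∃ (a : Fin n → k) (b : Fin m → k),
        x - (∑ i, a i • f i + ∑ j, b j • z j) ∈ irrelevant k n * I) ∧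
      ∀ (a : Fin n → k) (b : Fin m → k),
        ∑ i, a i • f i + ∑ j, b j • z j ∈ irrelevant k n * I →
          (∀ i j, a i = a j) ∧ ∀ j, b j = 0 := by
  obtain ⟨w, hw, hwsum, hwspan, hwrel⟩ := exists_standard_vectors (k := k) hn
  exact exists_equivariant_generators (W := (spechtModule k n (standardShape n hn)).toSubmodule)
    hn hw hwsum hwspan hwrel hstab hgen

end Lifting

/-! ### Minimal homogeneous generators -/

section MinimalGenerators

variable {k : Type*} [Field k] {n : ℕ} {I : Ideal (MvPolynomial (Fin n) k)}

theorem mem_irrelevant_iff {x : MvPolynomial (Fin n) k} :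
    x ∈ irrelevant k n ↔ coeff 0 x = 0 := by
  have := mem_pow_idealOfVars_iff' (σ := Fin n) (R := k) 1 x
  rw [pow_one] at this
  refine this.trans ⟨fun h => h 0 (by simp), fun h m hm => ?_⟩
  rwa [Finsupp.degree_eq_zero_iff m |>.1 (by omega)]

theorem IsHomogeneousIdeal.homogeneousComponent_mem (hI : IsHomogeneousIdeal I)
    {x : MvPolynomial (Fin n) k} (hx : x ∈ I) (e : ℕ) : homogeneousComponent e x ∈ I :=
  homogeneousComponent_mem_of_mem hI hx e

theorem homogeneousComponent_mul_of_isHomogeneous {g : MvPolynomial (Fin n) k} {w : ℕ}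
    (hg : g.IsHomogeneous w) (r : MvPolynomial (Fin n) k) (e : ℕ) :
    homogeneousComponent e (g * r) =
      if w ≤ e then g * homogeneousComponent (e - w) r else 0 := by
  let _ := gradedAlgebra (σ := Fin n) (R := k)
  have h := DirectSum.coe_decompose_mul_of_left_mem (homogeneousSubmodule (Fin n) k) (b := r) e hg
  have hd : ∀ (x : MvPolynomial (Fin n) k) (e : ℕ),
      (DirectSum.decompose (homogeneousSubmodule (Fin n) k) x e : MvPolynomial (Fin n) k) =
        homogeneousComponent e x := fun x e => decomposition.decompose'_apply x e
  rwa [hd, hd] at h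

theorem IsHomogeneousIdeal.le_irrelevant (hI : IsHomogeneousIdeal I) (hne : I ≠ ⊤) :
    I ≤ irrelevant k n := by
  intro x hx
  rw [mem_irrelevant_iff]
  by_contra h
  have h0 := hI.homogeneousComponent_mem hx 0
  rw [homogeneousComponent_zero] at h0
  exact hne (Ideal.eq_top_of_isUnit_mem _ h0 ((isUnit_iff_ne_zero.2 h).map C))

/-- A homogeneous form of Nakayama's lemma. -/
theorem span_range_eq_of_le_sup {ι : Type*} [Fintype ι] {g : ι → MvPolynomial (Fin n) k}
    {w : ι → ℕ} (hI : IsHomogeneousIdeal I) (hg : ∀ i, g i ∈ I)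
    (hgw : ∀ i, (g i).IsHomogeneous (w i))
    (hle : I ≤ Ideal.span (Set.range g) ⊔ irrelevant k n * I) : Ideal.span (Set.range g) = I := by
  apply le_antisymm (Ideal.span_le.2 (by rintro _ ⟨i, rfl⟩; exact hg i))
  have hcomp : ∀ x ∈ Ideal.span (Set.range g), ∀ e,
      homogeneousComponent e x ∈ Ideal.span (Set.range g) := by
    intro x hx e
    obtain ⟨c, rfl⟩ := Ideal.mem_span_range_iff_exists_fun.1 hx
    rw [map_sum]
    refine Ideal.sum_mem _ fun i _ => ?_
    rw [mul_comm, homogeneousComponent_mul_of_isHomogeneous (hgw i)]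
    split_ifs
    · exact Ideal.mul_mem_right _ _ (Ideal.subset_span ⟨i, rfl⟩)
    · exact zero_mem _
  have hpow : ∀ N : ℕ, I ≤ Ideal.span (Set.range g) ⊔ irrelevant k n ^ N * I := by
    intro N
    induction N with
    | zero => simp
    | succ N ih =>
      refine ih.trans (sup_le le_sup_left ((Ideal.mul_mono_right hle).trans ?_))
      rw [Ideal.mul_sup, ← mul_assoc, ← pow_succ]
      exact sup_le_sup_right Ideal.mul_le_right _
  -- Taking the power e+1 of the irrelevant ideal, the error term has no component in degree e.
  have hhom : ∀ e, ∀ x ∈ I, x.IsHomogeneous e → x ∈ Ideal.span (Set.range g) := by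
    intro e x hx hxe
    obtain ⟨j, hj, y, hy, hjy⟩ := Submodule.mem_sup.1 (hpow (e + 1) hx)
    have hy' : y ∈ idealOfVars (Fin n) k ^ (e + 1) := Ideal.mul_le_left hy
    rw [mem_pow_idealOfVars_iff'] at hy'
    have hy0 : homogeneousComponent e y = 0 := by
      ext m
      rw [coeff_homogeneousComponent, coeff_zero]
      split_ifs with h
      · exact hy' m (by omega)
      · rfl
    rw [← homogeneousComponent_eq_self hxe, ← hjy, map_add, hy0, add_zero]
    exact hcomp j hj e
  intro x hx
  rw [← sum_homogeneousComponent x]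
  exact Ideal.sum_mem _ fun e _ =>
    hhom e _ (hI.homogeneousComponent_mem hx e) (homogeneousComponent_isHomogeneous e x)

/-- Such a family lifts a basis of I/𝔪I, so its size depends only on I. Homogeneity is not required,
so the count also applies to the regular sequence. -/
theorem card_eq_finrank_of_generators {κ : Type*} [Fintype κ] {h : κ → MvPolynomial (Fin n) k}
    (hmem : ∀ j, h j ∈ I)
    (hspan : ∀ x ∈ I, ∃ b : κ → k, x - ∑ j, b j • h j ∈ irrelevant k n * I)
    (hli : ∀ b : κ → k, ∑ j, b j • h j ∈ irrelevant k n * I → ∀ j, b j = 0) :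
    Fintype.card κ = Module.finrank k ((I.restrictScalars k).map
      ((irrelevant k n * I).restrictScalars k).mkQ) := by
  let q := ((irrelevant k n * I).restrictScalars k).mkQ
  have hq : ∀ x, q x = 0 ↔ x ∈ irrelevant k n * I := fun x => Submodule.Quotient.mk_eq_zero _
  have h1 : LinearIndependent k fun j => q (h j) := by
    rw [Fintype.linearIndependent_iff]
    intro b hb
    refine hli b ?_
    rw [← hq, map_sum]
    simpa only [map_smul] using hb
  have h2 : Submodule.span k (Set.range fun j => q (h j)) = (I.restrictScalars k).map q := by
    apply le_antisymm
    · rw [Submodule.span_le]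
      rintro _ ⟨j, rfl⟩
      exact ⟨h j, hmem j, rfl⟩
    · rintro _ ⟨x, hx, rfl⟩
      obtain ⟨b, hb⟩ := hspan x hx
      rw [← hq, map_sub, sub_eq_zero] at hb
      rw [hb, map_sum]
      refine Submodule.sum_mem _ fun j _ => ?_
      rw [map_smul]
      exact Submodule.smul_mem _ _ (Submodule.subset_span ⟨j, rfl⟩)
  rw [← finrank_span_eq_card h1, h2]

/-- Minimal homogeneous generators of a complete intersection ideal are quasi-regular. -/
theorem isQuasiRegular_of_minimal_generators {ι : Type*} [Fintype ι] [DecidableEq ι]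
    {g : ι → MvPolynomial (Fin n) k} {w : ι → ℕ} (hI : IsHomogeneousIdeal I)
    (hci : IsCompleteIntersection I) (hg : ∀ i, g i ∈ I) (hgw : ∀ i, (g i).IsHomogeneous (w i))
    (hspan : ∀ x ∈ I, ∃ b : ι → k, x - ∑ j, b j • g j ∈ irrelevant k n * I)
    (hli : ∀ b : ι → k, ∑ j, b j • g j ∈ irrelevant k n * I → ∀ j, b j = 0) :
    Ideal.span (Set.range g) = I ∧ IsQuasiRegular g ∧ ∀ i, w i ≠ 0 := by
  obtain ⟨rs, hrs, rfl⟩ := hci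
  set I := Ideal.ofList rs with hIdef
  have hne : I ≠ ⊤ := by
    have := hrs.top_ne_smul
    rwa [smul_eq_mul, Ideal.mul_top, ne_comm] at this
  have hIm := hI.le_irrelevant hne
  have hgI : Ideal.span (Set.range g) = I := by
    refine span_range_eq_of_le_sup hI hg hgw fun x hx => ?_
    obtain ⟨b, hb⟩ := hspan x hx
    refine Submodule.mem_sup.2 ⟨_, ?_, _, hb, add_sub_cancel _ _⟩
    exact Ideal.sum_mem _ fun j _ => Submodule.smul_of_tower_mem _ _ (Ideal.subset_span ⟨j, rfl⟩)
  obtain ⟨a, ha, haI⟩ := exists_isQuasiRegular_of_isWeaklyRegular hrs.toIsWeaklyRegular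
  rw [← hIdef] at haI
  have hcard : Fintype.card ι = Fintype.card (Fin rs.length) := by
    rw [card_eq_finrank_of_generators hg hspan hli]
    refine (card_eq_finrank_of_generators (h := a) (fun j => ?_) (fun x hx => ?_)
      fun b hb j => ?_).symm
    · exact haI ▸ Ideal.subset_span ⟨j, rfl⟩
    · rw [← haI] at hx
      obtain ⟨r, rfl⟩ := Ideal.mem_span_range_iff_exists_fun.1 hx
      -- Modulo 𝔪I only the constant terms of the coefficients matter.
      refine ⟨fun j => coeff 0 (r j), ?_⟩
      rw [← Finset.sum_sub_distrib]
      refine Ideal.sum_mem _ fun j _ => ?_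
      rw [smul_eq_C_mul, ← sub_mul]
      refine Ideal.mul_mem_mul ?_ (haI ▸ Ideal.subset_span ⟨j, rfl⟩)
      rw [mem_irrelevant_iff, coeff_sub, coeff_C, if_pos rfl, sub_self]
    · have := ha.coeff_mem_of_mem_mul (haI.le.trans hIm) (c := fun j => C (b j)) (by
        rw [haI]
        simpa only [smul_eq_C_mul] using hb) j
      rwa [mem_irrelevant_iff, coeff_C, if_pos rfl] at this
  refine ⟨hgI, ha.of_span_eq (hgI.trans haI.symm) hcard, fun i hi => ?_⟩
  -- A generator of degree zero is a constant lying in 𝔪, hence zero, which contradicts independence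
  -- modulo 𝔪I.
  have h0 : g i = 0 := by
    have h1 := hgw i
    rw [hi] at h1
    obtain ⟨c, hc⟩ : ∃ c, g i = C c := ⟨_, totalDegree_eq_zero_iff_eq_C.1 (by
      simpa using h1.totalDegree_le)⟩
    have h2 := mem_irrelevant_iff.1 (hIm (hg i))
    rw [hc, coeff_C, if_pos rfl] at h2
    rw [hc, h2, C_0]
  have := hli (Pi.single i 1) (by
    rw [Finset.sum_eq_single i]
    · simp [h0]
    · intro j _ hj
      rw [Pi.single_eq_of_ne hj, zero_smul]
    · simp) i
  simp at this

end MinimalGenerators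

/-! ### An equivariant graded complement of the ideal -/

section EquivariantProjection

variable {k : Type*} [Field k] {n : ℕ} {I : Ideal (MvPolynomial (Fin n) k)}

theorem exists_graded_projection (hI : IsHomogeneousIdeal I) :
    ∃ p : MvPolynomial (Fin n) k →ₗ[k] MvPolynomial (Fin n) k,
      (∀ e x, x.IsHomogeneous e → (p x).IsHomogeneous e) ∧ (∀ x, x - p x ∈ I) ∧
      ∀ x ∈ I, p x = 0 := by
  have hq : ∀ e, ∃ q : MvPolynomial (Fin n) k →ₗ[k] MvPolynomial (Fin n) k,
      (∀ x, q x ∈ I ∧ (q x).IsHomogeneous e) ∧ ∀ x ∈ I, x.IsHomogeneous e → q x = x := by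
    intro e
    let U : Submodule k (MvPolynomial (Fin n) k) :=
      I.restrictScalars k ⊓ homogeneousSubmodule (Fin n) k e
    obtain ⟨q, hq⟩ := U.subtype.exists_leftInverse_of_injective U.ker_subtype
    refine ⟨U.subtype ∘ₗ q, fun x => (q x).2, fun x hx hxe => ?_⟩
    exact congrArg Subtype.val (LinearMap.congr_fun hq ⟨x, hx, hxe⟩)
  choose q hqmem hqid using hq
  -- The projections q e onto the degree-e parts of I are glued on the monomial basis; `id - p₁` is
  -- then a graded projection with kernel I.
  let p₁ : MvPolynomial (Fin n) k →ₗ[k] MvPolynomial (Fin n) k :=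
    (basisMonomials (Fin n) k).constr k fun m => q m.degree (monomial m 1)
  have hp₁ : ∀ e x, x.IsHomogeneous e → p₁ x = q e x := by
    intro e x hx
    rw [x.as_sum, map_sum, map_sum]
    refine Finset.sum_congr rfl fun m hm => ?_
    have hm' : m.degree = e := by
      by_contra h
      exact mem_support_iff.1 hm (hx.coeff_eq_zero h)
    have h1 : (monomial m (coeff m x) : MvPolynomial (Fin n) k) = coeff m x • monomial m 1 := by
      rw [smul_monomial, smul_eq_mul, mul_one]
    rw [h1, map_smul, map_smul, ← hm']
    congr 1
    have := (basisMonomials (Fin n) k).constr_basis k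
      (fun m => q m.degree (monomial m 1)) m
    rwa [coe_basisMonomials] at this
  have hsum : ∀ x, p₁ x = ∑ e ∈ Finset.range (x.totalDegree + 1),
      q e (homogeneousComponent e x) := by
    intro x
    conv_lhs => rw [← sum_homogeneousComponent x]
    rw [map_sum]
    exact Finset.sum_congr rfl fun e _ => hp₁ e _ (homogeneousComponent_isHomogeneous e x)
  refine ⟨LinearMap.id - p₁, fun e x hx => ?_, fun x => ?_, fun x hx => ?_⟩
  · rw [LinearMap.sub_apply, hp₁ e x hx]
    exact hx.sub (hqmem e x).2
  · rw [LinearMap.sub_apply, LinearMap.id_apply, sub_sub_cancel, hsum]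
    exact Ideal.sum_mem _ fun e _ => (hqmem e _).1
  · rw [LinearMap.sub_apply, LinearMap.id_apply, sub_eq_zero, hsum]
    conv_lhs => rw [← sum_homogeneousComponent x]
    exact Finset.sum_congr rfl fun e _ => (hqid e _ (hI.homogeneousComponent_mem hx e)
      (homogeneousComponent_isHomogeneous e x)).symm

/-- Maschke averaging: since I is stable, conjugating p by a permutation keeps both conditions
relating it to I, and so does the mean. The fixed vectors of the result model R/I inside R. -/
theorem exists_equivariant_graded_projection [CharZero k] (hI : IsHomogeneousIdeal I)
    (hstab : IsSymStable I) :
    ∃ p : MvPolynomial (Fin n) k →ₗ[k] MvPolynomial (Fin n) k,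
      (∀ e x, x.IsHomogeneous e → (p x).IsHomogeneous e) ∧ (∀ x, x - p x ∈ I) ∧
      (∀ x ∈ I, p x = 0) ∧ ∀ (σ : Equiv.Perm (Fin n)) x, p (rename σ x) = rename σ (p x) := by
  obtain ⟨p, hp, hpI, hp0⟩ := exists_graded_projection hI
  have hN : ((Fintype.card (Equiv.Perm (Fin n)) : ℕ) : k) ≠ 0 :=
    Nat.cast_ne_zero.2 Fintype.card_ne_zero
  let P : MvPolynomial (Fin n) k →ₗ[k] MvPolynomial (Fin n) k :=
    ((Fintype.card (Equiv.Perm (Fin n)) : ℕ) : k)⁻¹ •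
      ∑ τ : Equiv.Perm (Fin n), polyRep k n τ ∘ₗ p ∘ₗ polyRep k n τ⁻¹
  have hP : ∀ x, P x = ((Fintype.card (Equiv.Perm (Fin n)) : ℕ) : k)⁻¹ •
      ∑ τ : Equiv.Perm (Fin n), polyRep k n τ (p (polyRep k n τ⁻¹ x)) := fun x => by
    simp [P]
  refine ⟨P, fun e x hx => ?_, fun x => ?_, fun x hx => ?_, fun σ x => ?_⟩
  · rw [hP]
    refine (homogeneousSubmodule (Fin n) k e).smul_mem _ (Submodule.sum_mem _ fun τ _ => ?_)
    exact (hp e _ hx.rename_isHomogeneous).rename_isHomogeneous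
  · have hx : x = ((Fintype.card (Equiv.Perm (Fin n)) : ℕ) : k)⁻¹ •
        ∑ τ : Equiv.Perm (Fin n), polyRep k n τ (polyRep k n τ⁻¹ x) := by
      simp only [Representation.self_inv_apply, Finset.sum_const, Finset.card_univ]
      rw [← Nat.cast_smul_eq_nsmul k, smul_smul, inv_mul_cancel₀ hN, one_smul]
    have hsub : x - P x = ((Fintype.card (Equiv.Perm (Fin n)) : ℕ) : k)⁻¹ •
        ∑ τ : Equiv.Perm (Fin n), polyRep k n τ (polyRep k n τ⁻¹ x - p (polyRep k n τ⁻¹ x)) := by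
      simp only [map_sub, Finset.sum_sub_distrib, smul_sub]
      rw [← hx, ← hP]
    rw [hsub]
    refine (I.restrictScalars k).smul_mem _ (Submodule.sum_mem _ fun τ _ => ?_)
    exact hstab τ _ (hpI _)
  · rw [hP, Finset.sum_eq_zero, smul_zero]
    intro τ _
    have : p (polyRep k n τ⁻¹ x) = 0 := hp0 _ (hstab τ⁻¹ x hx)
    rw [this, map_zero]
  · change P (polyRep k n σ x) = polyRep k n σ (P x)
    rw [hP, hP, map_smul, map_sum]
    congr 1
    refine (Fintype.sum_equiv (Equiv.mulLeft σ) _ _ fun τ => ?_).symm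
    rw [Equiv.coe_mulLeft, ← Module.End.mul_apply (polyRep k n σ), ← map_mul,
      ← Module.End.mul_apply (polyRep k n (σ * τ)⁻¹), ← map_mul]
    simp

end EquivariantProjection

/-! ### Polynomials in the generators with coefficients in a complement -/

section WeightedPart

variable {k R ι : Type*} [Field k] [CommRing R] [Algebra k R]

/-- The polynomials over `R` of weighted degree `e`, where the variables have weights `w` and the
coefficients of degree `j` are those in `A j`. -/
def weightedPart (A : ℤ → Submodule k R) (w : ι → ℕ) (e : ℤ) :
    Submodule k (MvPolynomial ι R) where
  carrier := {F | ∀ a, coeff a F ∈ A (e - Finsupp.weight w a)}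
  zero_mem' := fun a => by rw [coeff_zero]; exact zero_mem _
  add_mem' := fun hF hG a => by rw [coeff_add]; exact add_mem (hF a) (hG a)
  smul_mem' := fun r F hF a => by rw [coeff_smul]; exact Submodule.smul_mem _ _ (hF a)

variable {A : ℤ → Submodule k R} {w : ι → ℕ}

theorem monomial_mem_weightedPart {e : ℤ} {a : ι →₀ ℕ} {x : R}
    (hx : x ∈ A (e - Finsupp.weight w a)) : monomial a x ∈ weightedPart A w e := by
  classical
  intro b
  rw [coeff_monomial]
  split_ifs with h
  · exact h ▸ hx
  · exact zero_mem _

theorem C_mem_weightedPart {e : ℤ} {x : R} (hx : x ∈ A e) : C x ∈ weightedPart A w e :=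
  monomial_mem_weightedPart (by simpa using hx)

theorem X_mul_mem_weightedPart {e e' : ℤ} {F : MvPolynomial ι R} (hF : F ∈ weightedPart A w e)
    (i : ι) (he : e' = e + w i) : X i * F ∈ weightedPart A w e' := by
  classical
  intro a
  rw [coeff_X_mul']
  split_ifs with h
  · have h1 : a = (a - Finsupp.single i 1) + Finsupp.single i 1 := by
      refine (tsub_add_cancel_of_le ?_).symm
      rw [Finsupp.single_le_iff]
      exact Nat.one_le_iff_ne_zero.2 (Finsupp.mem_support_iff.1 h)
    have h2 := congrArg (Finsupp.weight w) h1
    rw [map_add, Finsupp.weight_single, one_smul] at h2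
    convert hF (a - Finsupp.single i 1) using 2
    omega
  · exact zero_mem _

/-- The weighted parts are generated by constants under multiplication by variables. -/
theorem weightedPart_le {S : ℤ → Submodule k (MvPolynomial ι R)}
    (hC : ∀ e, ∀ x ∈ A e, C x ∈ S e) (hX : ∀ e i, ∀ F ∈ S e, X i * F ∈ S (e + w i)) (e : ℤ) :
    weightedPart A w e ≤ S e := by
  have hmon : ∀ (a : ι →₀ ℕ) (e : ℤ), ∀ F ∈ S e,
      monomial a (1 : R) * F ∈ S (e + Finsupp.weight w a) := by
    intro a
    induction a using Finsupp.induction_linear with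
    | zero => intro e F hF; simpa using hF
    | add a b ha hb =>
      intro e F hF
      have := ha _ _ (hb e F hF)
      rw [← mul_assoc, monomial_mul, one_mul] at this
      convert this using 2
      rw [map_add]
      push_cast
      ring
    | single i b =>
      induction b with
      | zero => intro e F hF; simpa using hF
      | succ b ih =>
        intro e F hF
        have := hX _ i _ (ih e F hF)
        rw [← mul_assoc, X, monomial_mul, one_mul, ← Finsupp.single_add, add_comm 1 b] at this
        convert this using 2
        simp only [Finsupp.weight_single, smul_eq_mul]
        push_cast
        ring
  intro F hF
  rw [F.as_sum]
  refine Submodule.sum_mem _ fun a _ => ?_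
  have := hmon a _ _ (hC _ _ (hF a))
  rwa [mul_comm, C_mul_monomial, mul_one, sub_add_cancel] at this

theorem finite_setOf_weight_le [Finite ι] (hw : ∀ i, w i ≠ 0) (e : ℤ) :
    {a : ι →₀ ℕ | (Finsupp.weight w a : ℤ) ≤ e}.Finite := by
  refine (Finsupp.finite_of_nat_weight_le w hw e.toNat).subset fun a ha => ?_
  simp only [Set.mem_ofPred_eq] at ha ⊢
  omega

/-- Degrees are integers so that subtracting a weight is never truncated. Positive weights and the
vanishing of A in negative degrees leave finitely many exponents. -/
theorem finiteDimensional_weightedPart [Finite ι] (hw : ∀ i, w i ≠ 0)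
    (hneg : ∀ e < 0, A e = ⊥) [∀ e, FiniteDimensional k (A e)] (e : ℤ) :
    FiniteDimensional k (weightedPart A w e) := by
  classical
  let s := (finite_setOf_weight_le hw e).toFinset
  have h : weightedPart A w e ≤ ⨆ a ∈ s, (A (e - Finsupp.weight w a)).map
      ((monomial a : R →ₗ[R] MvPolynomial ι R).restrictScalars k) := by
    intro F hF
    rw [F.as_sum]
    refine Submodule.sum_mem _ fun a ha => ?_
    have has : a ∈ s := by
      rw [Set.Finite.mem_toFinset]
      by_contra h
      have := hF a
      rw [hneg _ (by simp only [Set.mem_ofPred_eq] at h; omega), Submodule.mem_bot] at this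
      exact mem_support_iff.1 ha this
    exact Submodule.mem_iSup_of_mem a (Submodule.mem_iSup_of_mem has ⟨_, hF a, rfl⟩)
  rw [← Finset.sup_eq_iSup] at h
  exact Submodule.finiteDimensional_of_le h

variable (k) in
/-- Permutation of the variables by `π` and action of `σ` on the coefficients. -/
def semiRename (σ : R →ₐ[k] R) (π : Equiv.Perm ι) : Module.End k (MvPolynomial ι R) :=
  ((rename π : MvPolynomial ι R →ₐ[R] MvPolynomial ι R).toLinearMap.restrictScalars k) ∘ₗ
    (mapAlgHom σ).toLinearMap

theorem semiRename_apply (σ : R →ₐ[k] R) (π : Equiv.Perm ι) (F : MvPolynomial ι R) :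
    semiRename k σ π F = rename π (map (σ : R →+* R) F) := rfl

theorem coeff_mapDomain_semiRename (σ : R →ₐ[k] R) (π : Equiv.Perm ι) (F : MvPolynomial ι R)
    (a : ι →₀ ℕ) : coeff (a.mapDomain π) (semiRename k σ π F) = σ (coeff a F) := by
  rw [semiRename_apply, coeff_rename_mapDomain _ π.injective, coeff_map]
  rfl

theorem weight_mapDomain_perm {w : ι → ℕ} {π : Equiv.Perm ι} (hπ : ∀ i, w (π i) = w i)
    (a : ι →₀ ℕ) : Finsupp.weight w (a.mapDomain π) = Finsupp.weight w a := by
  induction a using Finsupp.induction_linear with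
  | zero => simp
  | add a b ha hb => rw [Finsupp.mapDomain_add, map_add, map_add, ha, hb]
  | single i b => rw [Finsupp.mapDomain_single, Finsupp.weight_single, Finsupp.weight_single, hπ]

theorem semiRename_mem_weightedPart {A : ℤ → Submodule k R} {w : ι → ℕ} {σ : R →ₐ[k] R}
    (hσ : ∀ e, ∀ x ∈ A e, σ x ∈ A e) {π : Equiv.Perm ι} (hπ : ∀ i, w (π i) = w i) {e : ℤ}
    {F : MvPolynomial ι R} (hF : F ∈ weightedPart A w e) :
    semiRename k σ π F ∈ weightedPart A w e := by
  intro b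
  have hb : b = (b.mapDomain π.symm).mapDomain π := by
    rw [← Finsupp.mapDomain_comp, Equiv.self_comp_symm, Finsupp.mapDomain_id]
  rw [hb, coeff_mapDomain_semiRename, weight_mapDomain_perm hπ]
  exact hσ _ _ (hF _)

/-- The operator carries the block of an exponent to that of its image under π, so only fixed
exponents meet the diagonal. -/
theorem traceOn_weightedPart [Finite ι] (hw : ∀ i, w i ≠ 0) (hneg : ∀ e < 0, A e = ⊥)
    [∀ e, FiniteDimensional k (A e)] (σ : R →ₐ[k] R) (hσ : ∀ e, ∀ x ∈ A e, σ x ∈ A e)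
    (π : Equiv.Perm ι) (hπ : ∀ i, w (π i) = w i) (e : ℤ) [DecidableEq ι] :
    traceOn (semiRename k σ π) (weightedPart A w e) =
      ∑ a ∈ (finite_setOf_weight_le hw e).toFinset with a.mapDomain π = a,
        traceOn σ.toLinearMap (A (e - Finsupp.weight w a)) := by
  have := finiteDimensional_weightedPart hw hneg e (A := A)
  rw [traceOn_eq_sum (X := fun a => R) (U := weightedPart A w e)
    (finite_setOf_weight_le hw e).toFinset _ (fun a => A (e - Finsupp.weight w a))
    (fun a => (monomial a : R →ₗ[R] MvPolynomial ι R).restrictScalars k)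
    (fun a => (lcoeff R a).restrictScalars k)]
  · rw [Finset.sum_filter]
    refine Finset.sum_congr rfl fun a _ => ?_
    split_ifs with h
    · refine traceOn_congr fun x _ => ?_
      change coeff a (rename π (map (σ : R →+* R) (monomial a x))) = σ x
      conv_lhs => rw [← h]
      rw [h, map_monomial, rename_monomial, h, coeff_monomial, if_pos rfl]
      rfl
    · refine (traceOn_congr fun x _ => ?_).trans (traceOn_zero _)
      change coeff a (rename π (map (σ : R →+* R) (monomial a x))) = 0
      rw [map_monomial, rename_monomial, coeff_monomial, if_neg h]
  · exact fun a _ x hx => monomial_mem_weightedPart hx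
  · exact fun a _ F hF => hF a
  · intro F hF
    conv_rhs => rw [F.as_sum]
    refine (Finset.sum_subset (fun a ha => ?_) fun a _ ha => ?_).symm
    · rw [Set.Finite.mem_toFinset]
      by_contra h
      have := hF a
      rw [hneg _ (by simp only [Set.mem_ofPred_eq] at h; omega), Submodule.mem_bot] at this
      exact mem_support_iff.1 ha this
    · change monomial a (coeff a F) = 0
      rw [notMem_support_iff.1 ha, monomial_zero]
  · exact fun F hF => semiRename_mem_weightedPart hσ hπ hF

/-- Weighted parts in variables subject to a linear change: modulo multiples of `y`, the variable
`X l` can be eliminated. -/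
theorem exists_eq_rename_add_mul {κ : Type*} {w : κ → ℕ} (emb : ι → κ) (l : κ)
    (hl : ∀ i, i = l ∨ ∃ j, emb j = i) (s : Finset ι) (hs : ∀ j ∈ s, w (emb j) = w l) {e : ℤ}
    {F : MvPolynomial κ R} (hF : F ∈ weightedPart A w e) :
    ∃ F₀ ∈ weightedPart A (w ∘ emb) e, ∃ G ∈ weightedPart A w (e - w l),
      rename emb F₀ + (X l + ∑ j ∈ s, X (emb j)) * G = F := by
  let S : ℤ → Submodule k (MvPolynomial κ R) := fun e =>
    (weightedPart A (w ∘ emb) e).map ((rename emb : _ →ₐ[R] MvPolynomial κ R).restrictScalars k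
      |>.toLinearMap) ⊔
    (weightedPart A w (e - w l)).map (LinearMap.mulLeft k (X l + ∑ j ∈ s, X (emb j)))
  have hS1 : ∀ e, ∀ F₀ ∈ weightedPart A (w ∘ emb) e, rename emb F₀ ∈ S e := fun e F₀ h =>
    Submodule.mem_sup_left ⟨F₀, h, rfl⟩
  have hS2 : ∀ e, ∀ G ∈ weightedPart A w (e - w l), (X l + ∑ j ∈ s, X (emb j)) * G ∈ S e :=
    fun e G h => Submodule.mem_sup_right ⟨G, h, rfl⟩
  have hle : weightedPart A w e ≤ S e := by
    refine weightedPart_le (fun e x hx => ?_) (fun e i F hF => ?_) e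
    · rw [← rename_C emb]
      exact hS1 _ _ (C_mem_weightedPart hx)
    · obtain ⟨_, ⟨F₀, hF₀, rfl⟩, _, ⟨G, hG, rfl⟩, rfl⟩ := Submodule.mem_sup.1 hF
      change X i * (rename emb F₀ + (X l + ∑ j ∈ s, X (emb j)) * G) ∈ _
      have hG' := hS2 _ _ (X_mul_mem_weightedPart hG i (e' := e + w i - w l) (by ring))
      rw [mul_add, mul_left_comm]
      refine add_mem ?_ hG'
      have hj : ∀ j, X (emb j) * rename emb F₀ ∈ S (e + w (emb j)) := fun j => by
        rw [← rename_X, ← map_mul]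
        exact hS1 _ _ (X_mul_mem_weightedPart hF₀ j rfl)
      obtain rfl | ⟨j, rfl⟩ := hl i
      · have h1 : X i * rename emb F₀ = (X i + ∑ j ∈ s, X (emb j)) * rename emb F₀ -
            ∑ j ∈ s, X (emb j) * rename emb F₀ := by rw [add_mul, Finset.sum_mul]; ring
        rw [h1]
        refine sub_mem (hS2 _ _ ?_) (Submodule.sum_mem _ fun j hjs => hs j hjs ▸ hj j)
        rw [add_sub_cancel_right]
        refine weightedPart_le (S := fun e => (weightedPart A w e).comap
          ((rename emb : _ →ₐ[R] MvPolynomial κ R).restrictScalars k).toLinearMap)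
          (fun e x hx => ?_) (fun e j F hF => ?_) e hF₀
        · change rename emb (C x) ∈ weightedPart A w _
          rw [rename_C]
          exact C_mem_weightedPart hx
        · change rename emb (X j * F) ∈ weightedPart A w _
          rw [map_mul, rename_X]
          exact X_mul_mem_weightedPart hF _ rfl
      · exact hj j
  obtain ⟨_, ⟨F₀, hF₀, rfl⟩, _, ⟨G, hG, rfl⟩, h⟩ := Submodule.mem_sup.1 (hle hF)
  exact ⟨F₀, hF₀, G, hG, h⟩

/-- Injectivity of evaluation on polynomials with coefficients in a complement. Once the components
below s vanish, the value of the s-th is minus that of the higher ones and lies in the (s+1)-st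
power, so its coefficients lie in the ideal and vanish. -/
theorem IsQuasiRegular.eq_zero_of_eval_eq_zero {g : ι → R} (hg : IsQuasiRegular g)
    {F : MvPolynomial ι R} (hF : ∀ a, coeff a F ∈ Ideal.span (Set.range g) → coeff a F = 0)
    (h0 : eval g F = 0) : F = 0 := by
  have hcomp : ∀ s, homogeneousComponent s F = 0 := by
    intro s
    induction s using Nat.strong_induction_on with
    | _ s ih =>
      have h1 : eval g (homogeneousComponent s F) =
          - ∑ t ∈ (Finset.range (F.totalDegree + 1)).erase s,
            eval g (homogeneousComponent t F) := by
        by_cases hs : s ∈ Finset.range (F.totalDegree + 1)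
        · rw [eq_neg_iff_add_eq_zero,
            Finset.add_sum_erase _ (fun t => eval g (homogeneousComponent t F)) hs, ← map_sum,
            sum_homogeneousComponent, h0]
        · rw [Finset.erase_eq_of_notMem hs, ← map_sum, sum_homogeneousComponent, h0,
            homogeneousComponent_eq_zero _ _ (by simpa using hs), map_zero, neg_zero]
      have h2 : eval g (homogeneousComponent s F) ∈ Ideal.span (Set.range g) ^ (s + 1) := by
        rw [h1]
        refine neg_mem (Ideal.sum_mem _ fun t ht => ?_)
        rcases lt_trichotomy t s with h | h | h
        · rw [ih t h, map_zero]
          exact zero_mem _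
        · exact absurd h (Finset.ne_of_mem_erase ht)
        · exact Ideal.pow_le_pow_right h (eval_mem_pow (homogeneousComponent_isHomogeneous t F))
      ext a
      have h3 := hg s _ (homogeneousComponent_isHomogeneous s F) h2 a
      rw [coeff_homogeneousComponent] at h3 ⊢
      split_ifs at h3 ⊢
      · exact hF a h3
      · rfl
  rw [← sum_homogeneousComponent F]
  exact Finset.sum_eq_zero fun s _ => hcomp s

end WeightedPart

/-! ### Counting fixed monomials by weighted degree -/

section FixedSeries

variable (k : Type*) [Field k] {ι κ : Type*}

/-- The generating function of the exponents fixed by `π`, counted by weighted degree. -/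
def fixedSeries (π : Equiv.Perm ι) (w : ι → ℕ) : PowerSeries k :=
  PowerSeries.mk fun i =>
    (Nat.card {a : ι →₀ ℕ // Finsupp.weight w a = i ∧ a.mapDomain π = a} : k)

variable {k}

theorem mapDomain_sumElim_equiv (π : Equiv.Perm ι) (π' : Equiv.Perm κ) (a : ι ⊕ κ →₀ ℕ) :
    a.mapDomain (Equiv.sumCongr π π') = a ↔
      (Finsupp.sumFinsuppEquivProdFinsupp a).1.mapDomain π =
          (Finsupp.sumFinsuppEquivProdFinsupp a).1 ∧
        (Finsupp.sumFinsuppEquivProdFinsupp a).2.mapDomain π' =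
          (Finsupp.sumFinsuppEquivProdFinsupp a).2 := by
  simp only [Finsupp.ext_iff]
  constructor
  · intro h
    refine ⟨fun i => ?_, fun j => ?_⟩
    · have := h (Sum.inl i)
      rw [Finsupp.mapDomain_equiv_apply] at this ⊢
      simpa using this
    · have := h (Sum.inr j)
      rw [Finsupp.mapDomain_equiv_apply] at this ⊢
      simpa using this
  · rintro ⟨h1, h2⟩ (i | j)
    · have := h1 i
      rw [Finsupp.mapDomain_equiv_apply] at this ⊢
      simpa using this
    · have := h2 j
      rw [Finsupp.mapDomain_equiv_apply] at this ⊢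
      simpa using this

theorem weight_sumElim [Fintype ι] [Fintype κ] (w : ι → ℕ) (w' : κ → ℕ) (a : ι ⊕ κ →₀ ℕ) :
    Finsupp.weight (Sum.elim w w') a =
      Finsupp.weight w (Finsupp.sumFinsuppEquivProdFinsupp a).1 +
        Finsupp.weight w' (Finsupp.sumFinsuppEquivProdFinsupp a).2 := by
  simp [Finsupp.weight_eq_sum]

theorem finite_fixed [Finite ι] (π : Equiv.Perm ι) {w : ι → ℕ} (hw : ∀ i, w i ≠ 0) (i : ℕ) :
    Finite {a : ι →₀ ℕ // Finsupp.weight w a = i ∧ a.mapDomain π = a} :=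
  ((Finsupp.finite_of_nat_weight_eq w hw i).subset fun _ h => h.1).to_subtype

theorem fixedSeries_sum [Fintype ι] [Fintype κ] (π : Equiv.Perm ι) (π' : Equiv.Perm κ)
    {w : ι → ℕ} {w' : κ → ℕ} (hw : ∀ i, w i ≠ 0) (hw' : ∀ i, w' i ≠ 0) :
    fixedSeries k (Equiv.sumCongr π π') (Sum.elim w w') =
      fixedSeries k π w * fixedSeries k π' w' := by
  ext e
  have := finite_fixed π hw
  have := finite_fixed π' hw'
  rw [PowerSeries.coeff_mul]
  simp only [fixedSeries, PowerSeries.coeff_mk]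
  simp only [← Nat.cast_mul, ← Nat.card_prod, ← Nat.cast_sum]
  rw [← Finset.sum_coe_sort, ← Nat.card_sigma]
  congr 1
  -- The two weights are determined by the exponents, so elements of the dependent sum may be
  -- compared through their exponents alone.
  have hinj : Function.Injective fun x : Σ p : Finset.HasAntidiagonal.antidiagonal e,
      {a : ι →₀ ℕ // Finsupp.weight w a = p.1.1 ∧ a.mapDomain π = a} ×
        {a : κ →₀ ℕ // Finsupp.weight w' a = p.1.2 ∧ a.mapDomain π' = a} =>
      (x.2.1.1, x.2.2.1) := by
    rintro ⟨⟨⟨i, j⟩, hij⟩, ⟨a, ha⟩, ⟨b, hb⟩⟩ ⟨⟨⟨i', j'⟩, hij'⟩, ⟨a', ha'⟩, ⟨b', hb'⟩⟩ h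
    obtain ⟨rfl, rfl⟩ : a = a' ∧ b = b' := Prod.mk.inj h
    obtain rfl : i = i' := ha.1.symm.trans ha'.1
    obtain rfl : j = j' := hb.1.symm.trans hb'.1
    rfl
  refine Nat.card_congr
    ⟨fun a => ⟨⟨(Finsupp.weight w (Finsupp.sumFinsuppEquivProdFinsupp a.1).1,
      Finsupp.weight w' (Finsupp.sumFinsuppEquivProdFinsupp a.1).2), ?_⟩,
      ⟨_, rfl, ?_⟩, ⟨_, rfl, ?_⟩⟩,
    fun x => ⟨Finsupp.sumFinsuppEquivProdFinsupp.symm (x.2.1.1, x.2.2.1), ?_, ?_⟩, ?_, ?_⟩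
  · rw [Finset.HasAntidiagonal.mem_antidiagonal, ← weight_sumElim]
    exact a.2.1
  · exact ((mapDomain_sumElim_equiv _ _ _).1 a.2.2).1
  · exact ((mapDomain_sumElim_equiv _ _ _).1 a.2.2).2
  · rw [weight_sumElim, Equiv.apply_symm_apply, x.2.1.2.1, x.2.2.2.1]
    exact Finset.HasAntidiagonal.mem_antidiagonal.1 x.1.2
  · rw [mapDomain_sumElim_equiv, Equiv.apply_symm_apply]
    exact ⟨x.2.1.2.2, x.2.2.2.2⟩
  · intro a
    exact Subtype.ext (Equiv.symm_apply_apply _ _)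
  · intro x
    exact hinj (Finsupp.sumFinsuppEquivProdFinsupp.apply_symm_apply (x.2.1.1, x.2.2.1))

theorem fixedSeries_equiv [Fintype ι] [Fintype κ] (e : ι ≃ κ) (w : κ → ℕ) :
    fixedSeries k (1 : Equiv.Perm ι) (w ∘ e) = fixedSeries k (1 : Equiv.Perm κ) w := by
  ext i
  simp only [fixedSeries, PowerSeries.coeff_mk]
  congr 1
  refine Nat.card_congr ((Finsupp.domCongr e).toEquiv.subtypeEquiv fun a => ?_)
  simp [Finsupp.weight_eq_sum, ← e.sum_comp, Equiv.Perm.coe_one]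

/-- With all weights equal to d the weighted degree is d times the degree: this is where the
substitution of t^d for t arises. -/
theorem fixedSeries_const {n d : ℕ} (σ : Equiv.Perm (Fin n)) (hd : d ≠ 0) :
    fixedSeries k σ (fun _ => d) =
      PowerSeries.expand d hd (PowerSeries.mk fun e => (fixedMonomials σ e : k)) := by
  ext e
  rw [PowerSeries.coeff_expand, fixedSeries, PowerSeries.coeff_mk]
  have hwt : ∀ a : Fin n →₀ ℕ, Finsupp.weight (fun _ => d) a = d * a.degree := fun a => by
    rw [Finsupp.weight_eq_sum, Finsupp.degree_eq_sum, Finset.mul_sum]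
    exact Finset.sum_congr rfl fun i _ => by rw [smul_eq_mul, mul_comm]
  split_ifs with h
  · obtain ⟨e, rfl⟩ := h
    rw [Nat.mul_div_cancel_left _ (Nat.pos_of_ne_zero hd), PowerSeries.coeff_mk, fixedMonomials,
      ← Nat.card_eq_finsetCard]
    congr 1
    refine Nat.card_congr (Equiv.subtypeEquivRight fun a => ?_)
    rw [Finset.mem_filter, mem_finsuppAntidiag_univ, hwt, mul_right_inj' hd]
  · have : IsEmpty {a : Fin n →₀ ℕ // Finsupp.weight (fun _ => d) a = e ∧ a.mapDomain σ = a} :=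
      ⟨fun a => h ⟨_, (hwt a.1 ▸ a.2.1).symm⟩⟩
    rw [Nat.card_of_isEmpty, Nat.cast_zero]

theorem fixedSeries_unit_mul {c : ℕ} (hc : c ≠ 0) :
    fixedSeries k (1 : Equiv.Perm (Fin 1)) (fun _ => c) * (1 - PowerSeries.X ^ c) = 1 := by
  have h : ∀ e, fixedMonomials (1 : Equiv.Perm (Fin 1)) e = 1 := by
    intro e
    refine Finset.card_eq_one.2 ⟨Finsupp.single 0 e, ?_⟩
    ext b
    rw [Finset.mem_filter, mem_finsuppAntidiag_univ, Finset.mem_singleton, Equiv.Perm.coe_one,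
      Finsupp.mapDomain_id, Finsupp.degree_eq_sum, Fin.sum_univ_one]
    constructor
    · rintro ⟨rfl, -⟩
      refine Finsupp.ext fun j => ?_
      rw [Subsingleton.elim j 0, Finsupp.single_eq_same]
    · rintro rfl
      exact ⟨Finsupp.single_eq_same, rfl⟩
  have h1 : (PowerSeries.mk fun e => (fixedMonomials (1 : Equiv.Perm (Fin 1)) e : k)) *
      (1 - PowerSeries.X) = 1 := by
    simp only [h, Nat.cast_one]
    exact PowerSeries.mk_one_mul_one_sub_eq_one k
  rw [fixedSeries_const _ hc, ← PowerSeries.expand_X c hc, ← map_one (PowerSeries.expand c hc),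
    ← map_sub, ← map_mul, h1]

/-- Each fixed variable of weight c contributes a geometric series in t^c; the induction splits off
the last variable. -/
theorem fixedSeries_one_mul_prod {m : ℕ} {c : Fin m → ℕ} (hc : ∀ j, c j ≠ 0) :
    fixedSeries k (1 : Equiv.Perm (Fin m)) c * ∏ j, (1 - PowerSeries.X ^ c j) = 1 := by
  induction m with
  | zero =>
    ext e
    rw [Finset.univ_eq_empty, Finset.prod_empty, mul_one, fixedSeries, PowerSeries.coeff_mk,
      PowerSeries.coeff_one]
    have h : ∀ a : Fin 0 →₀ ℕ, Finsupp.weight c a = 0 := fun a => by simp [Finsupp.weight_eq_sum]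
    split_ifs with he
    · have : Unique {a : Fin 0 →₀ ℕ // Finsupp.weight c a = e ∧
          a.mapDomain (1 : Equiv.Perm (Fin 0)) = a} :=
        { default := ⟨0, (h 0).trans he.symm, Subsingleton.elim _ _⟩
          uniq := fun _ => Subsingleton.elim _ _ }
      rw [Nat.card_unique, Nat.cast_one]
    · have : IsEmpty {a : Fin 0 →₀ ℕ // Finsupp.weight c a = e ∧
          a.mapDomain (1 : Equiv.Perm (Fin 0)) = a} :=
        ⟨fun a => he (a.2.1.symm.trans (h a.1))⟩
      rw [Nat.card_of_isEmpty, Nat.cast_zero]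
  | succ m ih =>
    rw [← fixedSeries_equiv finSumFinEquiv, Fin.prod_univ_castSucc]
    have h1 : c ∘ (finSumFinEquiv : Fin m ⊕ Fin 1 ≃ Fin (m + 1)) =
        Sum.elim (fun j => c j.castSucc) (fun _ => c (Fin.last m)) := by
      ext (j | j)
      · simp [Fin.castAdd, Fin.castSucc]
      · rw [Subsingleton.elim j 0]
        simp [Fin.last, Fin.natAdd]
    rw [h1, ← Equiv.Perm.sumCongr_one, Equiv.Perm.sumCongr,
      fixedSeries_sum _ _ (fun _ => hc _) (fun _ => hc _), mul_mul_mul_comm, ih fun j => hc _,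
      fixedSeries_unit_mul (hc _), one_mul]

end FixedSeries

/-! ### Traces along the evaluation map -/

section TraceRelation

variable {k R ι κ : Type*} [Field k] [CommRing R] [Algebra k R]

theorem eval_semiRename {σ : R →ₐ[k] R} {π : Equiv.Perm κ} {g : κ → R}
    (hg : ∀ i, σ (g i) = g (π i)) (F : MvPolynomial κ R) :
    eval g (semiRename k σ π F) = σ (eval g F) := by
  rw [semiRename_apply, eval_rename, eval_map]
  change _ = (σ : R →+* R) (eval g F)
  rw [← eval₂_id, eval₂_comp_left]
  congr 1
  exact funext fun i => (hg i).symm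

/-- The kernel of evaluation consists of the multiples of y = X_l + Σ X_{emb j}: modulo y the
variable X_l is eliminated, and the remaining polynomial vanishes by quasi-regularity.
Multiplication by the invariant y is injective and equivariant and shifts the degree by w_l. -/
theorem traceOn_weightedPart_relation [IsDomain R] [Finite κ] {A B : ℤ → Submodule k R}
    {w : κ → ℕ} (hw : ∀ i, w i ≠ 0) (hneg : ∀ e < 0, A e = ⊥) [∀ e, FiniteDimensional k (A e)]
    {σ : R →ₐ[k] R} (hσ : ∀ e, ∀ x ∈ A e, σ x ∈ A e) {π : Equiv.Perm κ}
    (hπ : ∀ i, w (π i) = w i) {g : κ → R} (hg : ∀ i, σ (g i) = g (π i))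
    (emb : ι → κ) (l : κ) (hl : ∀ i, i = l ∨ ∃ j, emb j = i) (hemb : ∀ j, emb j ≠ l)
    (s : Finset ι) (hs : ∀ j ∈ s, w (emb j) = w l) (hgs : g l + ∑ j ∈ s, g (emb j) = 0)
    (hπs : rename π (X l + ∑ j ∈ s, X (emb j)) = (X l + ∑ j ∈ s, X (emb j) : MvPolynomial κ R))
    (hreg : IsQuasiRegular (g ∘ emb))
    (hA : ∀ e, ∀ x ∈ A e, x ∈ Ideal.span (Set.range (g ∘ emb)) → x = 0) {e : ℤ}
    (hB : (weightedPart A w e).map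
      ((aeval g : MvPolynomial κ R →ₐ[R] R).restrictScalars k).toLinearMap = B e) :
    traceOn (semiRename k σ π) (weightedPart A w e) =
      traceOn (semiRename k σ π) (weightedPart A w (e - w l)) + traceOn σ.toLinearMap (B e) := by
  classical
  have := fun e => finiteDimensional_weightedPart (A := A) hw hneg e
  set y : MvPolynomial κ R := X l + ∑ j ∈ s, X (emb j) with hy
  have hy0 : y ≠ 0 := by
    intro h
    have := congrArg (coeff (Finsupp.single l 1)) h
    rw [hy, coeff_add, coeff_X, if_pos rfl, coeff_sum, Finset.sum_eq_zero, coeff_zero,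
      add_zero] at this
    · exact one_ne_zero this
    · intro j _
      rw [coeff_X, if_neg]
      intro h
      exact hemb j (Finsupp.single_left_injective one_ne_zero h)
  have hygs : aeval g y = 0 := by
    rw [hy, map_add, map_sum, aeval_X]
    simpa only [aeval_X] using hgs
  have hker : weightedPart A w e ⊓
      LinearMap.ker ((aeval g : MvPolynomial κ R →ₐ[R] R).restrictScalars k).toLinearMap =
      (weightedPart A w (e - w l)).map (LinearMap.mulLeft k y) := by
    apply le_antisymm
    · rintro F ⟨hF, hF0⟩
      have hF0 : aeval g F = 0 := hF0
      obtain ⟨F₀, hF₀, G, hG, rfl⟩ := exists_eq_rename_add_mul emb l hl s hs hF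
      rw [← hy, map_add, map_mul, hygs, zero_mul, add_zero, aeval_rename] at hF0
      have := hreg.eq_zero_of_eval_eq_zero (F := F₀) (fun a => hA _ _ (hF₀ a)) hF0
      rw [this, map_zero, zero_add]
      exact ⟨G, hG, rfl⟩
    · rintro _ ⟨G, hG, rfl⟩
      refine ⟨?_, ?_⟩
      · change (X l + ∑ j ∈ s, X (emb j)) * G ∈ _
        rw [add_mul, Finset.sum_mul]
        refine add_mem (X_mul_mem_weightedPart hG l (by ring)) (Submodule.sum_mem _ fun j hj => ?_)
        exact X_mul_mem_weightedPart hG _ (by rw [hs j hj]; ring)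
      · change aeval g (y * G) = 0
        rw [map_mul, hygs, zero_mul]
  rw [traceOn_eq_ker_add_map (τ' := σ.toLinearMap)
    ((aeval g : MvPolynomial κ R →ₐ[R] R).restrictScalars k).toLinearMap
    (fun F _ => eval_semiRename hg F) (fun F hF => semiRename_mem_weightedPart hσ hπ hF), hker, hB]
  congr 1
  refine traceOn_map_of_injOn _ (fun G _ => ?_)
    (fun F hF => semiRename_mem_weightedPart hσ hπ hF) fun G _ hG => ?_
  · change y * _ = semiRename k σ π (y * G)
    rw [semiRename_apply, semiRename_apply, map_mul, map_mul]
    congr 1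
    have : map (σ : R →+* R) y = y := by simp [hy]
    rw [this, hπs]
  · exact (mul_eq_zero.1 hG).resolve_left hy0

/-- Grouping the fixed exponents by weight turns the sum over exponents into a Cauchy product. -/
theorem traceOn_weightedPart_eq_coeff [Finite κ] {A : ℤ → Submodule k R}
    {w : κ → ℕ} (hw : ∀ i, w i ≠ 0) (hneg : ∀ e < 0, A e = ⊥) [∀ e, FiniteDimensional k (A e)]
    {σ : R →ₐ[k] R} (hσ : ∀ e, ∀ x ∈ A e, σ x ∈ A e) {π : Equiv.Perm κ}
    (hπ : ∀ i, w (π i) = w i) (e : ℕ) :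
    traceOn (semiRename k σ π) (weightedPart A w e) =
      PowerSeries.coeff e (fixedSeries k π w *
        PowerSeries.mk fun j => traceOn σ.toLinearMap (A j)) := by
  classical
  rw [traceOn_weightedPart hw hneg σ hσ π hπ, PowerSeries.coeff_mul,
    ← Finset.sum_fiberwise_of_maps_to
      (g := fun a => (Finsupp.weight w a, e - Finsupp.weight w a))
      (t := Finset.HasAntidiagonal.antidiagonal e)]
  · refine Finset.sum_congr rfl fun ⟨i, j⟩ hij => ?_
    rw [Finset.HasAntidiagonal.mem_antidiagonal] at hij
    simp only at hij
    rw [fixedSeries, PowerSeries.coeff_mk, PowerSeries.coeff_mk, ← nsmul_eq_mul]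
    have hcard : Nat.card {a : κ →₀ ℕ // Finsupp.weight w a = i ∧ a.mapDomain π = a} =
        (((finite_setOf_weight_le hw (e : ℤ)).toFinset.filter fun a => a.mapDomain π = a).filter
          fun a => (Finsupp.weight w a, e - Finsupp.weight w a) = (i, j)).card := by
      rw [← Nat.card_eq_finsetCard]
      refine Nat.card_congr (Equiv.subtypeEquivRight fun a => ?_)
      simp only [Finset.mem_filter, Set.Finite.mem_toFinset, Set.mem_ofPred_eq, Prod.mk.injEq]
      constructor
      · rintro ⟨h1, h2⟩
        exact ⟨⟨by omega, h2⟩, h1, by omega⟩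
      · rintro ⟨⟨-, h2⟩, h1, -⟩
        exact ⟨h1, h2⟩
    rw [hcard, ← Finset.sum_const]
    refine Finset.sum_congr rfl fun a ha => ?_
    simp only [Finset.mem_filter, Set.Finite.mem_toFinset, Set.mem_ofPred_eq, Prod.mk.injEq] at ha
    congr 2
    omega
  · intro a ha
    simp only [Finset.mem_filter, Set.Finite.mem_toFinset, Set.mem_ofPred_eq] at ha
    rw [Finset.HasAntidiagonal.mem_antidiagonal]
    omega

end TraceRelation

/-! ### The polynomial ring generated over a copy of the quotient -/

section Resolution

variable {k : Type*} [Field k] {n : ℕ}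

variable (k n) in
/-- The homogeneous polynomials of degree `e`, for an integer `e`. -/
def intHomogeneous (e : ℤ) : Submodule k (MvPolynomial (Fin n) k) where
  carrier := {x | ∀ b, (b.degree : ℤ) ≠ e → coeff b x = 0}
  zero_mem' := fun b _ => coeff_zero b
  add_mem' := fun hx hy b hb => by rw [coeff_add, hx b hb, hy b hb, add_zero]
  smul_mem' := fun r x hx b hb => by rw [coeff_smul, hx b hb, smul_zero]

theorem intHomogeneous_natCast (e : ℕ) :
    intHomogeneous k n e = homogeneousSubmodule (Fin n) k e := by
  ext x
  refine ⟨fun h b hb => ?_, fun h b hb => ?_⟩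
  · by_contra hne
    refine hb (h b fun h => hne ?_)
    exact (DFunLike.congr_fun Finsupp.degree_eq_weight_one b).symm.trans (by exact_mod_cast h)
  · exact IsHomogeneous.coeff_eq_zero h fun h => hb (by exact_mod_cast h)

theorem intHomogeneous_of_neg {e : ℤ} (he : e < 0) : intHomogeneous k n e = ⊥ := by
  rw [eq_bot_iff]
  intro x hx
  rw [Submodule.mem_bot]
  ext b
  exact hx b (by omega)

theorem mul_mem_intHomogeneous {e : ℤ} {w : ℕ} {g x : MvPolynomial (Fin n) k}
    (hg : g.IsHomogeneous w) (hx : x ∈ intHomogeneous k n e) :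
    g * x ∈ intHomogeneous k n (e + w) := by
  rcases lt_or_ge e 0 with he | he
  · rw [intHomogeneous_of_neg he, Submodule.mem_bot] at hx
    rw [hx, mul_zero]
    exact zero_mem _
  · lift e to ℕ using he
    rw [intHomogeneous_natCast] at hx
    rw [← Nat.cast_add, intHomogeneous_natCast, add_comm]
    exact hg.mul hx

/-- The homogeneous fixed vectors of `p` of degree `e`. -/
def fixedPart (p : Module.End k (MvPolynomial (Fin n) k)) (e : ℤ) :
    Submodule k (MvPolynomial (Fin n) k) :=
  LinearMap.ker (LinearMap.id - p) ⊓ intHomogeneous k n e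

theorem mem_fixedPart {p : Module.End k (MvPolynomial (Fin n) k)} {e : ℤ}
    {x : MvPolynomial (Fin n) k} : x ∈ fixedPart p e ↔ p x = x ∧ x ∈ intHomogeneous k n e := by
  rw [fixedPart, Submodule.mem_inf, LinearMap.mem_ker, LinearMap.sub_apply, LinearMap.id_apply,
    sub_eq_zero, eq_comm]

instance finiteDimensional_intHomogeneous (e : ℤ) :
    FiniteDimensional k (intHomogeneous k n e) := by
  rcases lt_or_ge e 0 with he | he
  · rw [intHomogeneous_of_neg he]
    infer_instance
  · lift e to ℕ using he
    rw [intHomogeneous_natCast]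
    infer_instance

instance finiteDimensional_fixedPart (p : Module.End k (MvPolynomial (Fin n) k)) (e : ℤ) :
    FiniteDimensional k (fixedPart p e) :=
  Submodule.finiteDimensional_of_le (inf_le_right : _ ≤ intHomogeneous k n e)

theorem fixedPart_of_neg (p : Module.End k (MvPolynomial (Fin n) k)) {e : ℤ} (he : e < 0) :
    fixedPart p e = ⊥ := by
  rw [fixedPart, intHomogeneous_of_neg he, inf_bot_eq]

/-- Surjectivity by induction on the degree: x - p x is a combination of the generators whose
coefficients may be taken homogeneous, and of smaller degree because the weights are positive. -/
theorem map_aeval_weightedPart {I : Ideal (MvPolynomial (Fin n) k)}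
    {p : Module.End k (MvPolynomial (Fin n) k)}
    (hp : ∀ e x, x.IsHomogeneous e → (p x).IsHomogeneous e) (hpI : ∀ x, x - p x ∈ I)
    (hp0 : ∀ x ∈ I, p x = 0) {κ : Type*} [Fintype κ] {g : κ → MvPolynomial (Fin n) k} {w : κ → ℕ}
    (hw : ∀ i, w i ≠ 0) (hg : ∀ i, (g i).IsHomogeneous (w i))
    (hgI : Ideal.span (Set.range g) = I) (e : ℕ) :
    (weightedPart (fixedPart p) w e).map
      ((aeval g : MvPolynomial κ (MvPolynomial (Fin n) k) →ₐ[MvPolynomial (Fin n) k] _)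
        |>.restrictScalars k).toLinearMap = intHomogeneous k n e := by
  apply le_antisymm
  · rw [Submodule.map_le_iff_le_comap]
    refine weightedPart_le (S := fun e => (intHomogeneous k n e).comap
      ((aeval g : MvPolynomial κ (MvPolynomial (Fin n) k) →ₐ[MvPolynomial (Fin n) k] _)
        |>.restrictScalars k).toLinearMap) (fun e x hx => ?_) (fun e i F hF => ?_) e
    · change aeval g (C x) ∈ intHomogeneous k n e
      rw [aeval_C]
      exact (mem_fixedPart.1 hx).2
    · change aeval g (X i * F) ∈ intHomogeneous k n _
      rw [map_mul, aeval_X]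
      exact mul_mem_intHomogeneous (hg i) hF
  · induction e using Nat.strong_induction_on with
    | _ e ih =>
      intro x hx
      have hx' : x.IsHomogeneous e := by rwa [intHomogeneous_natCast] at hx
      have hpx : p x ∈ fixedPart p e := by
        refine mem_fixedPart.2 ⟨?_, ?_⟩
        · have := hp0 _ (hpI x)
          rwa [map_sub, sub_eq_zero, eq_comm] at this
        · rw [intHomogeneous_natCast]
          exact hp e x hx'
      have hxI := hpI x
      rw [← hgI] at hxI
      obtain ⟨r, hr⟩ := Ideal.mem_span_range_iff_exists_fun.1 hxI
      have hx2 : x = p x + ∑ i,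
          if w i ≤ e then g i * homogeneousComponent (e - w i) (r i) else 0 := by
        rw [← sub_eq_iff_eq_add']
        conv_lhs => rw [← homogeneousComponent_eq_self (hx'.sub (hp e x hx')), ← hr]
        rw [map_sum]
        exact Finset.sum_congr rfl fun i _ => by
          rw [mul_comm, homogeneousComponent_mul_of_isHomogeneous (hg i)]
      rw [hx2]
      refine add_mem ⟨C (p x), C_mem_weightedPart hpx, ?_⟩ (Submodule.sum_mem _ fun i _ => ?_)
      · exact aeval_C _ _
      · split_ifs with h
        · obtain ⟨F, hF, hFr⟩ := ih (e - w i) (by have := hw i; omega) (x :=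
            homogeneousComponent (e - w i) (r i)) (by
              rw [intHomogeneous_natCast]
              exact homogeneousComponent_isHomogeneous _ _)
          refine ⟨X i * F, X_mul_mem_weightedPart hF i (by omega), ?_⟩
          change aeval g (X i * F) = _
          rw [map_mul, aeval_X, ← hFr]
          rfl
        · exact zero_mem _

/-- The projection p has kernel I and commutes with the group, so its fixed vectors map
isomorphically and equivariantly onto R/I, degree by degree. -/
theorem character_quotientGrading {I : Ideal (MvPolynomial (Fin n) k)} (hI : IsSymStable I)
    {p : Module.End k (MvPolynomial (Fin n) k)}
    (hp : ∀ e x, x.IsHomogeneous e → (p x).IsHomogeneous e) (hpI : ∀ x, x - p x ∈ I)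
    (hp0 : ∀ x ∈ I, p x = 0) (hpσ : ∀ (σ : Equiv.Perm (Fin n)) x, p (rename σ x) = rename σ (p x))
    (e : ℕ) (σ : Equiv.Perm (Fin n)) :
    (quotientGrading I hI e).toRepresentation.character σ =
      traceOn (polyRep k n σ) (fixedPart p e) := by
  have hst : ∀ x ∈ fixedPart p e, polyRep k n σ x ∈ fixedPart p e := by
    intro x hx
    rw [mem_fixedPart, intHomogeneous_natCast] at hx ⊢
    exact ⟨(hpσ σ x).trans (congrArg _ hx.1), hx.2.rename_isHomogeneous⟩
  have hmap : (quotientGrading I hI e).toSubmodule =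
      (fixedPart p e).map (idealRep I hI).toSubmodule.mkQ := by
    change (homogeneousSubmodule (Fin n) k e).map (idealRep I hI).toSubmodule.mkQ = _
    apply le_antisymm
    · rintro _ ⟨x, hx, rfl⟩
      refine ⟨p x, mem_fixedPart.2 ⟨?_, ?_⟩, ?_⟩
      · have := hp0 _ (hpI x)
        rwa [map_sub, sub_eq_zero, eq_comm] at this
      · rw [intHomogeneous_natCast]
        exact hp e x hx
      · refine (((Submodule.Quotient.eq _).2 ?_)).symm
        exact hpI x
    · refine Submodule.map_mono fun x hx => ?_
      rw [← intHomogeneous_natCast]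
      exact (mem_fixedPart.1 hx).2
  rw [character_toRepresentation, hmap]
  refine traceOn_map_of_injOn _ (fun x _ => rfl) hst fun x hx h0 => ?_
  rw [← (mem_fixedPart.1 hx).1]
  exact hp0 x ((Submodule.Quotient.mk_eq_zero _).1 h0)

end Resolution

/-! ### The character formula -/

section CharacterFormula

variable {k : Type*} [Field k] {n m : ℕ}

/-- The last f is minus the sum of the others, so its coefficient is subtracted from theirs.
Conversely, a relation extended by the coefficient 0 at the last place has constant coefficients on
the f's, which are therefore all zero. -/
theorem minimal_generators_of_sum_eq_zero {I : Ideal (MvPolynomial (Fin (n + 1)) k)}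
    {f : Fin (n + 1) → MvPolynomial (Fin (n + 1)) k} {z : Fin m → MvPolynomial (Fin (n + 1)) k}
    (hf0 : ∑ i, f i = 0)
    (hspan : ∀ x ∈ I, ∃ (a : Fin (n + 1) → k) (b : Fin m → k),
      x - (∑ i, a i • f i + ∑ j, b j • z j) ∈ irrelevant k (n + 1) * I)
    (hli : ∀ (a : Fin (n + 1) → k) (b : Fin m → k),
      ∑ i, a i • f i + ∑ j, b j • z j ∈ irrelevant k (n + 1) * I →
        (∀ i j, a i = a j) ∧ ∀ j, b j = 0) :
    (∀ x ∈ I, ∃ b : Fin n ⊕ Fin m → k,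
      x - ∑ j, b j • Sum.elim (f ∘ Fin.castSucc) z j ∈ irrelevant k (n + 1) * I) ∧
    ∀ b : Fin n ⊕ Fin m → k,
      ∑ j, b j • Sum.elim (f ∘ Fin.castSucc) z j ∈ irrelevant k (n + 1) * I → ∀ j, b j = 0 := by
  rw [Fin.sum_univ_castSucc, ← eq_neg_iff_add_eq_zero] at hf0
  refine ⟨fun x hx => ?_, fun b hb => ?_⟩
  · obtain ⟨a, b, hab⟩ := hspan x hx
    refine ⟨Sum.elim (fun i => a i.castSucc - a (Fin.last n)) b, ?_⟩
    convert hab using 2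
    simp only [Fintype.sum_sum_type, Sum.elim_inl, Sum.elim_inr, Function.comp_apply,
      Fin.sum_univ_castSucc, sub_smul, Finset.sum_sub_distrib, ← Finset.smul_sum, hf0]
    rw [smul_neg, sub_neg_eq_add]
  · have h := hli (Fin.snoc (α := fun _ => k) (fun i => b (Sum.inl i)) 0)
      (fun j => b (Sum.inr j)) (by
        simpa [Fintype.sum_sum_type, Fin.sum_univ_castSucc] using hb)
    rintro (i | j)
    · simpa using h.1 i.castSucc (Fin.last n)
    · exact h.2 j

/-- The relation between the characters of `R` and `R/I` at a permutation `σ` which comes from the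
resolution of `R` by the polynomials in the generators of `I` with coefficients in `R/I`. -/
theorem mk_fixedMonomials_eq [CharZero k] {I : Ideal (MvPolynomial (Fin (n + 1)) k)} (hn : n ≠ 0)
    (hhom : IsHomogeneousIdeal I) (hstab : IsSymStable I) (hci : IsCompleteIntersection I)
    {d : ℕ} {c : Fin m → ℕ}
    {f : Fin (n + 1) → MvPolynomial (Fin (n + 1)) k} {z : Fin m → MvPolynomial (Fin (n + 1)) k}
    (hf : ∀ i, f i ∈ I) (hz : ∀ j, z j ∈ I) (hfd : ∀ i, (f i).IsHomogeneous d)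
    (hzc : ∀ j, (z j).IsHomogeneous (c j))
    (hfσ : ∀ (σ : Equiv.Perm (Fin (n + 1))) i, rename σ (f i) = f (σ i))
    (hzσ : ∀ (σ : Equiv.Perm (Fin (n + 1))) j, rename σ (z j) = z j) (hf0 : ∑ i, f i = 0)
    (hspan : ∀ x ∈ I, ∃ (a : Fin (n + 1) → k) (b : Fin m → k),
      x - (∑ i, a i • f i + ∑ j, b j • z j) ∈ irrelevant k (n + 1) * I)
    (hli : ∀ (a : Fin (n + 1) → k) (b : Fin m → k),
      ∑ i, a i • f i + ∑ j, b j • z j ∈ irrelevant k (n + 1) * I →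
        (∀ i j, a i = a j) ∧ ∀ j, b j = 0) :
    d ≠ 0 ∧ (∀ j, c j ≠ 0) ∧ ∀ σ : Equiv.Perm (Fin (n + 1)),
      (PowerSeries.mk fun e => (fixedMonomials σ e : k)) =
        (1 - PowerSeries.X ^ d) * (fixedSeries k (Equiv.sumCongr σ (1 : Equiv.Perm (Fin m)))
          (Sum.elim (fun _ => d) c) *
          PowerSeries.mk fun e => (quotientGrading I hstab e).toRepresentation.character σ) := by
  obtain ⟨hspan', hli'⟩ := minimal_generators_of_sum_eq_zero hf0 hspan hli
  obtain ⟨hgI, hreg, hw⟩ := isQuasiRegular_of_minimal_generators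
    (w := Sum.elim (fun _ => d) c) hhom hci
    (by rintro (i | j); exacts [hf _, hz j]) (by rintro (i | j); exacts [hfd _, hzc j]) hspan' hli'
  have hd : d ≠ 0 := hw (Sum.inl ⟨0, Nat.pos_of_ne_zero hn⟩)
  have hc : ∀ j, c j ≠ 0 := fun j => hw (Sum.inr j)
  refine ⟨hd, hc, fun σ => ?_⟩
  obtain ⟨p, hp, hpI, hp0, hpσ⟩ := exists_equivariant_graded_projection hhom hstab
  let κ := Fin (n + 1) ⊕ Fin m
  let g : κ → MvPolynomial (Fin (n + 1)) k := Sum.elim f z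
  let w : κ → ℕ := Sum.elim (fun _ => d) c
  let π : Equiv.Perm κ := Equiv.sumCongr σ 1
  let emb : Fin n ⊕ Fin m → κ := Sum.map Fin.castSucc id
  let l : κ := Sum.inl (Fin.last n)
  -- With this choice y is the sum of all variables attached to the f's, which is invariant under σ.
  let s : Finset (Fin n ⊕ Fin m) := Finset.univ.map Function.Embedding.inl
  have hgemb : g ∘ emb = Sum.elim (f ∘ Fin.castSucc) z := by
    ext1 (i | j) <;> rfl
  have hgmem : ∀ i, g i ∈ I := by rintro (i | j); exacts [hf i, hz j]
  have hgspan : Ideal.span (Set.range g) = I := by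
    refine le_antisymm (Ideal.span_le.2 (by rintro _ ⟨i, rfl⟩; exact hgmem i)) ?_
    rw [← hgI, ← hgemb]
    exact Ideal.span_mono (Set.range_comp_subset_range _ _)
  have hw' : ∀ i, w i ≠ 0 := by rintro (i | j); exacts [hd, hc j]
  have hπ : ∀ i, w (π i) = w i := by rintro (i | j) <;> rfl
  have hgw : ∀ i, (g i).IsHomogeneous (w i) := by rintro (i | j); exacts [hfd i, hzc j]
  have hA : ∀ e, ∀ x ∈ fixedPart p e, rename σ x ∈ fixedPart p e := by
    intro e x hx
    rcases lt_or_ge e 0 with he | he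
    · rw [fixedPart_of_neg p he, Submodule.mem_bot] at hx
      rw [hx, map_zero]
      exact zero_mem _
    · lift e to ℕ using he
      rw [mem_fixedPart, intHomogeneous_natCast] at hx ⊢
      exact ⟨(hpσ σ x).trans (congrArg _ hx.1), hx.2.rename_isHomogeneous⟩
  have hneg : ∀ e < 0, fixedPart p e = ⊥ := fun e he => fixedPart_of_neg p he
  have hsum : X l + ∑ j ∈ s, X (emb j) =
      (∑ i, X (Sum.inl i) : MvPolynomial κ (MvPolynomial (Fin (n + 1)) k)) := by
    rw [Fin.sum_univ_castSucc, Finset.sum_map]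
    exact add_comm _ _
  have hrel : ∀ e : ℕ, (fixedMonomials σ e : k) =
      traceOn (semiRename k (rename σ) π) (weightedPart (fixedPart p) w e) -
        traceOn (semiRename k (rename σ) π) (weightedPart (fixedPart p) w (e - d)) := by
    intro e
    rw [traceOn_weightedPart_relation (B := intHomogeneous k (n + 1)) hw' hneg (σ := rename σ) hA hπ
      (g := g) (by rintro (i | j); exacts [hfσ σ i, hzσ σ j]) emb l ?_ ?_ s ?_ ?_ ?_
      (by rw [hgemb]; exact hreg) ?_ (map_aeval_weightedPart hp hpI hp0 hw' hgw hgspan e),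
      intHomogeneous_natCast]
    · rw [← traceOn_homogeneousSubmodule]
      exact (add_sub_cancel_left _ _).symm
    · rintro (i | j)
      · induction i using Fin.lastCases with
        | last => exact Or.inl rfl
        | cast i => exact Or.inr ⟨Sum.inl i, rfl⟩
      · exact Or.inr ⟨Sum.inr j, rfl⟩
    · rintro (i | j) h
      · exact Fin.castSucc_ne_last i (Sum.inl_injective h)
      · exact Sum.inr_ne_inl h
    · intro j hj
      obtain ⟨i, -, rfl⟩ := Finset.mem_map.1 hj
      rfl
    · rw [Fin.sum_univ_castSucc] at hf0
      rw [Finset.sum_map]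
      exact (add_comm _ _).trans hf0
    · rw [hsum, map_sum]
      simp only [rename_X]
      exact Equiv.sum_comp σ fun i => (X (Sum.inl i) : MvPolynomial κ _)
    · intro e x hx hxI
      rw [hgemb, hgI] at hxI
      rw [← (mem_fixedPart.1 hx).1]
      exact hp0 x hxI
  have hchar : (PowerSeries.mk fun e => (quotientGrading I hstab e).toRepresentation.character σ) =
      PowerSeries.mk fun e : ℕ =>
        traceOn (rename σ : _ →ₐ[k] MvPolynomial (Fin (n + 1)) k).toLinearMap (fixedPart p e) := by
    ext e
    rw [PowerSeries.coeff_mk, PowerSeries.coeff_mk,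
      character_quotientGrading hstab hp hpI hp0 hpσ e σ]
    rfl
  have hN : ∀ e : ℕ, traceOn (semiRename k (rename σ) π) (weightedPart (fixedPart p) w e) = _ :=
    fun e => traceOn_weightedPart_eq_coeff hw' hneg hA hπ e
  ext e
  rw [hchar, sub_mul, one_mul, map_sub, PowerSeries.coeff_X_pow_mul', PowerSeries.coeff_mk, hrel,
    hN]
  congr 1
  split_ifs with h
  · rw [← hN, Nat.cast_sub h]
  -- For e < d every coefficient would have negative degree, in agreement with the vanishing
  -- coefficient of the series multiplied by t^d.
  · have : weightedPart (fixedPart p) w ((e : ℤ) - d) = ⊥ := by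
      rw [eq_bot_iff]
      intro F hF
      rw [Submodule.mem_bot]
      ext1 a
      have := hF a
      rwa [hneg _ (by omega), Submodule.mem_bot] at this
    rw [this, traceOn_bot]

theorem mk_character_quotientGrading [CharZero k] {I : Ideal (MvPolynomial (Fin n) k)} (hn : 2 ≤ n)
    (hhom : IsHomogeneousIdeal I) (hstab : IsSymStable I) (hci : IsCompleteIntersection I)
    {d : ℕ} {c : Fin m → ℕ}
    (hgen : GradedIso (generatorGrading I hstab)
      (sumTrivialGrading (spechtRep k n (standardShape n hn)) d c))
    (σ : Equiv.Perm (Fin n)) :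
    (PowerSeries.mk fun e => (quotientGrading I hstab e).toRepresentation.character σ) =
      (PowerSeries.mk fun e => (fixedMonomials σ e : k)) *
        (∑ u : Fin n, (-1) ^ (u : ℕ) * PowerSeries.C (boundaryTrace k σ u) *
          PowerSeries.X ^ (d * (u : ℕ))) * ∏ i : Fin m, (1 - PowerSeries.X ^ c i) := by
  obtain ⟨f, z, hf, hz, hfd, hzc, hfσ, hzσ, hf0, hspan, hli⟩ :=
    exists_equivariant_generators_of_standard hn hstab hgen
  obtain ⟨n, rfl⟩ : ∃ n', n = n' + 1 := ⟨n - 1, by omega⟩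
  obtain ⟨hd, hc, hmain⟩ := mk_fixedMonomials_eq (by omega) hhom hstab hci hf hz hfd hzc hfσ hzσ hf0
    hspan hli
  have h1 := altTrace_mul_fixedMonomials (k := k) σ
  have h2 := one_sub_X_mul_boundaryTrace (k := k) σ 0
  have h3 := congrArg (PowerSeries.expand d hd) h1
  have h4 := congrArg (PowerSeries.expand d hd) h2
  have h5 := congrArg (PowerSeries.expand d hd) (mk_boundaryTrace (k := k) σ)
  rw [map_mul, map_one] at h3
  rw [map_mul, map_sub, map_one, PowerSeries.expand_X] at h4
  have h6 : PowerSeries.expand d hd (∑ u : Fin (n + 1), (-1) ^ (u : ℕ) *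
      PowerSeries.C (boundaryTrace k σ u) * PowerSeries.X ^ (u : ℕ)) =
      ∑ u : Fin (n + 1), (-1) ^ (u : ℕ) * PowerSeries.C (boundaryTrace k σ u) *
        PowerSeries.X ^ (d * (u : ℕ)) := by
    rw [map_sum]
    refine Finset.sum_congr rfl fun u _ => ?_
    rw [map_mul, map_mul, map_pow, map_pow, map_neg, map_one, PowerSeries.expand_C,
      PowerSeries.expand_X, ← pow_mul]
  rw [← h6, ← h5]
  have h7 := hmain σ
  have h8 := fixedSeries_const (k := k) σ hd
  have h9 := fixedSeries_one_mul_prod (k := k) hc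
  rw [fixedSeries_sum _ _ (fun _ => hd) hc] at h7
  conv_rhs => rw [h7]
  rw [← h8] at h3
  -- In the notation of the overview, after t ↦ t^d: `h4` turns (1 - t^d) H(t^d) into the signed
  -- exterior series, `h3` cancels that against P(t^d), and `h9` cancels the series of the invariant
  -- generators against ∏ (1 - t^{c_j}).
  linear_combination
    (-(PowerSeries.mk fun e => (quotientGrading I hstab e).toRepresentation.character σ)) * h3 -
    (PowerSeries.mk fun e => (quotientGrading I hstab e).toRepresentation.character σ) *
      fixedSeries k σ (fun _ => d) * fixedSeries k 1 c * (∏ i : Fin m, (1 - PowerSeries.X ^ c i)) *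
      h4 -
    (PowerSeries.mk fun e => (quotientGrading I hstab e).toRepresentation.character σ) *
      fixedSeries k σ (fun _ => d) *
      PowerSeries.expand d hd (PowerSeries.mk fun u => (-1) ^ u * altTrace k σ u) * h9

end CharacterFormula

end SymCI

end

theorem theorem3 {k : Type*} [Field k] [CharZero k] (n : ℕ) (hn : 2 ≤ n)
    (I : Ideal (MvPolynomial (Fin n) k))
    (hhom : SymCI.IsHomogeneousIdeal I)
    (hstab : SymCI.IsSymStable I)
    (hci : SymCI.IsCompleteIntersection I)
    (d m : ℕ) (c : Fin m → ℕ)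
    (hgen : SymCI.GradedIso (SymCI.generatorGrading I hstab)
      (SymCI.sumTrivialGrading (SymCI.spechtRep k n (SymCI.standardShape n hn)) d c)) :
    SymCI.gradedChar (SymCI.quotientGrading I hstab) =
      SymCI.gradedChar (SymCI.polyGrading k n) *
        (∑ u : Fin n, (-1) ^ (u : ℕ) *
          PowerSeries.C (SymCI.spechtChar k n (SymCI.hook n u)) *
            PowerSeries.X ^ (d * (u : ℕ))) *
        ∏ i : Fin m, (1 - PowerSeries.X ^ (c i)) := by
  ext e σ
  -- Operations on class functions are pointwise, so evaluation at σ is a ring homomorphism and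
  -- carries the right-hand side to the scalar identity at σ.
  let ev : SymCI.ClassFunction k (Equiv.Perm (Fin n)) →+* k :=
    (Pi.evalRingHom (fun _ => k) σ).comp (Subring.subtype _)
  have h := congrArg (PowerSeries.coeff e)
    (SymCI.mk_character_quotientGrading hn hhom hstab hci hgen σ)
  have hR : PowerSeries.map ev (SymCI.gradedChar (SymCI.polyGrading k n)) =
      PowerSeries.mk fun e => (SymCI.fixedMonomials σ e : k) := by
    ext e
    rw [PowerSeries.coeff_map, SymCI.gradedChar, PowerSeries.coeff_mk, PowerSeries.coeff_mk,
      ← SymCI.traceOn_homogeneousSubmodule]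
    exact SymCI.character_toRepresentation (SymCI.polyGrading k n e) σ
  have hrhs : ∀ F : PowerSeries (SymCI.ClassFunction k (Equiv.Perm (Fin n))),
      (PowerSeries.coeff e F).1 σ = PowerSeries.coeff e (PowerSeries.map ev F) := fun F => by
    rw [PowerSeries.coeff_map]
    rfl
  rw [hrhs, hrhs, map_mul (PowerSeries.map ev), map_mul (PowerSeries.map ev), hR,
    map_sum (PowerSeries.map ev), map_prod (PowerSeries.map ev)]
  simp only [map_mul, map_pow, map_neg, map_one, map_sub, PowerSeries.map_C, PowerSeries.map_X]
  have hu : ∀ u : Fin n, ev (SymCI.spechtChar k n (SymCI.hook n u)) =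
      SymCI.boundaryTrace k σ u := fun u => SymCI.spechtChar_hook u σ
  simp only [hu]
  rw [← h, PowerSeries.coeff_map, PowerSeries.coeff_mk, SymCI.gradedChar, PowerSeries.coeff_mk]
  rfl
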